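/- **Setting.** Let $k$ be a field. All categories and functors below are $k$-linear. A *monoidal category* means a locally presentable monoidal category whose tensor product preserves small colimits in each variable. An object $x$ is *compact projective* if $\mathrm{Hom}(x,-)$, with values in $k$-vector spaces, preserves small colimits; $\mathcal{C}^{\mathrm{cp}}$ is the full subcategory of compact projective objects. A monoidal category $\mathcal{C}$ is *cp-rigid* if its compact projective objects form a strong generator (equivalently, $\mathcal{C}\simeq\mathrm{Fun}((\mathcal{C}^{\mathrm{cp}})^{\mathrm{op}},\mathrm{Vect})$) and each of them has a left and a right dual. We write $x^\vee$ for the dual with evaluation $x^\vee\otimes x\to\mathbf 1$. Let $\mathcal{C}$ be a cp-rigid monoidal category whose unit is compact projective, and let $(\mathcal{L},\tau)$, $\tau_x\colon x\otimes\mathcal{L}\cong\mathcal{L}\otimes x$, be a commutative algebra in the Drinfeld center of $\mathcal{C}$. Let $\mathrm{HC}=\mathrm{LMod}_{\mathcal{L}}(\mathcal{C})$ be the category of left $\mathcal{L}$-modules, with the relative tensor product $\otimes_{\mathcal{L}}$, where the right action on a left module is the left action composed with $\tau$. For $\mathcal{H}=\mathcal{C}$ or $\mathcal{H}=\mathrm{HC}$,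 the category $\mathcal{H}\otimes\mathcal{H}$ is the category of $k$-linear functors $X\colon(\mathcal{H}^{\mathrm{cp}})^{\mathrm{op}}\to\mathcal{H}$, where $M_1\boxtimes M_2$ is the functor $c\mapsto \mathrm{Hom}(c,M_2)\otimes M_1$. An algebra in $\mathcal{H}\otimes\mathcal{H}^{\otimes\mathrm{op}}$ is such a functor with a unit $\mathbf 1\to X(\mathbf 1)$ and products $X(c)\otimes X(d)\to X(d\otimes c)$ making it lax monoidal. For $X\in\mathrm{HC}\otimes\mathrm{HC}$ and $M\in\mathrm{HC}$ put $$X\times_{\mathcal{L}}M=\int^{c\in\mathrm{HC}^{\mathrm{cp}}}\mathrm{Hom}_{\mathrm{HC}}(\mathbf 1,c\otimes_{\mathcal{L}} M)\otimes X(c),$$ so that $(M_1\boxtimes M_2)\times_{\mathcal{L}}M=\mathrm{Hom}(\mathbf 1,M_2\otimes_{\mathcal{L}} M)\otimes M_1$. The *Takeuchi product* on $\mathrm{HC}\otimes\mathrm{HC}$ is $(X\times_{\mathcal{L}}Y)(c)=X\times_{\mathcal{L}}Y(c)$; its unit is $\mathcal{D}\colon c\mapsto c^\vee$. A *Harish-Chandra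 bialgebroid* is an algebra $B$ in $\mathcal{C}\otimes\mathcal{C}^{\otimes\mathrm{op}}$ with a quantum moment map $s\otimes t\colon\mathcal{L}\boxtimes\mathcal{L}^{\mathrm{op}}\to B$ (an algebra map that is central with respect to $\tau$), through which $B$ is regarded as an algebra in $\mathrm{HC}\otimes\mathrm{HC}^{\otimes\mathrm{op}}$, together with a coproduct $\Delta\colon B\to B\times_{\mathcal{L}}B$ and a counit $\varepsilon\colon B\to\mathcal{D}$ which are coassociative and counital and are maps of algebras in $\mathrm{HC}\otimes\mathrm{HC}^{\otimes\mathrm{op}}$. Then $B\times_{\mathcal{L}}(-)$ is a lax monoidal comonad on $\mathrm{HC}$. A *$B$-comodule* is an object $M\in\mathrm{HC}$ with a coassociative and counital coaction $M\to B\times_{\mathcal{L}}M$. The $B$-comodules form a category $\mathrm{CoMod}_B(\mathrm{HC})$, which is monoidal in such a way that the forgetful functor $U$ to $\mathrm{HC}$ is monoidal. **Theorem.** Let $\mathcal{D}'$ be a monoidal category and $F\colon\mathcal{D}'\to\mathrm{HC}$ a ($k$-linear, strong) monoidal functor with a right adjoint $F^{\mathrm R}$ that preserves small colimits; let $\eta$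 be the unit of the adjunction. Then there are 1. a Harish-Chandra bialgebroid $B$ and an isomorphism of lax monoidal comonads $e\colon F F^{\mathrm R}\cong B\times_{\mathcal{L}}(-)$; 2. a monoidal functor $G\colon\mathcal{D}'\to\mathrm{CoMod}_B(\mathrm{HC})$ and a monoidal isomorphism $U\circ G\cong F$ which, for each $d\in\mathcal{D}'$, identifies the coaction of $G(d)$ with $$F(d)\xrightarrow{F(\eta_d)}F F^{\mathrm R}F(d)\xrightarrow{e_{F(d)}}B\times_{\mathcal{L}}F(d).$$ If moreover $F$ is conservative and preserves equalizers, then $G$ is an equivalence. -/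

import Mathlib

universe w v u u'

namespace HarishChandra

noncomputable section

set_option linter.unusedSectionVars false

open CategoryTheory Category MonoidalCategory Limits Opposite MonObj

/-- A monoidal structure on a locally presentable category whose tensor product preserves small
colimits in each variable. -/
class PresentablyMonoidal (C : Type u) [Category.{v} C] [MonoidalCategory C] : Prop where
  presentable : IsLocallyPresentable.{v} C
  preservesLeft : ∀ X : C, PreservesColimitsOfSize.{v, v} (tensorLeft X)
  preservesRight : ∀ X : C, PreservesColimitsOfSize.{v, v} (tensorRight X)

section
variable {C : Type u} [Category.{v} C] [MonoidalCategory C] [PresentablyMonoidal C]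

instance : IsLocallyPresentable.{v} C := PresentablyMonoidal.presentable
instance (X : C) : PreservesColimitsOfSize.{v, v} (tensorLeft X) :=
  PresentablyMonoidal.preservesLeft X
instance (X : C) : PreservesColimitsOfSize.{v, v} (tensorRight X) :=
  PresentablyMonoidal.preservesRight X
instance (X : C) : PreservesColimitsOfSize.{0, 0} (tensorLeft X) :=
  preservesSmallestColimits_of_preservesColimits _
instance (X : C) : PreservesColimitsOfSize.{0, 0} (tensorRight X) :=
  preservesSmallestColimits_of_preservesColimits _
instance : HasColimitsOfSize.{v, v} C := by
  obtain ⟨κ, _, _⟩ := IsLocallyPresentable.exists_cardinal.{v} C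
  infer_instance
end

section HC
variable {C : Type u} [Category.{v} C] [MonoidalCategory C]

/-- The underlying object of `L`. -/
def base (L : Center C) : C := L.1

section
variable (L : Center C)

/-- The isomorphism `τ : U ⊗ L ≅ L ⊗ U` given by the half-braiding. -/
def τ (U : C) : U ⊗ base L ≅ base L ⊗ U := (L.2.β U).symm

lemma τ_naturality {U V : C} (f : U ⟶ V) :
    f ▷ base L ≫ (τ L V).hom = (τ L U).hom ≫ base L ◁ f := by
  have := L.2.naturality f
  change f ▷ L.1 ≫ (L.2.β V).inv = (L.2.β U).inv ≫ L.1 ◁ f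
  rw [Iso.comp_inv_eq, assoc, this, Iso.inv_hom_id_assoc]

lemma τ_tensor (U V : C) : (τ L (U ⊗ V)).hom =
    (α_ _ _ _).hom ≫ U ◁ (τ L V).hom ≫ (α_ _ _ _).inv ≫ (τ L U).hom ▷ V ≫
      (α_ _ _ _).hom := by
  have := L.2.monoidal U V
  change (L.2.β (U ⊗ V)).inv =
    (α_ _ _ _).hom ≫ U ◁ (L.2.β V).inv ≫ (α_ _ _ _).inv ≫ (L.2.β U).inv ▷ V ≫
      (α_ _ _ _).hom
  rw [← cancel_mono (L.2.β (U ⊗ V)).hom, Iso.inv_hom_id, this]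
  simp

variable [MonObj L]

instance : MonObj (base L) where
  one := η[L].f
  mul := μ[L].f
  one_mul := congrArg Center.Hom.f (MonObj.one_mul L)
  mul_one := congrArg Center.Hom.f (MonObj.mul_one L)
  mul_assoc := congrArg Center.Hom.f (MonObj.mul_assoc L)

lemma whiskerLeft_one_τ (U : C) :
    U ◁ η[base L] ≫ (τ L U).hom = (ρ_ U).hom ≫ (λ_ U).inv ≫ η[base L] ▷ U := by
  have : η[base L] ▷ U ≫ (τ L U).inv = ((λ_ U).hom ≫ (ρ_ U).inv) ≫ U ◁ η[base L] := by
    have := Center.Hom.comm η[L] U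
    rw [Center.tensorUnit_β] at this
    exact this
  rw [← Iso.eq_comp_inv]
  simp [this]

lemma whiskerLeft_mul_τ (U : C) :
    U ◁ μ[base L] ≫ (τ L U).hom = (α_ _ _ _).inv ≫ (τ L U).hom ▷ base L ≫ (α_ _ _ _).hom ≫
      base L ◁ (τ L U).hom ≫ (α_ _ _ _).inv ≫ μ[base L] ▷ U := by
  have : μ[base L] ▷ U ≫ (τ L U).inv = ((α_ _ _ _).hom ≫ base L ◁ (τ L U).inv ≫
      (α_ _ _ _).inv ≫ (τ L U).inv ▷ base L ≫ (α_ _ _ _).hom) ≫ U ◁ μ[base L] := by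
    have := Center.Hom.comm μ[L] U
    rw [Center.tensor_β] at this
    refine this.trans ?_
    simp [τ, base]
    rfl
  rw [← Iso.eq_comp_inv]
  simp [this]

lemma τ_mul [IsCommMonObj L] : (τ L (base L)).hom ≫ μ[base L] = μ[base L] := by
  rw [← Iso.eq_inv_comp]
  exact (congrArg Center.Hom.f (IsCommMonObj.mul_comm L)).symm

/-- The category `HC` of Harish-Chandra bimodules: left `L`-modules in `C`. -/
abbrev HC : Type _ := Mod C (base L)

end

namespace HC
section
variable {L : Center C} [MonObj L]

/-- The left action of `L`. -/
abbrev act (M : HC L) : base L ⊗ M.X ⟶ M.X := ModObj.smul (M := base L) (X := M.X)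

lemma one_act (M : HC L) : η[base L] ▷ M.X ≫ M.act = (λ_ M.X).hom :=
  ModObj.one_smul (M := base L) M.X
lemma mul_act (M : HC L) :
    μ[base L] ▷ M.X ≫ M.act = (α_ _ _ _).hom ≫ base L ◁ M.act ≫ M.act :=
  ModObj.mul_smul (M := base L) M.X

/-- A left `L`-module from its action map. -/
abbrev of (X : C) (a : base L ⊗ X ⟶ X) (h₁ : η[base L] ▷ X ≫ a = (λ_ X).hom)
    (h₂ : μ[base L] ▷ X ≫ a = (α_ _ _ _).hom ≫ base L ◁ a ≫ a) : HC L :=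
  letI : ModObj (base L) X := ⟨a, h₁, h₂⟩
  ⟨X⟩

/-- An `L`-linear map. -/
abbrev homOf {M N : HC L} (f : M.X ⟶ N.X) (h : M.act ≫ f = base L ◁ f ≫ N.act) : M ⟶ N :=
  Mod.Hom.mk' f h

lemma act_hom {M N : HC L} (f : M ⟶ N) : M.act ≫ f.hom = base L ◁ f.hom ≫ N.act :=
  IsModHom.smul_hom (A := base L) (f := f.hom)

/-- The right action of `L`, induced by the left action through `τ`. -/
def rightAct (M : HC L) : M.X ⊗ base L ⟶ M.X := (τ L M.X).hom ≫ M.act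

lemma rightAct_hom {M N : HC L} (f : M ⟶ N) :
    M.rightAct ≫ f.hom = f.hom ▷ base L ≫ N.rightAct := by
  rw [rightAct, assoc, act_hom, rightAct, reassoc_of% τ_naturality]

lemma rightAct_one (M : HC L) : M.X ◁ η[base L] ≫ M.rightAct = (ρ_ M.X).hom := by
  rw [rightAct, reassoc_of% whiskerLeft_one_τ, one_act]; simp

variable [IsCommMonObj L]

lemma act_rightAct (M : HC L) :
    M.act ▷ base L ≫ M.rightAct = (α_ _ _ _).hom ≫ base L ◁ M.rightAct ≫ M.act := by
  rw [rightAct, reassoc_of% τ_naturality, τ_tensor]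
  have h1 : (τ L (base L)).hom ▷ M.X ≫ (α_ _ _ _).hom ≫ base L ◁ M.act ≫ M.act
    = (α_ _ _ _).hom ≫ base L ◁ M.act ≫ M.act := by
    rw [← mul_act, ← comp_whiskerRight_assoc, τ_mul]
  simp only [assoc, whiskerLeft_comp]
  rw [h1]; simp

lemma rightAct_mul (M : HC L) :
    M.X ◁ μ[base L] ≫ M.rightAct = (α_ _ _ _).inv ≫ M.rightAct ▷ base L ≫ M.rightAct := by
  rw [rightAct, reassoc_of% whiskerLeft_mul_τ, mul_act,
    comp_whiskerRight_assoc, reassoc_of% τ_naturality,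
    τ_tensor]
  have h1 : (τ L (base L)).hom ▷ M.X ≫ (α_ _ _ _).hom ≫ base L ◁ M.act ≫ M.act
    = (α_ _ _ _).hom ≫ base L ◁ M.act ≫ M.act := by
    rw [← mul_act, ← comp_whiskerRight_assoc, τ_mul]
  simp only [assoc]
  rw [h1]

variable (L) in
/-- The underlying monoid of `L` in `C`. -/
abbrev monL : Mon C := ⟨base L⟩

/-- A left `L`-module as an `L`-bimodule. -/
def bimodObj (M : HC L) : Bimod (monL L) (monL L) where
  X := M.X
  actLeft := M.act
  one_actLeft := M.one_act
  left_assoc := M.mul_act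
  actRight := M.rightAct
  actRight_one := M.rightAct_one
  right_assoc := M.rightAct_mul
  middle_assoc := M.act_rightAct

end
end HC
end HC
end
end HarishChandra

namespace HarishChandra

noncomputable section

set_option linter.unusedSectionVars false

open CategoryTheory Category MonoidalCategory Limits Opposite MonObj

section
variable {C : Type u} [Category.{v} C] [MonoidalCategory C] [HasCoequalizers C]
  [∀ X : C, PreservesColimitsOfSize.{0, 0} (tensorLeft X)]
  [∀ X : C, PreservesColimitsOfSize.{0, 0} (tensorRight X)]

/-- Bimodules over a monoid with the relative tensor product. -/
instance (A : Mon C) : MonoidalCategoryStruct (Bimod A A) where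
  tensorObj M N := M.tensorBimod N
  tensorHom {_ M' N _} f g := Bimod.whiskerRight f N ≫ Bimod.whiskerLeft M' g
  whiskerLeft M _ _ f := Bimod.whiskerLeft M f
  whiskerRight f N := Bimod.whiskerRight f N
  tensorUnit := Bimod.regular A
  associator := Bimod.associatorBimod
  leftUnitor := Bimod.leftUnitorBimod
  rightUnitor := Bimod.rightUnitorBimod

instance bimodMonoidal (A : Mon C) : MonoidalCategory (Bimod A A) where
  whiskerLeft_id _ _ := Bimod.whiskerLeft_id_bimod
  id_whiskerRight _ _ := Bimod.id_whiskerRight_bimod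
  tensorHom_comp_tensorHom {X₁ Y₁ Z₁ X₂ Y₂ Z₂} f₁ f₂ g₁ g₂ := by
    change (Bimod.whiskerRight f₁ X₂ ≫ Bimod.whiskerLeft Y₁ f₂) ≫
      (Bimod.whiskerRight g₁ Y₂ ≫ Bimod.whiskerLeft Z₁ g₂) =
      Bimod.whiskerRight (f₁ ≫ g₁) X₂ ≫ Bimod.whiskerLeft Z₁ (f₂ ≫ g₂)
    rw [assoc, ← assoc (Bimod.whiskerLeft _ f₂), Bimod.whisker_exchange_bimod, assoc,
      Bimod.comp_whiskerRight_bimod, Bimod.whiskerLeft_comp_bimod, assoc]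
  id_tensorHom_id M N := by
    change Bimod.whiskerRight (𝟙 M) N ≫ Bimod.whiskerLeft M (𝟙 N) = 𝟙 (M.tensorBimod N)
    rw [Bimod.whiskerLeft_id_bimod, Bimod.id_whiskerRight_bimod, comp_id]
  associator_naturality {X₁ X₂ X₃ Y₁ Y₂ Y₃} f₁ f₂ f₃ := by
    change (Bimod.whiskerRight (Bimod.whiskerRight f₁ X₂ ≫ Bimod.whiskerLeft Y₁ f₂) X₃ ≫
      Bimod.whiskerLeft (Y₁.tensorBimod Y₂) f₃) ≫ (Bimod.associatorBimod Y₁ Y₂ Y₃).hom =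
      (Bimod.associatorBimod X₁ X₂ X₃).hom ≫ Bimod.whiskerRight f₁ (X₂.tensorBimod X₃) ≫
      Bimod.whiskerLeft Y₁ (Bimod.whiskerRight f₂ X₃ ≫ Bimod.whiskerLeft Y₂ f₃)
    rw [Bimod.comp_whiskerRight_bimod, Bimod.whiskerLeft_comp_bimod,
      Bimod.whiskerRight_comp_bimod, Bimod.whisker_assoc_bimod, Bimod.comp_whiskerLeft_bimod]
    simp only [assoc, Iso.inv_hom_id, Iso.hom_inv_id_assoc, Iso.inv_hom_id_assoc, comp_id]
  leftUnitor_naturality {X Y} f := by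
    change Bimod.whiskerLeft _ f ≫ Y.leftUnitorBimod.hom = _
    rw [Bimod.id_whiskerLeft_bimod]; simp; rfl
  rightUnitor_naturality {X Y} f := by
    change Bimod.whiskerRight f _ ≫ Y.rightUnitorBimod.hom = _
    rw [Bimod.whiskerRight_id_bimod]; simp; rfl
  pentagon := Bimod.pentagon_bimod
  triangle := Bimod.triangle_bimod

lemma act_comp_id {X Y : C} (a : Y ⊗ X ⟶ X) : a ≫ 𝟙 X = Y ◁ 𝟙 X ≫ a := by simp
lemma ract_comp_id {X Y : C} (a : X ⊗ Y ⟶ X) : a ≫ 𝟙 X = 𝟙 X ▷ Y ≫ a := by simp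

namespace HC
variable {L : Center C} [MonObj L] [IsCommMonObj L]

lemma hom_ext {M N : HC L} {f g : M ⟶ N} (h : f.hom = g.hom) : f = g := Mod.Hom.ext h

variable (L) in
/-- Every left-module map is a bimodule map. -/
def toBimod : HC L ⥤ Bimod (monL L) (monL L) where
  obj := bimodObj
  map f := { hom := f.hom, left_act_hom := act_hom f, right_act_hom := rightAct_hom f }

instance : (toBimod L).Faithful where
  map_injective h := hom_ext (congrArg Bimod.Hom.hom h)

/-- Every bimodule map is a left-module map. -/
def ofBimodHom {M N : HC L} (f : bimodObj M ⟶ bimodObj N) : M ⟶ N :=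
  homOf f.hom f.left_act_hom

/-- `M ⊗_L N` as a left module. -/
def tensorHC (M N : HC L) : HC L :=
  of ((bimodObj M).tensorBimod (bimodObj N)).X ((bimodObj M).tensorBimod (bimodObj N)).actLeft
    ((bimodObj M).tensorBimod (bimodObj N)).one_actLeft
    ((bimodObj M).tensorBimod (bimodObj N)).left_assoc

/-- The projection `M ⊗ N ⟶ M ⊗_L N`. -/
def π (M N : HC L) : M.X ⊗ N.X ⟶ (tensorHC M N).X :=
  coequalizer.π ((bimodObj M).actRight ▷ (bimodObj N).X) _

instance (M N : HC L) : Epi (π M N) :=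
  inferInstanceAs (Epi (coequalizer.π ((bimodObj M).actRight ▷ (bimodObj N).X)
    ((α_ _ _ _).hom ≫ ((bimodObj M).X ◁ (bimodObj N).actLeft))))
instance (M N : HC L) (Y : C) : Epi (Y ◁ π M N) := by
  have : Epi ((tensorLeft Y).map (coequalizer.π ((bimodObj M).actRight ▷ (bimodObj N).X)
    ((α_ _ _ _).hom ≫ ((bimodObj M).X ◁ (bimodObj N).actLeft)))) := inferInstance
  exact this
instance (M N : HC L) (Y : C) : Epi (π M N ▷ Y) := by
  have : Epi ((tensorRight Y).map (coequalizer.π ((bimodObj M).actRight ▷ (bimodObj N).X)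
    ((α_ _ _ _).hom ≫ ((bimodObj M).X ◁ (bimodObj N).actLeft)))) := inferInstance
  exact this

lemma π_condition (M N : HC L) :
    M.rightAct ▷ N.X ≫ π M N = (α_ _ _ _).hom ≫ M.X ◁ N.act ≫ π M N :=
  (coequalizer.condition _ _).trans (assoc _ _ _)

/-- The universal property of `M ⊗_L N`. -/
def descπ {M N : HC L} {Z : C} (f : M.X ⊗ N.X ⟶ Z)
    (hf : M.rightAct ▷ N.X ≫ f = (α_ _ _ _).hom ≫ M.X ◁ N.act ≫ f) : (tensorHC M N).X ⟶ Z :=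
  coequalizer.desc f (hf.trans (assoc _ _ _).symm)

lemma π_desc {M N : HC L} {Z : C} (f : M.X ⊗ N.X ⟶ Z)
    (hf : M.rightAct ▷ N.X ≫ f = (α_ _ _ _).hom ≫ M.X ◁ N.act ≫ f) : π M N ≫ descπ f hf = f :=
  coequalizer.π_desc _ _

lemma π_act (M N : HC L) :
    base L ◁ π M N ≫ (tensorHC M N).act = (α_ _ _ _).inv ≫ M.act ▷ N.X ≫ π M N :=
  Bimod.TensorBimod.whiskerLeft_π_actLeft (bimodObj M) (bimodObj N)

lemma π_rightAct (M N : HC L) :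
    π M N ▷ base L ≫ (tensorHC M N).rightAct = (α_ _ _ _).hom ≫ M.X ◁ N.rightAct ≫ π M N := by
  rw [rightAct, reassoc_of% τ_naturality, π_act, τ_tensor, rightAct]
  simp only [assoc, Iso.hom_inv_id_assoc, whiskerLeft_comp]
  rw [← comp_whiskerRight_assoc, ← rightAct, π_condition]
  simp

lemma rightAct_tensor (M N : HC L) :
    (tensorHC M N).rightAct = ((bimodObj M).tensorBimod (bimodObj N)).actRight := by
  refine (cancel_epi (π M N ▷ base L)).1 ((π_rightAct M N).trans ?_)
  exact (Bimod.TensorBimod.π_tensor_id_actRight (bimodObj M) (bimodObj N)).symm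

/-- Compatibility of the tensor product with the one of bimodules. -/
def tensorIso (M N : HC L) :
    (bimodObj M).tensorBimod (bimodObj N) ≅ bimodObj (tensorHC M N) :=
  Bimod.isoOfIso (Iso.refl _) (act_comp_id _)
    ((ract_comp_id _).trans (by rw [← rightAct_tensor]; rfl))

variable (L) in
/-- `L` as a module over itself. -/
def unitHC : HC L := of (base L) μ (one_mul _) (mul_assoc _)

lemma unitHC_rightAct : (unitHC L).rightAct = μ[base L] := τ_mul L

/-- Compatibility of the unit with the one of bimodules. -/
def unitIso : Bimod.regular (monL L) ≅ bimodObj (unitHC L) :=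
  Bimod.isoOfIso (Iso.refl _) (act_comp_id _)
    ((ract_comp_id _).trans (congrArg (fun x => 𝟙 (base L) ▷ base L ≫ x)
      (unitHC_rightAct (L := L)).symm))

/-- Every bimodule isomorphism is a module isomorphism. -/
def isoOf {M N : HC L} (e : bimodObj M ≅ bimodObj N) : M ≅ N where
  hom := ofBimodHom e.hom
  inv := ofBimodHom e.inv
  hom_inv_id := hom_ext (congrArg Bimod.Hom.hom e.hom_inv_id)
  inv_hom_id := hom_ext (congrArg Bimod.Hom.hom e.inv_hom_id)

lemma toBimod_ofBimodHom {M N : HC L} (f : bimodObj M ⟶ bimodObj N) :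
    (toBimod L).map (ofBimodHom f) = f := rfl

abbrev tensorIsos (M N : HC L) :
    bimodObj M ⊗ bimodObj N ≅ bimodObj (tensorHC M N) := tensorIso M N

abbrev unitIsos : 𝟙_ (Bimod (monL L) (monL L)) ≅ bimodObj (unitHC L) := unitIso

instance : MonoidalCategoryStruct (HC L) where
  tensorObj := tensorHC
  tensorUnit := unitHC L
  tensorHom {M M' N N'} f g := ofBimodHom ((tensorIsos M N).inv ≫
    ((toBimod L).map f ⊗ₘ (toBimod L).map g) ≫ (tensorIsos M' N').hom)
  whiskerLeft M {N N'} f := ofBimodHom ((tensorIsos M N).inv ≫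
    (bimodObj M ◁ (toBimod L).map f) ≫ (tensorIsos M N').hom)
  whiskerRight {M M'} f N := ofBimodHom ((tensorIsos M N).inv ≫
    ((toBimod L).map f ▷ bimodObj N) ≫ (tensorIsos M' N).hom)
  associator M N K := isoOf
    (((tensorIsos _ K).symm ≪≫ ((tensorIsos M N).symm ⊗ᵢ .refl _))
        ≪≫ α_ (bimodObj M) (bimodObj N) (bimodObj K)
        ≪≫ ((.refl _ ⊗ᵢ tensorIsos N K) ≪≫ tensorIsos M _))
  leftUnitor M := isoOf (((tensorIsos _ M).symm ≪≫ (unitIsos.symm ⊗ᵢ .refl _)) ≪≫ λ_ (bimodObj M))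
  rightUnitor M := isoOf (((tensorIsos M _).symm ≪≫ (.refl _ ⊗ᵢ unitIsos.symm)) ≪≫ ρ_ (bimodObj M))

instance : MonoidalCategory (HC L) := Monoidal.induced (toBimod L)
  { μIso := tensorIsos
    εIso := unitIsos
    whiskerLeft_eq _ _ _ _ := rfl
    whiskerRight_eq _ _ := rfl
    tensorHom_eq _ _ := rfl
    associator_eq _ _ _ := rfl
    leftUnitor_eq _ := rfl
    rightUnitor_eq _ := rfl }

end HC
end
end
end HarishChandra

namespace HarishChandra

noncomputable section

set_option linter.unusedSectionVars false

open CategoryTheory Category MonoidalCategory Limits Opposite MonObj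

namespace HC
section
variable {C : Type u} [Category.{v} C] [MonoidalCategory C] {L : Center C} [MonObj L]

variable (L) in
/-- The forgetful functor. -/
abbrev forget : HC L ⥤ C := Mod.forget (base L)

instance : (forget L).Faithful where
  map_injective h := Mod.Hom.ext h

instance : (forget L).ReflectsIsomorphisms where
  reflects {M N} f _ := by
    have : IsIso f.hom := inferInstanceAs (IsIso ((forget L).map f))
    refine ⟨homOf (inv f.hom) ?_, Mod.Hom.ext (IsIso.hom_inv_id f.hom),
      Mod.Hom.ext (IsIso.inv_hom_id f.hom)⟩
    rw [IsIso.comp_inv_eq, assoc, act_hom, ← whiskerLeft_comp_assoc]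
    simp

variable (L) in
/-- The free module functor `X ↦ L ⊗ X`. -/
def free : C ⥤ HC L where
  obj X := of (base L ⊗ X) ((α_ _ _ _).inv ≫ μ ▷ X)
    (by rw [associator_inv_naturality_left_assoc, ← comp_whiskerRight, one_mul]; simp)
    (by
      rw [associator_inv_naturality_left_assoc, ← comp_whiskerRight, mul_assoc]
      simp)
  map f := homOf (base L ◁ f) (by
    change ((α_ (base L) (base L) _).inv ≫ μ ▷ _) ≫ base L ◁ f =
      base L ◁ base L ◁ f ≫ (α_ (base L) (base L) _).inv ≫ μ ▷ _
    rw [assoc, ← whisker_exchange, associator_inv_naturality_right_assoc])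
  map_id X := Mod.Hom.ext (whiskerLeft_id _ _)
  map_comp f g := Mod.Hom.ext (whiskerLeft_comp _ _ _)

lemma free_act (X : C) : ((free L).obj X).act = (α_ _ _ _).inv ≫ μ ▷ X := rfl

/-- The extension of a map to the free module. -/
def freeLift {X : C} {M : HC L} (g : X ⟶ M.X) : (free L).obj X ⟶ M :=
  homOf (base L ◁ g ≫ M.act) (by
    change ((α_ (base L) (base L) X).inv ≫ μ ▷ X) ≫ base L ◁ g ≫ M.act =
      base L ◁ (base L ◁ g ≫ M.act) ≫ M.act
    rw [whiskerLeft_comp, assoc, assoc, ← whisker_exchange_assoc, mul_act]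
    simp)

/-- The inclusion of generators of the free module. -/
def freeUnit (X : C) : X ⟶ ((free L).obj X).X := (λ_ X).inv ≫ η[base L] ▷ X

lemma freeUnit_freeLift {X : C} {M : HC L} (g : X ⟶ M.X) :
    freeUnit X ≫ (freeLift g).hom = g := by
  change ((λ_ X).inv ≫ η[base L] ▷ X) ≫ base L ◁ g ≫ M.act = g
  rw [assoc, ← whisker_exchange_assoc, one_act]
  simp

lemma freeLift_freeUnit {X : C} {M : HC L} (f : (free L).obj X ⟶ M) :
    freeLift (freeUnit X ≫ f.hom) = f := by
  refine Mod.Hom.ext ?_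
  have h := act_hom f
  rw [free_act] at h
  change base L ◁ (freeUnit X ≫ f.hom) ≫ M.act = f.hom
  rw [whiskerLeft_comp, assoc, ← h]
  change base L ◁ ((λ_ X).inv ≫ η[base L] ▷ X) ≫ ((α_ (base L) (base L) X).inv ≫ μ ▷ X) ≫ f.hom = _
  have : base L ◁ ((λ_ X).inv ≫ η[base L] ▷ X) ≫ (α_ (base L) (base L) X).inv ≫ μ ▷ X = 𝟙 _ := by
    rw [whiskerLeft_comp, assoc, associator_inv_naturality_middle_assoc, ← comp_whiskerRight,
      mul_one]
    simp
  exact (assoc _ _ _).symm.trans ((congrArg (· ≫ f.hom) this).trans (id_comp _))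

variable (L) in
/-- The free-forgetful adjunction. -/
def adj : free L ⊣ forget L := Adjunction.mkOfHomEquiv
  { homEquiv X M :=
      { toFun f := freeUnit X ≫ f.hom
        invFun g := freeLift g
        left_inv := freeLift_freeUnit
        right_inv := freeUnit_freeLift }
    homEquiv_naturality_left_symm {_ _ M} f g := Mod.Hom.ext (by
      change base L ◁ (f ≫ g) ≫ M.act = base L ◁ f ≫ base L ◁ g ≫ M.act
      rw [whiskerLeft_comp]
      exact assoc _ _ _)
    homEquiv_naturality_right {X _ _} f g := (assoc _ _ _).symm }

section
variable [∀ X : C, PreservesColimitsOfSize.{v, v} (tensorLeft X)]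
variable {J : Type v} [Category.{v} J]

/-- The legs of a cocone. -/
def leg {F : J ⥤ HC L} (c : Cocone (F ⋙ forget L)) (j : J) : (F.obj j).X ⟶ c.pt := c.ι.app j

lemma leg_w {F : J ⥤ HC L} (c : Cocone (F ⋙ forget L)) {i j : J} (f : i ⟶ j) :
    (F.map f).hom ≫ leg c j = leg c i := c.w f

/-- The map from a colimit of underlying objects induced by a cocone of modules. -/
def legDesc {F : J ⥤ HC L} {c : Cocone (F ⋙ forget L)} (hc : IsColimit c) (s : Cocone F) :
    c.pt ⟶ s.pt.X := hc.desc ((forget L).mapCocone s)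

lemma leg_legDesc {F : J ⥤ HC L} {c : Cocone (F ⋙ forget L)} (hc : IsColimit c)
    (s : Cocone F) (j : J) : leg c j ≫ legDesc hc s = (s.ι.app j).hom :=
  hc.fac ((forget L).mapCocone s) j

lemma leg_ext {F : J ⥤ HC L} {c : Cocone (F ⋙ forget L)} (hc : IsColimit c) (Y : C) {Z : C}
    {f g : Y ⊗ c.pt ⟶ Z} (h : ∀ j, Y ◁ leg c j ≫ f = Y ◁ leg c j ≫ g) : f = g :=
  (isColimitOfPreserves (tensorLeft Y) hc).hom_ext h

/-- The action of `L` on a colimit. -/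
def colimAct (F : J ⥤ HC L) (c : Cocone (F ⋙ forget L)) (hc : IsColimit c) :
    base L ⊗ c.pt ⟶ c.pt :=
  (isColimitOfPreserves (tensorLeft (base L)) hc).desc (Cocone.mk c.pt
    { app := fun j => (F.obj j).act ≫ leg c j
      naturality := fun i j f => by
        change base L ◁ (F.map f).hom ≫ (F.obj j).act ≫ leg c j =
          ((F.obj i).act ≫ leg c i) ≫ 𝟙 _
        rw [← reassoc_of% act_hom, comp_id, leg_w] })

lemma leg_colimAct (F : J ⥤ HC L) (c : Cocone (F ⋙ forget L)) (hc : IsColimit c) (j : J) :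
    base L ◁ leg c j ≫ colimAct F c hc = (F.obj j).act ≫ leg c j :=
  (isColimitOfPreserves (tensorLeft (base L)) hc).fac (Cocone.mk c.pt _) j

/-- A colimit of modules, on the colimit of the underlying objects. -/
def colimObj (F : J ⥤ HC L) (c : Cocone (F ⋙ forget L)) (hc : IsColimit c) : HC L :=
  of c.pt (colimAct F c hc)
    (leg_ext hc _ fun j => by
      rw [whisker_exchange_assoc, leg_colimAct, reassoc_of% one_act, leftUnitor_naturality])
    (leg_ext hc _ fun j => by
      rw [whisker_exchange_assoc, leg_colimAct, reassoc_of% mul_act,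
        associator_naturality_right_assoc, ← whiskerLeft_comp_assoc, leg_colimAct]
      simp only [whiskerLeft_comp, assoc, leg_colimAct])

/-- The colimit cocone of modules. -/
def colimCocone (F : J ⥤ HC L) (c : Cocone (F ⋙ forget L)) (hc : IsColimit c) : Cocone F :=
  Cocone.mk (colimObj F c hc)
    { app := fun j => homOf (leg c j) (leg_colimAct F c hc j).symm
      naturality := fun _ _ f => Mod.Hom.ext (c.ι.naturality f) }

/-- The colimit cocone of modules is a colimit. -/
def colimIsColimit (F : J ⥤ HC L) (c : Cocone (F ⋙ forget L)) (hc : IsColimit c) :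
    IsColimit (colimCocone F c hc) where
  desc s := homOf (legDesc hc s) (leg_ext hc _ fun j => by
      change base L ◁ leg c j ≫ colimAct F c hc ≫ legDesc hc s =
        base L ◁ leg c j ≫ base L ◁ legDesc hc s ≫ s.pt.act
      rw [reassoc_of% leg_colimAct, ← whiskerLeft_comp_assoc, leg_legDesc]
      exact act_hom (s.ι.app j))
  fac s j := Mod.Hom.ext (hc.fac ((forget L).mapCocone s) j)
  uniq s m hm := Mod.Hom.ext (hc.uniq ((forget L).mapCocone s) m.hom
    fun j => congrArg Mod.Hom.hom (hm j))

instance [HasColimitsOfSize.{v, v} C] : HasColimitsOfSize.{v, v} (HC L) where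
  has_colimits_of_shape _ := { has_colimit := fun F =>
    ⟨⟨⟨_, colimIsColimit F _ (colimit.isColimit (F ⋙ forget L))⟩⟩⟩ }

instance [HasColimitsOfSize.{v, v} C] : PreservesColimitsOfSize.{v, v} (forget L) where
  preservesColimitsOfShape :=
    { preservesColimit := by
        intro F
        exact preservesColimit_of_preserves_colimit_cocone
          (colimIsColimit F _ (colimit.isColimit (F ⋙ forget L)))
          (IsColimit.ofIsoColimit (colimit.isColimit (F ⋙ forget L))
            (Cocone.ext (Iso.refl _) fun j => comp_id _)) }

/-- A functor into modules preserves colimits if its underlying functor does. -/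
lemma preservesColimits_of_forget [HasColimitsOfSize.{v, v} C] {E : Type*} [Category E]
    (G : E ⥤ HC L) [PreservesColimitsOfSize.{v, v} (G ⋙ forget L)] :
    PreservesColimitsOfSize.{v, v} G :=
  have : ReflectsColimitsOfSize.{v, v} (forget L) := reflectsColimits_of_reflectsIsomorphisms
  preservesColimits_of_reflects_of_preserves G (forget L)

end
end

section
variable {C : Type u} [Category.{v} C] [MonoidalCategory C] [PresentablyMonoidal C]
variable {L : Center C} [MonObj L] [IsCommMonObj L]

instance : HasColimitsOfSize.{0, 0} C := hasColimitsOfSizeShrink.{0, 0, v, v} C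

lemma π_whiskerRight {M M' : HC L} (f : M ⟶ M') (N : HC L) :
    π M N ≫ (f ▷ N).hom = f.hom ▷ N.X ≫ π M' N := by
  exact (congrArg (π M N ≫ ·) ((id_comp _).trans (comp_id _))).trans
    (ι_colimMap _ WalkingParallelPair.one)

lemma π_whiskerLeft (M : HC L) {N N' : HC L} (f : N ⟶ N') :
    π M N ≫ (M ◁ f).hom = M.X ◁ f.hom ≫ π M N' := by
  exact (congrArg (π M N ≫ ·) ((id_comp _).trans (comp_id _))).trans
    (ι_colimMap _ WalkingParallelPair.one)

lemma tensor_hom_ext {M N K : HC L} {f g : M ⊗ N ⟶ K} (h : π M N ≫ f.hom = π M N ≫ g.hom) :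
    f = g := Mod.Hom.ext ((cancel_epi (π M N)).1 h)

instance (N : HC L) : PreservesColimitsOfSize.{v, v} (tensorRight N ⋙ forget L) where
  preservesColimitsOfShape {J} _ :=
    { preservesColimit := by
        intro F
        constructor
        intro c hc
        let h₁ := isColimitOfPreserves (forget L ⋙ tensorRight N.X) hc
        let h₂ := isColimitOfPreserves (forget L ⋙ tensorRight (base L) ⋙ tensorRight N.X) hc
        obtain ⟨k, hk⟩ : ∃ k : ∀ j, F.obj j ⟶ c.pt, k = c.ι.app := ⟨_, rfl⟩
        have e₁ {Z : C} {f g : c.pt.X ⊗ N.X ⟶ Z}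
          (h : ∀ j, (k j).hom ▷ N.X ≫ f = (k j).hom ▷ N.X ≫ g) : f = g := by
          subst hk; exact h₁.hom_ext h
        have e₂ {Z : C} {f g : (c.pt.X ⊗ base L) ⊗ N.X ⟶ Z}
          (h : ∀ j, (k j).hom ▷ base L ▷ N.X ≫ f = (k j).hom ▷ base L ▷ N.X ≫ g) : f = g := by
          subst hk; exact h₂.hom_ext h
        have hq (s : Cocone (F ⋙ tensorRight N ⋙ forget L)) :
            ∃ q : ∀ j, ((F.obj j) ⊗ N).X ⟶ s.pt, q = s.ι.app := ⟨_, rfl⟩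
        choose q hq using hq
        have hw (s) {i j : J} (f : i ⟶ j) : ((F.map f) ▷ N).hom ≫ q s j = q s i := by
          rw [hq]; exact s.w f
        let s₁ (s : Cocone (F ⋙ tensorRight N ⋙ forget L)) :
            Cocone (F ⋙ forget L ⋙ tensorRight N.X) := Cocone.mk s.pt
          { app := fun j => π (F.obj j) N ≫ q s j
            naturality := fun i j f => by
              change (F.map f).hom ▷ N.X ≫ π (F.obj j) N ≫ q s j = (π (F.obj i) N ≫ q s i) ≫ 𝟙 _
              rw [← reassoc_of% π_whiskerRight, comp_id, hw] }
        let d (s : Cocone (F ⋙ tensorRight N ⋙ forget L)) : c.pt.X ⊗ N.X ⟶ s.pt := h₁.desc (s₁ s)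
        have hd (s) (j) : (k j).hom ▷ N.X ≫ d s = π (F.obj j) N ≫ q s j := by
          subst hk; exact h₁.fac (s₁ s) j
        have hc' (s) : (HC.rightAct c.pt) ▷ N.X ≫ d s = (α_ _ _ _).hom ≫ c.pt.X ◁ HC.act N ≫ d s := by
          refine e₂ fun j => ?_
          rw [← comp_whiskerRight_assoc, ← rightAct_hom, comp_whiskerRight, assoc, hd,
            reassoc_of% π_condition, associator_naturality_left_assoc,
            ← whisker_exchange_assoc, hd]
        have fac (s) (j) : ((k j) ▷ N).hom ≫ descπ (d s) (hc' s) = q s j := by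
          refine (cancel_epi (π (F.obj j) N)).1 ?_
          rw [reassoc_of% π_whiskerRight, π_desc, hd]
        have uniq (s) (m : ((c.pt) ⊗ N).X ⟶ s.pt) (hm : ∀ j, ((k j) ▷ N).hom ≫ m = q s j) :
            m = descπ (d s) (hc' s) := by
          refine (cancel_epi (π (c.pt) N)).1 (e₁ fun j => ?_)
          rw [π_desc, hd, ← hm j, reassoc_of% π_whiskerRight]
        subst hk
        exact ⟨
          { desc := fun s => descπ (d s) (hc' s)
            fac := fun s j => (fac s j).trans (congrFun (hq s) j)
            uniq := fun s m hm => uniq s m fun j => (hm j).trans (congrFun (hq s) j).symm }⟩ }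

instance (M : HC L) : PreservesColimitsOfSize.{v, v} (tensorLeft M ⋙ forget L) where
  preservesColimitsOfShape {J} _ :=
    { preservesColimit := by
        intro F
        constructor
        intro c hc
        let h₁ := isColimitOfPreserves (forget L ⋙ tensorLeft M.X) hc
        let h₂ := isColimitOfPreserves (forget L ⋙ tensorLeft (M.X ⊗ base L)) hc
        obtain ⟨k, hk⟩ : ∃ k : ∀ j, F.obj j ⟶ c.pt, k = c.ι.app := ⟨_, rfl⟩
        have e₁ {Z : C} {f g : M.X ⊗ c.pt.X ⟶ Z}
          (h : ∀ j, M.X ◁ (k j).hom ≫ f = M.X ◁ (k j).hom ≫ g) : f = g := by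
          subst hk; exact h₁.hom_ext h
        have e₂ {Z : C} {f g : (M.X ⊗ base L) ⊗ c.pt.X ⟶ Z}
          (h : ∀ j, (M.X ⊗ base L) ◁ (k j).hom ≫ f = (M.X ⊗ base L) ◁ (k j).hom ≫ g) : f = g := by
          subst hk; exact h₂.hom_ext h
        have hq (s : Cocone (F ⋙ tensorLeft M ⋙ forget L)) :
            ∃ q : ∀ j, (M ⊗ (F.obj j)).X ⟶ s.pt, q = s.ι.app := ⟨_, rfl⟩
        choose q hq using hq
        have hw (s) {i j : J} (f : i ⟶ j) : (M ◁ (F.map f)).hom ≫ q s j = q s i := by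
          rw [hq]; exact s.w f
        let s₁ (s : Cocone (F ⋙ tensorLeft M ⋙ forget L)) :
            Cocone (F ⋙ forget L ⋙ tensorLeft M.X) := Cocone.mk s.pt
          { app := fun j => π M (F.obj j) ≫ q s j
            naturality := fun i j f => by
              change M.X ◁ (F.map f).hom ≫ π M (F.obj j) ≫ q s j = (π M (F.obj i) ≫ q s i) ≫ 𝟙 _
              rw [← reassoc_of% π_whiskerLeft, comp_id, hw] }
        let d (s : Cocone (F ⋙ tensorLeft M ⋙ forget L)) : M.X ⊗ c.pt.X ⟶ s.pt := h₁.desc (s₁ s)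
        have hd (s) (j) : M.X ◁ (k j).hom ≫ d s = π M (F.obj j) ≫ q s j := by
          subst hk; exact h₁.fac (s₁ s) j
        have hc' (s) : M.rightAct ▷ c.pt.X ≫ d s = (α_ _ _ _).hom ≫ M.X ◁ HC.act c.pt ≫ d s := by
          refine e₂ fun j => ?_
          rw [whisker_exchange_assoc, hd, reassoc_of% π_condition,
            associator_naturality_right_assoc, ← whiskerLeft_comp_assoc, ← act_hom,
            whiskerLeft_comp, assoc, hd]
        have fac (s) (j) : (M ◁ (k j)).hom ≫ descπ (d s) (hc' s) = q s j := by
          refine (cancel_epi (π M (F.obj j))).1 ?_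
          rw [reassoc_of% π_whiskerLeft, π_desc, hd]
        have uniq (s) (m : (M ⊗ (c.pt)).X ⟶ s.pt) (hm : ∀ j, (M ◁ (k j)).hom ≫ m = q s j) :
            m = descπ (d s) (hc' s) := by
          refine (cancel_epi (π M (c.pt))).1 (e₁ fun j => ?_)
          rw [π_desc, hd, ← hm j, reassoc_of% π_whiskerLeft]
        subst hk
        exact ⟨
          { desc := fun s => descπ (d s) (hc' s)
            fac := fun s j => (fac s j).trans (congrFun (hq s) j)
            uniq := fun s m hm => uniq s m fun j => (hm j).trans (congrFun (hq s) j).symm }⟩ }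

lemma mono_hom {M N : HC L} (i : M ⟶ N) [Mono i] : Mono i.hom := by
  have := (adj L).rightAdjoint_preservesLimits
  exact inferInstanceAs (Mono ((forget L).map i))

instance : PresentablyMonoidal (HC L) where
  presentable := by
    obtain ⟨κ, _, _⟩ := IsLocallyPresentable.exists_cardinal.{v} C
    obtain ⟨P, _, hP, hP'⟩ := (IsCardinalLocallyPresentable.iff_exists_isStrongGenerator C κ).1
      inferInstance
    refine ⟨κ, inferInstance, (IsCardinalLocallyPresentable.iff_exists_isStrongGenerator _ κ).2
      ⟨P.strictMap (free L), inferInstance, ?_, ?_⟩⟩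
    · refine ObjectProperty.isStrongGenerator_iff.2 ⟨?_, ?_⟩
      · intro M N f g h
        refine Mod.Hom.ext (hP.isSeparating _ _ fun G hG k => ?_)
        have := congrArg (fun q => freeUnit G ≫ q.hom) (h _ (P.strictMap_obj (free L) hG) (freeLift k))
        dsimp at this
        rwa [← assoc, freeUnit_freeLift, ← assoc, freeUnit_freeLift] at this
      · intro M N i _ h
        have := mono_hom i
        have : IsIso i.hom := hP.isIso_of_mono i.hom fun G hG k => by
          obtain ⟨q, hq⟩ := h _ (P.strictMap_obj (free L) hG) (freeLift k)
          refine ⟨freeUnit G ≫ q.hom, ?_⟩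
          have := congrArg (fun q => freeUnit G ≫ q.hom) hq
          dsimp at this
          rw [freeUnit_freeLift] at this
          exact (assoc _ _ _).trans this
        have : IsIso ((forget L).map i) := this
        exact isIso_of_reflects_iso i (forget L)
    · rintro _ ⟨G, hG⟩
      have : IsCardinalPresentable G κ := hP' _ hG
      exact (adj L).isCardinalPresentable_leftAdjoint_obj κ G
  preservesLeft M := preservesColimits_of_forget _
  preservesRight M := preservesColimits_of_forget _

end
end HC
end
end HarishChandra

namespace HarishChandra

noncomputable section

set_option linter.unusedSectionVars false

open CategoryTheory Category MonoidalCategory Limits Opposite MonObj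

namespace HC
section
variable {C : Type u} [Category.{v} C] [MonoidalCategory C] [Preadditive C] [MonoidalPreadditive C]
  {L : Center C} [MonObj L]

lemma hom_injective {M N : HC L} : Function.Injective (fun f : M ⟶ N => f.hom) :=
  fun _ _ h => Mod.Hom.ext h

instance (M N : HC L) : Zero (M ⟶ N) := ⟨homOf 0 (by simp)⟩
instance (M N : HC L) : Add (M ⟶ N) := ⟨fun f g => homOf (f.hom + g.hom) (by
  rw [Preadditive.comp_add, act_hom, act_hom, MonoidalPreadditive.whiskerLeft_add,
    Preadditive.add_comp])⟩
instance (M N : HC L) : Neg (M ⟶ N) := ⟨fun f => homOf (-f.hom) (by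
  rw [Preadditive.comp_neg, act_hom, ← Preadditive.neg_comp]
  congr 1
  exact ((tensoringLeft C).obj (base L)).map_neg.symm)⟩
instance (M N : HC L) : Sub (M ⟶ N) := ⟨fun f g => homOf (f.hom - g.hom) (by
  rw [Preadditive.comp_sub, act_hom, act_hom, ← Preadditive.sub_comp]
  congr 1
  exact ((tensoringLeft C).obj (base L)).map_sub.symm)⟩
instance (M N : HC L) : SMul ℕ (M ⟶ N) := ⟨fun n f => homOf (n • f.hom) (by
  rw [Preadditive.comp_nsmul, act_hom, ← Preadditive.nsmul_comp]
  congr 1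
  exact (((tensoringLeft C).obj (base L)).map_nsmul).symm)⟩
instance (M N : HC L) : SMul ℤ (M ⟶ N) := ⟨fun n f => homOf (n • f.hom) (by
  rw [Preadditive.comp_zsmul, act_hom, ← Preadditive.zsmul_comp]
  congr 1
  exact (((tensoringLeft C).obj (base L)).map_zsmul).symm)⟩

instance (M N : HC L) : AddCommGroup (M ⟶ N) :=
  hom_injective.addCommGroup _ rfl (fun _ _ => rfl) (fun _ => rfl) (fun _ _ => rfl)
    (fun _ _ => rfl) (fun _ _ => rfl)

instance : Preadditive (HC L) where
  add_comp _ _ _ _ _ _ := Mod.Hom.ext (Preadditive.add_comp _ _ _ _ _ _)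
  comp_add _ _ _ _ _ _ := Mod.Hom.ext (Preadditive.comp_add _ _ _ _ _ _)

variable (k : Type w) [Field k] [Linear k C] [MonoidalLinear k C]

instance (M N : HC L) : SMul k (M ⟶ N) := ⟨fun n f => homOf (n • f.hom) (by
  rw [Linear.comp_smul, act_hom, MonoidalLinear.whiskerLeft_smul, Linear.smul_comp])⟩

instance : Linear k (HC L) where
  homModule M N := Function.Injective.module k
    { toFun := fun f : M ⟶ N => f.hom, map_zero' := rfl, map_add' := fun _ _ => rfl }
    hom_injective (fun _ _ => rfl)
  smul_comp _ _ _ _ _ _ := Mod.Hom.ext (Linear.smul_comp _ _ _ _ _ _)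
  comp_smul _ _ _ _ _ _ := Mod.Hom.ext (Linear.comp_smul _ _ _ _ _ _)

end
end HC
end
end HarishChandra

namespace HarishChandra

noncomputable section

set_option linter.unusedSectionVars false

open CategoryTheory Category MonoidalCategory Limits Opposite MonObj

section
variable (k : Type w) [Field k] (H : Type u) [Category.{v} H] [Preadditive H] [Linear k H]

/-- An object `X` is compact projective if `Hom(X, -) : H ⥤ Vect` preserves small colimits. -/
def isCompactProjective : ObjectProperty H := fun X =>
  PreservesColimitsOfSize.{v, v} ((linearCoyoneda k H).obj (op X))

variable [MonoidalCategory H]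

/-- A monoidal category is cp-rigid if compact projective objects strongly generate and every
compact projective object has a left and a right dual. -/
class CpRigid : Prop where
  isStrongGenerator : (isCompactProjective k H).IsStrongGenerator
  hasRightDual : ∀ X : H, isCompactProjective k H X → Nonempty (HasRightDual X)
  hasLeftDual : ∀ X : H, isCompactProjective k H X → Nonempty (HasLeftDual X)

/-- The unit object is compact projective. -/
class UnitCP : Prop where
  prop_unit : isCompactProjective k H (𝟙_ H)

/-- Compact projective objects with a right dual; in a cp-rigid category these are all
compact projective objects. -/
def isDualizableCP : ObjectProperty H := fun X =>
  isCompactProjective k H X ∧ Nonempty (HasRightDual X)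

/-- The category of (dualizable) compact projective objects. -/
abbrev CP : Type _ := (isDualizableCP k H).FullSubcategory

variable [MonoidalPreadditive H] [MonoidalLinear k H] [PresentablyMonoidal H]

/-- `Hom(X ⊗ Y, Z) ≅ Hom(X, Z ⊗ Yᘁ)`, linearly. -/
def homTensorIso (X Y : H) [HasRightDual Y] :
    (linearCoyoneda k H).obj (op (X ⊗ Y)) ≅
      tensorRight (Yᘁ) ⋙ (linearCoyoneda k H).obj (op X) :=
  NatIso.ofComponents (fun Z => LinearEquiv.toModuleIso
    { tensorRightHomEquiv X Y (Yᘁ) Z with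
      map_add' := fun f g => by
        simp [tensorRightHomEquiv, MonoidalPreadditive.add_whiskerRight]
      map_smul' := fun r f => by
        simp [tensorRightHomEquiv, MonoidalLinear.smul_whiskerRight] })
    (fun f => by
      ext g
      exact tensorRightHomEquiv_naturality g f)

instance [UnitCP k H] : (isDualizableCP k H).IsMonoidal where
  prop_unit := ⟨UnitCP.prop_unit, ⟨inferInstance⟩⟩
  prop_tensor := by
    rintro X Y ⟨hX, ⟨_⟩⟩ ⟨hY, ⟨_⟩⟩
    refine ⟨?_, ⟨hasRightDualTensor⟩⟩
    have : PreservesColimitsOfSize.{v, v} ((linearCoyoneda k H).obj (op X)) := hX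
    exact preservesColimits_of_natIso (homTensorIso k H X Y).symm

lemma isDualizableCP_le (κ : Cardinal.{v}) [Fact κ.IsRegular] :
    isDualizableCP k H ≤ isCardinalPresentable H κ := by
  rintro X ⟨hX, -⟩
  have : PreservesColimitsOfSize.{v, v} ((linearCoyoneda k H).obj (op X)) := hX
  refine ⟨fun J _ _ => ?_⟩
  have := isFiltered_of_isCardinalFiltered J κ
  have : PreservesColimitsOfShape J ((linearCoyoneda k H).obj (op X) ⋙
    forget₂ (ModuleCat.{v} k) AddCommGrpCat.{v} ⋙ CategoryTheory.forget AddCommGrpCat.{v}) :=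
    inferInstance
  exact this

instance : EssentiallySmall.{v} (CP k H) := by
  obtain ⟨κ, _, _⟩ := IsLocallyPresentable.exists_cardinal.{v} H
  have := ObjectProperty.EssentiallySmall.of_le.{v} (isDualizableCP_le k H κ)
  infer_instance

end

namespace HC
section
variable {C : Type u} [Category.{v} C] [MonoidalCategory C] [Preadditive C] [MonoidalPreadditive C]
  {L : Center C} [MonObj L] [IsCommMonObj L] [PresentablyMonoidal C]

lemma add_hom {M N : HC L} (f g : M ⟶ N) : (f + g).hom = f.hom + g.hom := rfl

instance : MonoidalPreadditive (HC L) where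
  whiskerLeft_zero := tensor_hom_ext (by
    rw [π_whiskerLeft]
    change _ ◁ 0 ≫ _ = _ ≫ 0
    simp)
  zero_whiskerRight := tensor_hom_ext (by
    rw [π_whiskerRight]
    change 0 ▷ _ ≫ _ = _ ≫ 0
    simp)
  whiskerLeft_add f g := tensor_hom_ext (by
    rw [π_whiskerLeft, add_hom, add_hom, Preadditive.comp_add, π_whiskerLeft, π_whiskerLeft]
    simp [MonoidalPreadditive.whiskerLeft_add])
  add_whiskerRight f g := tensor_hom_ext (by
    rw [π_whiskerRight, add_hom, add_hom, Preadditive.comp_add, π_whiskerRight, π_whiskerRight]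
    simp [MonoidalPreadditive.add_whiskerRight])

variable (k : Type w) [Field k] [Linear k C] [MonoidalLinear k C]

lemma smul_hom {M N : HC L} (r : k) (f : M ⟶ N) : (r • f).hom = r • f.hom := rfl

instance : MonoidalLinear k (HC L) where
  whiskerLeft_smul M _ _ r f := tensor_hom_ext (by
    rw [π_whiskerLeft, smul_hom, smul_hom, Linear.comp_smul, π_whiskerLeft]
    simp [MonoidalLinear.whiskerLeft_smul])
  smul_whiskerRight r _ _ f M := tensor_hom_ext (by
    rw [π_whiskerRight, smul_hom, smul_hom, Linear.comp_smul, π_whiskerRight]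
    simp [MonoidalLinear.smul_whiskerRight])

/-- The module map `L ⟶ M` determined by a map `1 ⟶ M`. -/
def unitLift {M : HC L} (g : 𝟙_ C ⟶ M.X) : unitHC L ⟶ M :=
  homOf ((ρ_ (base L)).inv ≫ base L ◁ g ≫ M.act) (by
    change μ[base L] ≫ (ρ_ (base L)).inv ≫ base L ◁ g ≫ M.act =
      base L ◁ ((ρ_ (base L)).inv ≫ base L ◁ g ≫ M.act) ≫ M.act
    rw [rightUnitor_inv_naturality_assoc, ← whisker_exchange_assoc, mul_act]
    simp)

lemma one_unitLift {M : HC L} (g : 𝟙_ C ⟶ M.X) : η[base L] ≫ (unitLift g).hom = g := by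
  change η[base L] ≫ (ρ_ (base L)).inv ≫ base L ◁ g ≫ M.act = g
  rw [rightUnitor_inv_naturality_assoc, ← whisker_exchange_assoc, one_act]
  rw [leftUnitor_naturality, unitors_equal, Iso.inv_hom_id_assoc]

lemma unitLift_one {M : HC L} (f : unitHC L ⟶ M) : unitLift (η[base L] ≫ f.hom) = f := by
  have key (f : base L ⟶ M.X) (h : μ[base L] ≫ f = base L ◁ f ≫ M.act) :
      (ρ_ (base L)).inv ≫ base L ◁ (η[base L] ≫ f) ≫ M.act = f := by
    rw [whiskerLeft_comp, assoc, ← h, ← assoc (base L ◁ _), mul_one]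
    simp
  exact Mod.Hom.ext (key f.hom (act_hom f))

/-- `Hom_HC(L, M) ≅ Hom_C(1, M)`. -/
def unitHomIso : (linearCoyoneda k (HC L)).obj (op (𝟙_ (HC L))) ≅
    forget L ⋙ (linearCoyoneda k C).obj (op (𝟙_ C)) :=
  NatIso.ofComponents (fun M => LinearEquiv.toModuleIso
    { toFun := fun f : unitHC L ⟶ M => (η[base L] ≫ f.hom : 𝟙_ C ⟶ M.X)
      invFun := fun g : 𝟙_ C ⟶ M.X => unitLift g
      left_inv := unitLift_one
      right_inv := one_unitLift
      map_add' := fun f g => Preadditive.comp_add _ _ _ _ _ _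
      map_smul' := fun r f => Linear.comp_smul _ _ _ _ _ _ })
    (fun f => by
      ext g
      exact (assoc _ _ _).symm)

instance [UnitCP k C] : UnitCP k (HC L) where
  prop_unit := by
    have : PreservesColimitsOfSize.{v, v} ((linearCoyoneda k C).obj (op (𝟙_ C))) :=
      UnitCP.prop_unit
    exact preservesColimits_of_natIso (unitHomIso k).symm
end
end HC
end
end HarishChandra

namespace HarishChandra

noncomputable section

set_option linter.unusedSectionVars false

open CategoryTheory Category MonoidalCategory Limits Opposite

section
variable (k : Type w) [Field k] (H : Type u) [Category.{v} H] [Preadditive H] [Linear k H]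
  [MonoidalCategory H] [MonoidalPreadditive H] [MonoidalLinear k H] [PresentablyMonoidal H]

/-- The indexing category of coefficients. -/
abbrev Idx : Type _ := ((CP k H)ᴹᵒᵖ)ᵒᵖ

variable {k H}

/-- The value of a functor of coefficients on a compact projective object. -/
def ob (X : Idx k H ⥤ H) (c : CP k H) : H := X.obj (op (MonoidalOpposite.mop c))

/-- The contravariant functoriality of coefficients. -/
def mp (X : Idx k H ⥤ H) {c d : CP k H} (f : c ⟶ d) : ob X d ⟶ ob X c := X.map f.mop.op

lemma mp_id (X : Idx k H ⥤ H) (c : CP k H) : mp X (𝟙 c) = 𝟙 _ := X.map_id _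
lemma mp_comp (X : Idx k H ⥤ H) {c d e : CP k H} (f : c ⟶ d) (g : d ⟶ e) :
    mp X (f ≫ g) = mp X g ≫ mp X f := X.map_comp g.mop.op f.mop.op

/-- `X` is a `k`-linear functor. -/
structure IsLin (X : Idx k H ⥤ H) : Prop where
  add : ∀ ⦃c d : CP k H⦄ (f g : c ⟶ d), mp X (f + g) = mp X f + mp X g
  smul : ∀ ⦃c d : CP k H⦄ (r : k) (f : c ⟶ d), mp X (r • f) = r • mp X f

/-- The pairs `(c, e : 1 ⟶ c ⊗ M)`. -/
abbrev Pairs (k : Type w) [Field k] [Linear k H] (M : H) : Type _ :=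
  StructuredArrow (𝟙_ H) ((isDualizableCP k H).ι ⋙ tensorRight M)

/-- The diagram `(c, e) ↦ X(c)`. -/
def diag (X : Idx k H ⥤ H) (M : H) : (Pairs k M)ᵒᵖ ⥤ H :=
  (StructuredArrow.proj _ _ ⋙ mopFunctor (CP k H)).op ⋙ X

instance (M : H) : EssentiallySmall.{v} (Pairs k M)ᵒᵖ := inferInstance

instance (M : H) : HasColimitsOfShape (Pairs k M)ᵒᵖ H :=
  hasColimitsOfShape_of_essentiallySmall.{v} _ _

/-- `X × M`: the coend of `Hom(1, c ⊗ M) ⊗ X(c)` over `c`. -/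
def actObj (X : Idx k H ⥤ H) (M : H) : H := colimit (diag X M)

variable {X Y Z : Idx k H ⥤ H} {M N K : H}

variable (X) in
/-- The inclusion of `X(c)` into the coend at `e : 1 ⟶ c ⊗ M`. -/
def inj (c : CP k H) (e : 𝟙_ H ⟶ c.obj ⊗ M) : ob X c ⟶ actObj X M :=
  colimit.ι (diag X M)
    (op (StructuredArrow.mk (T := (isDualizableCP k H).ι ⋙ tensorRight M) (Y := c) e))

lemma inj_w {c d : CP k H} (f : c ⟶ d) (e : 𝟙_ H ⟶ c.obj ⊗ M) :
    mp X f ≫ inj X c e = inj X d (e ≫ f.hom ▷ M) :=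
  colimit.w (diag X M) (Quiver.Hom.op (StructuredArrow.homMk f rfl :
    StructuredArrow.mk (T := (isDualizableCP k H).ι ⋙ tensorRight M) (Y := c) e ⟶
      StructuredArrow.mk (T := (isDualizableCP k H).ι ⋙ tensorRight M) (Y := d) (e ≫ f.hom ▷ M)))

lemma act_ext {W : H} {f g : actObj X M ⟶ W} (h : ∀ c e, inj X c e ≫ f = inj X c e ≫ g) :
    f = g :=
  colimit.hom_ext fun j => h j.unop.right j.unop.hom

/-- The cocone on the diagram defining `X × M` given by a compatible family of maps. -/
def actCocone {W : H} (φ : ∀ c : CP k H, (𝟙_ H ⟶ c.obj ⊗ M) → (ob X c ⟶ W))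
    (hφ : ∀ ⦃c d : CP k H⦄ (f : c ⟶ d) (e), mp X f ≫ φ c e = φ d (e ≫ f.hom ▷ M)) :
    Cocone (diag X M) :=
  Cocone.mk W
    { app := fun j => φ j.unop.right j.unop.hom
      naturality := fun i j f => by
        have h := hφ f.unop.right j.unop.hom
        have h' : j.unop.hom ≫ f.unop.right.hom ▷ M = i.unop.hom := StructuredArrow.w f.unop
        rw [h'] at h
        exact h.trans (comp_id _).symm }

/-- The universal property of `X × M`. -/
def actDesc {W : H} (φ : ∀ c : CP k H, (𝟙_ H ⟶ c.obj ⊗ M) → (ob X c ⟶ W))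
    (hφ : ∀ ⦃c d : CP k H⦄ (f : c ⟶ d) (e), mp X f ≫ φ c e = φ d (e ≫ f.hom ▷ M)) :
    actObj X M ⟶ W := colimit.desc (diag X M) (actCocone φ hφ)

lemma inj_actDesc {W : H} (φ : ∀ c : CP k H, (𝟙_ H ⟶ c.obj ⊗ M) → (ob X c ⟶ W))
    (hφ : ∀ ⦃c d : CP k H⦄ (f : c ⟶ d) (e), mp X f ≫ φ c e = φ d (e ≫ f.hom ▷ M))
    (c : CP k H) (e : 𝟙_ H ⟶ c.obj ⊗ M) : inj X c e ≫ actDesc φ hφ = φ c e :=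
  colimit.ι_desc (actCocone φ hφ) _

section
variable (P : H ⥤ H) [PreservesColimitsOfSize.{v, v} P]

instance preservesDiag : PreservesColimit (diag X M) P := by
  have e := equivSmallModel.{v} (Pairs k M)ᵒᵖ
  have := preservesColimitsOfShape_of_equiv e.symm P
  infer_instance

lemma act_ext_map {W : H} {f g : P.obj (actObj X M) ⟶ W}
    (h : ∀ c e, P.map (inj X c e) ≫ f = P.map (inj X c e) ≫ g) : f = g :=
  (isColimitOfPreserves P (colimit.isColimit (diag X M))).hom_ext
    fun j => h j.unop.right j.unop.hom

/-- The universal property of the image of `X × M` under a cocontinuous functor. -/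
def actDescMap {W : H} (φ : ∀ c : CP k H, (𝟙_ H ⟶ c.obj ⊗ M) → (P.obj (ob X c) ⟶ W))
    (hφ : ∀ ⦃c d : CP k H⦄ (f : c ⟶ d) (e), P.map (mp X f) ≫ φ c e = φ d (e ≫ f.hom ▷ M)) :
    P.obj (actObj X M) ⟶ W :=
  (isColimitOfPreserves P (colimit.isColimit (diag X M))).desc (Cocone.mk W
    { app := fun j => φ j.unop.right j.unop.hom
      naturality := fun i j f => by
        have h := hφ f.unop.right j.unop.hom
        have h' : j.unop.hom ≫ f.unop.right.hom ▷ M = i.unop.hom := StructuredArrow.w f.unop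
        rw [h'] at h
        exact h.trans (comp_id _).symm })

lemma inj_actDescMap {W : H} (φ : ∀ c : CP k H, (𝟙_ H ⟶ c.obj ⊗ M) → (P.obj (ob X c) ⟶ W))
    (hφ : ∀ ⦃c d : CP k H⦄ (f : c ⟶ d) (e), P.map (mp X f) ≫ φ c e = φ d (e ≫ f.hom ▷ M))
    (c : CP k H) (e : 𝟙_ H ⟶ c.obj ⊗ M) : P.map (inj X c e) ≫ actDescMap P φ hφ = φ c e :=
  (isColimitOfPreserves P (colimit.isColimit (diag X M))).fac (Cocone.mk W _)
    (op (StructuredArrow.mk (T := (isDualizableCP k H).ι ⋙ tensorRight M) (Y := c) e))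
end

lemma act_extR {V W : H} {f g : actObj X M ⊗ V ⟶ W}
    (h : ∀ c e, inj X c e ▷ V ≫ f = inj X c e ▷ V ≫ g) : f = g :=
  act_ext_map (tensorRight V) h

lemma act_extL {V W : H} {f g : V ⊗ actObj X M ⟶ W}
    (h : ∀ c e, V ◁ inj X c e ≫ f = V ◁ inj X c e ≫ g) : f = g :=
  act_ext_map (tensorLeft V) h

lemma act_ext₂ {W : H} {f g : actObj X M ⊗ actObj Y N ⟶ W}
    (h : ∀ c e d e', (inj X c e ⊗ₘ inj Y d e') ≫ f = (inj X c e ⊗ₘ inj Y d e') ≫ g) : f = g :=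
  act_extR fun c e => act_extL fun d e' => by
    simpa [tensorHom_def'] using h c e d e'

lemma act_ext₃ {W : H} {f g : (actObj X M ⊗ actObj Y N) ⊗ actObj Z K ⟶ W}
    (h : ∀ c e d e' c' e'', ((inj X c e ⊗ₘ inj Y d e') ⊗ₘ inj Z c' e'') ≫ f =
      ((inj X c e ⊗ₘ inj Y d e') ⊗ₘ inj Z c' e'') ≫ g) : f = g := by
  refine act_ext_map (tensorRight (actObj Y N) ⋙ tensorRight (actObj Z K)) fun c e =>
    act_ext_map (tensorLeft (ob X c) ⋙ tensorRight (actObj Z K)) fun d e' => act_extL fun c' e'' => ?_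
  have := h c e d e' c' e''
  simp only [tensorHom_def', comp_whiskerRight, assoc] at this
  simpa using this

/-- The universal property of `(X × M) ⊗ (Y × N)`. -/
def actDesc₂ {W : H}
    (φ : ∀ (c : CP k H) (_ : 𝟙_ H ⟶ c.obj ⊗ M) (d : CP k H) (_ : 𝟙_ H ⟶ d.obj ⊗ N),
      (ob X c ⊗ ob Y d ⟶ W))
    (h₁ : ∀ ⦃c c' : CP k H⦄ (f : c ⟶ c') (e d e'),
      mp X f ▷ _ ≫ φ c e d e' = φ c' (e ≫ f.hom ▷ M) d e')
    (h₂ : ∀ ⦃d d' : CP k H⦄ (f : d ⟶ d') (c e e'),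
      _ ◁ mp Y f ≫ φ c e d e' = φ c e d' (e' ≫ f.hom ▷ N)) :
    actObj X M ⊗ actObj Y N ⟶ W :=
  actDescMap (tensorRight (actObj Y N))
    (fun c e => actDescMap (tensorLeft (ob X c)) (fun d e' => φ c e d e')
      (fun _ _ f e' => h₂ f c e e'))
    (fun c c' f e => act_extL fun d e' => by
      have := inj_actDescMap (tensorLeft (ob X c)) (fun d e' => φ c e d e')
        (fun _ _ f e' => h₂ f c e e') d e'
      have h' := inj_actDescMap (tensorLeft (ob X c')) (fun d e' => φ c' (e ≫ f.hom ▷ M) d e')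
        (fun _ _ g e' => h₂ g c' (e ≫ f.hom ▷ M) e') d e'
      dsimp at this h' ⊢
      rw [h', whisker_exchange_assoc, this, h₁])

lemma inj_actDesc₂ {W : H}
    (φ : ∀ (c : CP k H) (_ : 𝟙_ H ⟶ c.obj ⊗ M) (d : CP k H) (_ : 𝟙_ H ⟶ d.obj ⊗ N),
      (ob X c ⊗ ob Y d ⟶ W))
    (h₁ : ∀ ⦃c c' : CP k H⦄ (f : c ⟶ c') (e d e'),
      mp X f ▷ _ ≫ φ c e d e' = φ c' (e ≫ f.hom ▷ M) d e')
    (h₂ : ∀ ⦃d d' : CP k H⦄ (f : d ⟶ d') (c e e'),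
      _ ◁ mp Y f ≫ φ c e d e' = φ c e d' (e' ≫ f.hom ▷ N)) (c e d e') :
    (inj X c e ⊗ₘ inj Y d e') ≫ actDesc₂ φ h₁ h₂ = φ c e d e' := by
  rw [tensorHom_def', assoc]
  have h := inj_actDescMap (tensorLeft (ob X c)) (fun d e' => φ c e d e')
        (fun _ _ f e' => h₂ f c e e') d e'
  exact (congrArg (_ ≫ ·) (inj_actDescMap (tensorRight (actObj Y N)) _ _ c e)).trans h

variable (X) in
/-- The functor `X × (-)`. -/
abbrev act : H ⥤ H where
  obj M := actObj X M
  map {M N} g := actDesc (fun c e => inj X c (e ≫ c.obj ◁ g)) (fun c d f e => by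
    rw [inj_w]; simp [whisker_exchange])
  map_id M := act_ext fun c e => by rw [inj_actDesc]; simp
  map_comp f g := act_ext fun c e => by
    rw [inj_actDesc, reassoc_of% inj_actDesc, inj_actDesc]; simp

lemma inj_map (g : M ⟶ N) (c : CP k H) (e) :
    inj X c e ≫ (act X).map g = inj X c (e ≫ c.obj ◁ g) := inj_actDesc _ _ _ _

/-- A map of coefficients at an object. -/
def ap (φ : X ⟶ Y) (c : CP k H) : ob X c ⟶ ob Y c := φ.app _

lemma ap_nat (φ : X ⟶ Y) {c d : CP k H} (f : c ⟶ d) : mp X f ≫ ap φ c = ap φ d ≫ mp Y f :=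
  φ.naturality _

/-- Functoriality of `X × (-)` in `X`. -/
def actMap (φ : X ⟶ Y) : act X ⟶ act Y where
  app M := actDesc (fun c e => ap φ c ≫ inj Y c e) (fun c d f e => by
    rw [← inj_w, reassoc_of% ap_nat])
  naturality M N g := act_ext fun c e => by
    rw [reassoc_of% inj_map, inj_actDesc, reassoc_of% inj_actDesc, assoc, inj_map]

lemma inj_actMap (φ : X ⟶ Y) (M : H) (c : CP k H) (e : 𝟙_ H ⟶ c.obj ⊗ M) :
    inj X c e ≫ (actMap φ).app M = ap φ c ≫ inj Y c e := inj_actDesc _ _ _ _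

end
end
end HarishChandra

namespace HarishChandra

noncomputable section

set_option linter.unusedSectionVars false

open CategoryTheory Category MonoidalCategory Limits Opposite

section
variable {k : Type w} [Field k] {H : Type u} [Category.{v} H] [Preadditive H] [Linear k H]
  [MonoidalCategory H] [MonoidalPreadditive H] [MonoidalLinear k H] [PresentablyMonoidal H]
  [UnitCP k H]

section
variable (X : Idx k H ⥤ H) [X.LaxMonoidal]

/-- The multiplication of an algebra of coefficients. -/
def lm (c d : CP k H) : ob X c ⊗ ob X d ⟶ ob X (d ⊗ c) :=
  Functor.LaxMonoidal.μ X (op (MonoidalOpposite.mop c)) (op (MonoidalOpposite.mop d))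

/-- The unit of an algebra of coefficients. -/
def lu : 𝟙_ H ⟶ ob X (𝟙_ (CP k H)) := Functor.LaxMonoidal.ε X

lemma lm_natR {c c' : CP k H} (f : c ⟶ c') (d : CP k H) :
    mp X f ▷ ob X d ≫ lm X c d = lm X c' d ≫ mp X (d ◁ f) :=
  Functor.LaxMonoidal.μ_natural_left X f.mop.op (op (MonoidalOpposite.mop d))

lemma lm_natL (c : CP k H) {d d' : CP k H} (f : d ⟶ d') :
    ob X c ◁ mp X f ≫ lm X c d = lm X c d' ≫ mp X (f ▷ c) :=
  Functor.LaxMonoidal.μ_natural_right X (op (MonoidalOpposite.mop c)) f.mop.op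

lemma lm_assoc (c d e : CP k H) :
    lm X c d ▷ ob X e ≫ lm X (d ⊗ c) e ≫ mp X (α_ e d c).hom =
      (α_ _ _ _).hom ≫ ob X c ◁ lm X d e ≫ lm X c (e ⊗ d) :=
  Functor.LaxMonoidal.associativity X (op (MonoidalOpposite.mop c)) (op (MonoidalOpposite.mop d))
    (op (MonoidalOpposite.mop e))

lemma lu_left (c : CP k H) :
    (λ_ (ob X c)).hom = lu X ▷ ob X c ≫ lm X (𝟙_ _) c ≫ mp X (ρ_ c).inv :=
  Functor.LaxMonoidal.left_unitality X (op (MonoidalOpposite.mop c))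

lemma lu_right (c : CP k H) :
    (ρ_ (ob X c)).hom = ob X c ◁ lu X ≫ lm X c (𝟙_ _) ≫ mp X (λ_ c).inv :=
  Functor.LaxMonoidal.right_unitality X (op (MonoidalOpposite.mop c))
end

variable {X Y : Idx k H ⥤ H} {M N K : H}

/-- The pair `1 ⟶ d ⊗ N ⟶ d ⊗ ((c ⊗ M) ⊗ N)` obtained from `1 ⟶ c ⊗ M` and `1 ⟶ d ⊗ N`. -/
def pairE {c d : H} (e : 𝟙_ H ⟶ c ⊗ M) (e' : 𝟙_ H ⟶ d ⊗ N) : 𝟙_ H ⟶ (d ⊗ c) ⊗ (M ⊗ N) :=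
  e' ≫ d ◁ ((λ_ N).inv ≫ e ▷ N ≫ (α_ c M N).hom) ≫ (α_ d c (M ⊗ N)).inv

lemma pairE_w₁ {c c' d : H} (f : c ⟶ c') (e : 𝟙_ H ⟶ c ⊗ M) (e' : 𝟙_ H ⟶ d ⊗ N) :
    pairE (e ≫ f ▷ M) e' = pairE e e' ≫ (d ◁ f) ▷ (M ⊗ N) := by
  simp [pairE]

lemma pairE_w₂ {c d d' : H} (f : d ⟶ d') (e : 𝟙_ H ⟶ c ⊗ M) (e' : 𝟙_ H ⟶ d ⊗ N) :
    pairE e (e' ≫ f ▷ N) = pairE e e' ≫ (f ▷ c) ▷ (M ⊗ N) := by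
  simp only [pairE, assoc]
  rw [← whisker_exchange_assoc]
  simp

lemma pairE_nat₁ {c d : H} {M' : H} (g : M ⟶ M') (e : 𝟙_ H ⟶ c ⊗ M) (e' : 𝟙_ H ⟶ d ⊗ N) :
    pairE (e ≫ c ◁ g) e' = pairE e e' ≫ (d ⊗ c) ◁ (g ▷ N) := by
  simp [pairE]

lemma pairE_nat₂ {c d : H} {N' : H} (g : N ⟶ N') (e : 𝟙_ H ⟶ c ⊗ M) (e' : 𝟙_ H ⟶ d ⊗ N) :
    pairE e (e' ≫ d ◁ g) = pairE e e' ≫ (d ⊗ c) ◁ (M ◁ g) := by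
  simp only [pairE, assoc, ← whiskerLeft_comp_assoc, leftUnitor_inv_naturality_assoc]
  rw [whisker_exchange_assoc]
  simp

lemma pairE_assoc {c d b : H} (e : 𝟙_ H ⟶ c ⊗ M) (e' : 𝟙_ H ⟶ d ⊗ N) (e'' : 𝟙_ H ⟶ b ⊗ K) :
    pairE (pairE e e') e'' ≫ _ ◁ (α_ M N K).hom =
      pairE e (pairE e' e'') ≫ (α_ b d c).hom ▷ _ := by
  simp only [pairE]
  monoidal

lemma pairE_left {c : H} (e : 𝟙_ H ⟶ c ⊗ M) :
    pairE (λ_ (𝟙_ H)).inv e ≫ _ ◁ (λ_ M).hom = e ≫ (ρ_ c).inv ▷ M := by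
  simp only [pairE]
  monoidal

lemma pairE_right {c : H} (e : 𝟙_ H ⟶ c ⊗ M) :
    pairE e (λ_ (𝟙_ H)).inv ≫ _ ◁ (ρ_ M).hom = e ≫ (λ_ c).inv ▷ M := by
  simp only [pairE]
  monoidal

section
variable (X) [X.LaxMonoidal]

/-- The multiplication `(X × M) ⊗ (X × N) ⟶ X × (M ⊗ N)`. -/
def actμ (M N : H) : actObj X M ⊗ actObj X N ⟶ actObj X (M ⊗ N) :=
  actDesc₂ (fun c e d e' => lm X c d ≫ inj X (d ⊗ c) (pairE e e'))
    (fun c c' f e d e' => by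
      rw [reassoc_of% lm_natR, inj_w]
      exact congrArg (_ ≫ inj X _ ·) (pairE_w₁ f.hom e e').symm)
    (fun d d' f c e e' => by
      rw [reassoc_of% lm_natL, inj_w]
      exact congrArg (_ ≫ inj X _ ·) (pairE_w₂ f.hom e e').symm)

lemma inj_actμ (c : CP k H) (e : 𝟙_ H ⟶ c.obj ⊗ M) (d : CP k H) (e' : 𝟙_ H ⟶ d.obj ⊗ N) :
    (inj X c e ⊗ₘ inj X d e') ≫ actμ X M N = lm X c d ≫ inj X (d ⊗ c) (pairE e e') :=
  inj_actDesc₂ _ _ _ _ _ _ _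

/-- The unit `1 ⟶ X × 1`. -/
def actε : 𝟙_ H ⟶ actObj X (𝟙_ H) := lu X ≫ inj X (𝟙_ (CP k H)) (λ_ (𝟙_ H)).inv

/-- If `X` is an algebra, then `X × (-)` is lax monoidal. -/
instance actLax : (act X).LaxMonoidal where
  ε := actε X
  μ := actμ X
  μ_natural_left {M M'} g N := act_ext₂ fun c e d e' => by
    rw [reassoc_of% inj_actμ, inj_map, ← tensorHom_id, tensorHom_comp_tensorHom_assoc, inj_map,
      comp_id, inj_actμ]
    exact congrArg (_ ≫ inj X _ ·) (pairE_nat₁ g e e')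
  μ_natural_right M {N N'} g := act_ext₂ fun c e d e' => by
    rw [reassoc_of% inj_actμ, inj_map, ← id_tensorHom, tensorHom_comp_tensorHom_assoc, inj_map,
      comp_id, inj_actμ]
    exact congrArg (_ ≫ inj X _ ·) (pairE_nat₂ g e e')
  associativity M N K := act_ext₃ fun c e d e' b e'' => by
    have h₁ : ((inj X c e ⊗ₘ inj X d e') ⊗ₘ inj X b e'') ≫ actμ X M N ▷ actObj X K =
        lm X c d ▷ ob X b ≫ (inj X (d ⊗ c) (pairE e e') ⊗ₘ inj X b e'') := by
      rw [← tensorHom_id, tensorHom_comp_tensorHom, inj_actμ, comp_id, ← tensorHom_id,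
        tensorHom_comp_tensorHom, id_comp]
    have h₂ : (inj X c e ⊗ₘ (inj X d e' ⊗ₘ inj X b e'')) ≫ actObj X M ◁ actμ X N K =
        ob X c ◁ lm X d b ≫ (inj X c e ⊗ₘ inj X (b ⊗ d) (pairE e' e'')) := by
      rw [← id_tensorHom, tensorHom_comp_tensorHom, inj_actμ, comp_id, ← id_tensorHom,
        tensorHom_comp_tensorHom, id_comp]
    rw [reassoc_of% h₁, reassoc_of% inj_actμ, inj_map, associator_naturality_assoc,
      reassoc_of% h₂, inj_actμ, ← reassoc_of% lm_assoc, inj_w]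
    exact congrArg (_ ≫ _ ≫ inj X _ ·) (pairE_assoc e e' e'')
  left_unitality M := act_extL fun c e => by
    have h : (𝟙_ H) ◁ inj X c e ≫ actε X ▷ actObj X M =
        lu X ▷ ob X c ≫ (inj X (𝟙_ (CP k H)) (λ_ (𝟙_ H)).inv ⊗ₘ inj X c e) := by
      rw [whisker_exchange, actε, comp_whiskerRight, assoc, MonoidalCategory.tensorHom_def]
    rw [leftUnitor_naturality, reassoc_of% h, reassoc_of% inj_actμ, inj_map,
      lu_left X c, assoc, assoc, inj_w]
    exact congrArg (_ ≫ _ ≫ inj X _ ·) (pairE_left e).symm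
  right_unitality M := act_extR fun c e => by
    have h : inj X c e ▷ (𝟙_ H) ≫ actObj X M ◁ actε X =
        ob X c ◁ lu X ≫ (inj X c e ⊗ₘ inj X (𝟙_ (CP k H)) (λ_ (𝟙_ H)).inv) := by
      rw [← whisker_exchange, actε, whiskerLeft_comp, assoc, tensorHom_def']
    rw [rightUnitor_naturality, reassoc_of% h, reassoc_of% inj_actμ, inj_map,
      lu_right X c, assoc, assoc, inj_w]
    exact congrArg (_ ≫ _ ≫ inj X _ ·) (pairE_right e).symm
end
end
end
end HarishChandra

namespace HarishChandra

noncomputable section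

set_option linter.unusedSectionVars false

open CategoryTheory Category MonoidalCategory Limits Opposite

section
variable {k : Type w} [Field k] {H : Type u} [Category.{v} H] [Preadditive H] [Linear k H]
  [MonoidalCategory H]

/-- A chosen right dual of a compact projective object. -/
instance cpDual (c : CP k H) : HasRightDual c.obj := c.property.2.some

/-- The dual of a compact projective object. -/
def dl (c : CP k H) : H := (c.obj)ᘁ

/-- The evaluation `cᵛ ⊗ c ⟶ 1`. -/
def dev (c : CP k H) : dl c ⊗ c.obj ⟶ 𝟙_ H := ε_ c.obj (c.obj)ᘁ

/-- The coevaluation `1 ⟶ c ⊗ cᵛ`. -/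
def dcoev (c : CP k H) : 𝟙_ H ⟶ c.obj ⊗ dl c := η_ c.obj (c.obj)ᘁ

instance dlPairing (c : CP k H) : ExactPairing c.obj (dl c) := (cpDual c).exact

/-- The transpose of a pairing. -/
def tr {A : H} {c : CP k H} (h : A ⊗ c.obj ⟶ 𝟙_ H) : A ⟶ dl c :=
  tensorRightHomEquiv A c.obj (dl c) (𝟙_ H) h ≫ (λ_ _).hom

lemma tr_dev {A : H} {c : CP k H} (h : A ⊗ c.obj ⟶ 𝟙_ H) : tr h ▷ c.obj ≫ dev c = h := by
  have h' := (tensorRightHomEquiv A c.obj (dl c) (𝟙_ H)).left_inv h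
  change (_ ▷ _ ≫ (α_ _ _ _).hom ≫ _ ◁ dev c ≫ (ρ_ _).hom) = h at h'
  rw [tr, comp_whiskerRight, assoc]
  refine Eq.trans ?_ h'
  change _ = (tensorRightHomEquiv A c.obj (dl c) (𝟙_ H) h) ▷ _ ≫ _
  congr 1
  rw [← unitors_equal, leftUnitor_naturality]
  simp

lemma dl_ext {A : H} {c : CP k H} {f g : A ⟶ dl c}
    (h : f ▷ c.obj ≫ dev c = g ▷ c.obj ≫ dev c) : f = g := by
  have key (f : A ⟶ dl c) : tr (f ▷ c.obj ≫ dev c) = f := by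
    have h₁ : tensorRightHomEquiv A c.obj (dl c) (𝟙_ H) (f ▷ c.obj ≫ dev c) = f ≫ (λ_ _).inv := by
      rw [← Equiv.eq_symm_apply]
      change f ▷ c.obj ≫ dev c =
        (f ≫ (λ_ _).inv) ▷ _ ≫ (α_ _ _ _).hom ≫ _ ◁ dev c ≫ (ρ_ _).hom
      rw [← unitors_equal, leftUnitor_naturality]
      simp
    rw [tr, h₁]
    simp
  rw [← key f, h, key g]

/-- The dual of a map. -/
def dmap {c d : CP k H} (f : c ⟶ d) : dl d ⟶ dl c := tr (dl d ◁ f.hom ≫ dev d)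

lemma dmap_dev {c d : CP k H} (f : c ⟶ d) : dmap f ▷ c.obj ≫ dev c = dl d ◁ f.hom ≫ dev d :=
  tr_dev _

variable (k H) in
/-- The unit `𝒟` of the Takeuchi product: it sends `c` to its dual. -/
def unitD : Idx k H ⥤ H where
  obj c := dl c.unop.unmop
  map f := dmap f.unop.unmop
  map_id c := dl_ext (by
    rw [dmap_dev]
    change _ ◁ 𝟙 _ ≫ _ = _
    simp)
  map_comp {a b c} f g := dl_ext (by
    rw [dmap_dev, comp_whiskerRight, assoc, dmap_dev, ← whisker_exchange_assoc, dmap_dev,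
      ← whiskerLeft_comp_assoc]
    rfl)

lemma ob_unitD [MonoidalPreadditive H] [MonoidalLinear k H] [PresentablyMonoidal H] (c : CP k H) :
    ob (unitD k H) c = dl c := rfl

variable [MonoidalPreadditive H] [MonoidalLinear k H] [PresentablyMonoidal H] [UnitCP k H]

/-- The nested evaluation. -/
def nev (c d : CP k H) : (dl c ⊗ dl d) ⊗ (d.obj ⊗ c.obj) ⟶ 𝟙_ H :=
  (α_ _ _ _).hom ≫ dl c ◁ ((α_ _ _ _).inv ≫ dev d ▷ c.obj ≫ (λ_ _).hom) ≫ dev c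

/-- The multiplication `cᵛ ⊗ dᵛ ⟶ (d ⊗ c)ᵛ`. -/
def dμ (c d : CP k H) : dl c ⊗ dl d ⟶ dl (d ⊗ c) := tr (nev c d)

lemma dμ_dev (c d : CP k H) : dμ c d ▷ (d.obj ⊗ c.obj) ≫ dev (d ⊗ c) = nev c d := tr_dev _

/-- The unit `1 ⟶ 1ᵛ`. -/
def dε : 𝟙_ H ⟶ dl (𝟙_ (CP k H)) := tr (λ_ (𝟙_ H)).hom

lemma dε_dev : dε ▷ 𝟙_ H ≫ dev (𝟙_ (CP k H)) = (λ_ (𝟙_ H)).hom := tr_dev _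

lemma dμ_natR {c c' : CP k H} (f : c ⟶ c') (d : CP k H) :
    dmap f ▷ dl d ≫ dμ c d = dμ c' d ≫ dmap (d ◁ f) := dl_ext (by
  have h : dmap (d ◁ f) ▷ (d.obj ⊗ c.obj) ≫ dev (d ⊗ c) = _ ◁ (d.obj ◁ f.hom) ≫ dev (d ⊗ c') :=
    dmap_dev (d ◁ f)
  change _ ▷ (d.obj ⊗ c.obj) ≫ dev (d ⊗ c) = _ ▷ (d.obj ⊗ c.obj) ≫ dev (d ⊗ c)
  rw [comp_whiskerRight, assoc, dμ_dev, comp_whiskerRight, assoc, h, ← whisker_exchange_assoc,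
    dμ_dev, nev, nev, associator_naturality_left_assoc, ← whisker_exchange_assoc, dmap_dev,
    ← whiskerLeft_comp_assoc, tensor_whiskerLeft_assoc, Iso.inv_hom_id_assoc,
    ← whiskerLeft_comp_assoc, assoc, assoc, associator_inv_naturality_right_assoc,
    whisker_exchange_assoc, ← leftUnitor_naturality])

lemma dμ_natL (c : CP k H) {d d' : CP k H} (f : d ⟶ d') :
    dl c ◁ dmap f ≫ dμ c d = dμ c d' ≫ dmap (f ▷ c) := dl_ext (by
  have h : dmap (f ▷ c) ▷ (d.obj ⊗ c.obj) ≫ dev (d ⊗ c) = _ ◁ (f.hom ▷ c.obj) ≫ dev (d' ⊗ c) :=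
    dmap_dev (f ▷ c)
  change _ ▷ (d.obj ⊗ c.obj) ≫ dev (d ⊗ c) = _ ▷ (d.obj ⊗ c.obj) ≫ dev (d ⊗ c)
  rw [comp_whiskerRight, assoc, dμ_dev, comp_whiskerRight, assoc, h, ← whisker_exchange_assoc,
    dμ_dev, nev, nev, associator_naturality_middle_assoc, tensor_whiskerLeft_assoc,
    Iso.inv_hom_id_assoc, ← whiskerLeft_comp_assoc, ← whiskerLeft_comp_assoc,
    associator_inv_naturality_left_assoc, associator_inv_naturality_middle_assoc,
    ← comp_whiskerRight_assoc, ← comp_whiskerRight_assoc, dmap_dev])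

lemma dμ_assoc (c d e : CP k H) :
    dμ c d ▷ dl e ≫ dμ (d ⊗ c) e ≫ dmap (α_ e d c).hom =
      (α_ _ _ _).hom ≫ dl c ◁ dμ d e ≫ dμ c (e ⊗ d) := dl_ext (by
  have h : dmap (α_ e d c).hom ▷ ((e.obj ⊗ d.obj) ⊗ c.obj) ≫ dev ((e ⊗ d) ⊗ c) =
      _ ◁ (α_ e.obj d.obj c.obj).hom ≫ dev (e ⊗ (d ⊗ c)) := dmap_dev (α_ e d c).hom
  have h₁ : dμ (d ⊗ c) e ▷ (e.obj ⊗ (d.obj ⊗ c.obj)) ≫ dev (e ⊗ (d ⊗ c)) =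
    (α_ _ _ _).hom ≫ dl (d ⊗ c) ◁ ((α_ _ _ _).inv ≫ dev e ▷ (d.obj ⊗ c.obj) ≫ (λ_ _).hom) ≫
      dev (d ⊗ c) := dμ_dev _ _
  have h₂ : dμ c (e ⊗ d) ▷ ((e.obj ⊗ d.obj) ⊗ c.obj) ≫ dev ((e ⊗ d) ⊗ c) =
    (α_ _ _ _).hom ≫ dl c ◁ ((α_ _ (e.obj ⊗ d.obj) _).inv ≫ dev (e ⊗ d) ▷ c.obj ≫ (λ_ _).hom) ≫
      dev c := dμ_dev _ _
  change _ ▷ ((e.obj ⊗ d.obj) ⊗ c.obj) ≫ dev ((e ⊗ d) ⊗ c) =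
    _ ▷ ((e.obj ⊗ d.obj) ⊗ c.obj) ≫ dev ((e ⊗ d) ⊗ c)
  simp only [comp_whiskerRight, assoc]
  rw [h, h₂, ← whisker_exchange_assoc, h₁, ← whisker_exchange_assoc,
    associator_naturality_left_assoc, ← whisker_exchange_assoc, dμ_dev,
    associator_naturality_middle_assoc, ← whiskerLeft_comp_assoc,
    associator_inv_naturality_left_assoc, ← comp_whiskerRight_assoc, dμ_dev, nev, nev]
  simp only [comp_whiskerRight, whiskerLeft_comp, assoc]
  monoidal)

lemma dε_left (c : CP k H) :
    (λ_ (dl c)).hom = dε ▷ dl c ≫ dμ (𝟙_ _) c ≫ dmap (ρ_ c).inv := dl_ext (by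
  have h : dmap (ρ_ c).inv ▷ c.obj ≫ dev c = _ ◁ (ρ_ c.obj).inv ≫ dev (c ⊗ 𝟙_ (CP k H)) :=
    dmap_dev (ρ_ c).inv
  have h₁ : dμ (𝟙_ _) c ▷ (c.obj ⊗ 𝟙_ H) ≫ dev (c ⊗ 𝟙_ (CP k H)) =
    (α_ _ _ _).hom ≫ dl (𝟙_ (CP k H)) ◁ ((α_ _ _ _).inv ≫ dev c ▷ (𝟙_ H) ≫ (λ_ _).hom) ≫
      dev (𝟙_ (CP k H)) := dμ_dev _ _
  simp only [comp_whiskerRight, assoc]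
  rw [h, ← whisker_exchange_assoc, h₁, ← whisker_exchange_assoc,
    associator_naturality_left_assoc, ← whisker_exchange_assoc, dε_dev]
  simp only [whiskerLeft_comp, assoc]
  monoidal)

lemma dε_right (c : CP k H) :
    (ρ_ (dl c)).hom = dl c ◁ dε ≫ dμ c (𝟙_ _) ≫ dmap (λ_ c).inv := dl_ext (by
  have h : dmap (λ_ c).inv ▷ c.obj ≫ dev c = _ ◁ (λ_ c.obj).inv ≫ dev (𝟙_ (CP k H) ⊗ c) :=
    dmap_dev (λ_ c).inv
  have h₁ : dμ c (𝟙_ _) ▷ (𝟙_ H ⊗ c.obj) ≫ dev (𝟙_ (CP k H) ⊗ c) =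
    (α_ _ _ _).hom ≫ dl c ◁ ((α_ _ (𝟙_ H) _).inv ≫ dev (𝟙_ (CP k H)) ▷ c.obj ≫ (λ_ _).hom) ≫
      dev c := dμ_dev _ _
  simp only [comp_whiskerRight, assoc]
  rw [h, ← whisker_exchange_assoc, h₁, ← whisker_exchange_assoc,
    associator_naturality_middle_assoc, ← whiskerLeft_comp_assoc,
    associator_inv_naturality_left_assoc, ← comp_whiskerRight_assoc, dε_dev]
  simp only [whiskerLeft_comp, assoc]
  monoidal)

/-- The algebra structure on the unit `𝒟` of the Takeuchi product. -/
instance unitDLax : (unitD k H).LaxMonoidal where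
  ε := dε
  μ c d := dμ c.unop.unmop d.unop.unmop
  μ_natural_left f d := dμ_natR f.unop.unmop d.unop.unmop
  μ_natural_right c f := dμ_natL c.unop.unmop f.unop.unmop
  associativity c d e := dμ_assoc c.unop.unmop d.unop.unmop e.unop.unmop
  left_unitality c := dε_left c.unop.unmop
  right_unitality c := dε_right c.unop.unmop

end
end
end HarishChandra

namespace HarishChandra

noncomputable section

set_option linter.unusedSectionVars false

open CategoryTheory Category MonoidalCategory Limits Opposite

section
variable {k : Type w} [Field k] {H : Type u} [Category.{v} H] [Preadditive H] [Linear k H]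
  [MonoidalCategory H] [MonoidalPreadditive H] [MonoidalLinear k H] [PresentablyMonoidal H]
  [UnitCP k H]

/-- The map `cᵛ ⟶ M` corresponding to `1 ⟶ c ⊗ M`. -/
def adjunct {c : CP k H} {M : H} (e : 𝟙_ H ⟶ c.obj ⊗ M) : dl c ⟶ M :=
  (ρ_ _).inv ≫ dl c ◁ e ≫ (α_ _ _ _).inv ≫ dev c ▷ M ≫ (λ_ _).hom

lemma adjunct_w {c d : CP k H} {M : H} (f : c ⟶ d) (e : 𝟙_ H ⟶ c.obj ⊗ M) :
    dmap f ≫ adjunct e = adjunct (c := d) (e ≫ f.hom ▷ M) := by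
  rw [adjunct, adjunct, rightUnitor_inv_naturality_assoc, ← whisker_exchange_assoc,
    associator_inv_naturality_left_assoc, ← comp_whiskerRight_assoc, dmap_dev, comp_whiskerRight,
    assoc, whiskerLeft_comp, assoc, associator_inv_naturality_middle_assoc]

lemma adjunct_nat {c : CP k H} {M N : H} (e : 𝟙_ H ⟶ c.obj ⊗ M) (g : M ⟶ N) :
    adjunct e ≫ g = adjunct (e ≫ c.obj ◁ g) := by
  rw [adjunct, adjunct]
  simp only [assoc, whiskerLeft_comp]
  rw [associator_inv_naturality_right_assoc, whisker_exchange_assoc, leftUnitor_naturality]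

lemma coev_adjunct {c : CP k H} {M : H} (e : 𝟙_ H ⟶ c.obj ⊗ M) :
    dcoev c ≫ c.obj ◁ adjunct e = e := by
  have h : dcoev c ▷ c.obj ≫ (α_ _ _ _).hom ≫ c.obj ◁ dev c = (λ_ _).hom ≫ (ρ_ _).inv :=
    ExactPairing.evaluation_coevaluation c.obj (dl c)
  have h' : dcoev c ≫ c.obj ◁ adjunct e =
    (λ_ _).inv ≫ 𝟙_ H ◁ e ≫ (α_ _ _ _).inv ≫
      (dcoev c ▷ c.obj ≫ (α_ _ _ _).hom ≫ c.obj ◁ dev c) ▷ M ≫ (ρ_ _).hom ▷ M := by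
    rw [comp_whiskerRight, assoc, ← associator_inv_naturality_left_assoc,
      whisker_exchange_assoc, adjunct]
    monoidal
  rw [h', h]
  monoidal

lemma nest_aux {A B c d M N : H} (p : A ⊗ c ⟶ 𝟙_ H) (q : B ⊗ d ⟶ 𝟙_ H) (e : 𝟙_ H ⟶ c ⊗ M)
    (e' : 𝟙_ H ⟶ d ⊗ N) :
    (ρ_ _).inv ≫ (A ⊗ B) ◁ (e' ≫ d ◁ ((λ_ N).inv ≫ e ▷ N ≫ (α_ c M N).hom) ≫ (α_ _ _ _).inv) ≫
      (α_ _ _ _).inv ≫ ((α_ _ _ _).hom ≫ A ◁ ((α_ _ _ _).inv ≫ q ▷ c ≫ (λ_ _).hom) ≫ p) ▷ (M ⊗ N) ≫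
        (λ_ _).hom =
    A ◁ ((ρ_ _).inv ≫ B ◁ e' ≫ (α_ _ _ _).inv ≫ q ▷ N ≫ (λ_ _).hom) ≫
      ((ρ_ _).inv ≫ A ◁ e ≫ (α_ _ _ _).inv ≫ p ▷ M ≫ (λ_ _).hom) ▷ N := by
  have h := whisker_exchange q (e ▷ N)
  trans A ◁ ((ρ_ _).inv ≫ B ◁ (e' ≫ d ◁ (λ_ N).inv) ≫ (α_ _ _ _).inv ≫
    ((B ⊗ d) ◁ (e ▷ N) ≫ q ▷ ((c ⊗ M) ⊗ N)) ≫ (λ_ _).hom ≫ (α_ _ _ _).hom) ≫ (α_ _ _ _).inv ≫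
      p ▷ _ ≫ (λ_ _).hom
  · monoidal
  · rw [h]
    monoidal

lemma dμ_adjunct {c d : CP k H} {M N : H} (e : 𝟙_ H ⟶ c.obj ⊗ M) (e' : 𝟙_ H ⟶ d.obj ⊗ N) :
    dμ c d ≫ adjunct (c := d ⊗ c) (pairE e e') = adjunct e ⊗ₘ adjunct e' := by
  have h : dμ c d ▷ (d.obj ⊗ c.obj) ≫ dev (d ⊗ c) = nev c d := dμ_dev c d
  have h₁ : dμ c d ≫ adjunct (c := d ⊗ c) (pairE e e') = (ρ_ _).inv ≫ (dl c ⊗ dl d) ◁ pairE e e' ≫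
      (α_ _ _ _).inv ≫ (dμ c d ▷ (d.obj ⊗ c.obj) ≫ dev (d ⊗ c)) ▷ (M ⊗ N) ≫ (λ_ _).hom := by
    have h₂ : adjunct (c := d ⊗ c) (pairE e e') = (ρ_ _).inv ≫ dl (d ⊗ c) ◁ pairE e e' ≫
      (α_ _ _ _).inv ≫ dev (d ⊗ c) ▷ (M ⊗ N) ≫ (λ_ _).hom := rfl
    rw [h₂, rightUnitor_inv_naturality_assoc, ← whisker_exchange_assoc]
    erw [associator_inv_naturality_left_assoc, ← comp_whiskerRight_assoc]
  rw [h₁, h, tensorHom_def', nev, adjunct, adjunct, pairE]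
  exact nest_aux _ _ e e'

variable {X Y : Idx k H ⥤ H}

/-- The map `𝒟(c) ⟶ M` corresponding to `1 ⟶ c ⊗ M`. -/
def adjD {c : CP k H} {M : H} (e : 𝟙_ H ⟶ c.obj ⊗ M) : ob (unitD k H) c ⟶ M := adjunct e

lemma adjD_w {c d : CP k H} {M : H} (f : c ⟶ d) (e : 𝟙_ H ⟶ c.obj ⊗ M) :
    mp (unitD k H) f ≫ adjD e = adjD (c := d) (e ≫ f.hom ▷ M) := adjunct_w f e

lemma adjD_nat {c : CP k H} {M N : H} (e : 𝟙_ H ⟶ c.obj ⊗ M) (g : M ⟶ N) :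
    adjD e ≫ g = adjD (e ≫ c.obj ◁ g) := adjunct_nat e g

lemma lm_adjD {c d : CP k H} {M N : H} (e : 𝟙_ H ⟶ c.obj ⊗ M) (e' : 𝟙_ H ⟶ d.obj ⊗ N) :
    lm (unitD k H) c d ≫ adjD (c := d ⊗ c) (pairE e e') = adjD e ⊗ₘ adjD e' := dμ_adjunct e e'

lemma lu_adjD : lu (unitD k H) ≫ adjD (c := 𝟙_ (CP k H)) (λ_ (𝟙_ H)).inv = 𝟙 _ := by
  have h : adjunct (c := 𝟙_ (CP k H)) (λ_ (𝟙_ H)).inv =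
    (ρ_ _).inv ≫ dl (𝟙_ (CP k H)) ◁ (λ_ (𝟙_ H)).inv ≫ (α_ _ _ _).inv ≫
      dev (𝟙_ (CP k H)) ▷ (𝟙_ H) ≫ (λ_ _).hom := rfl
  have h' : dε ≫ adjunct (c := 𝟙_ (CP k H)) (λ_ (𝟙_ H)).inv = 𝟙 (𝟙_ H) := by
    rw [h, rightUnitor_inv_naturality_assoc, ← whisker_exchange_assoc,
      associator_inv_naturality_left_assoc, ← comp_whiskerRight_assoc, dε_dev]
    monoidal
  exact h'

variable (k H) in
/-- The action of `𝒟` is the identity. -/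
def unitAct : act (unitD k H) ⟶ 𝟭 H where
  app M := actDesc (X := unitD k H) (W := M) (fun c e => adjD e) (fun c d f e => adjD_w f e)
  naturality M N g := act_ext fun c e => by
    rw [reassoc_of% inj_map, inj_actDesc, reassoc_of% inj_actDesc]
    exact (adjD_nat e g).symm

lemma inj_unitAct (M : H) (c : CP k H) (e : 𝟙_ H ⟶ c.obj ⊗ M) :
    inj (unitD k H) c e ≫ (unitAct k H).app M = adjD e := inj_actDesc _ _ _ _

variable (X) in
/-- The map `(X × Y)(c) ⟶ X × (Y × M)` at `e : 1 ⟶ c ⊗ M`. -/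
def injC (c : CP k H) {M : H} (e : 𝟙_ H ⟶ c.obj ⊗ M) :
    ob (Y ⋙ act X) c ⟶ actObj X (actObj Y M) := (act X).map (inj Y c e)

lemma injC_w {c d : CP k H} {M : H} (f : c ⟶ d) (e : 𝟙_ H ⟶ c.obj ⊗ M) :
    mp (Y ⋙ act X) f ≫ injC X c e = injC X d (e ≫ f.hom ▷ M) :=
  ((act X).map_comp _ _).symm.trans (congrArg (act X).map (inj_w f e))

lemma injC_nat {c : CP k H} {M N : H} (e : 𝟙_ H ⟶ c.obj ⊗ M) (g : M ⟶ N) :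
    injC (Y := Y) X c e ≫ (act X).map ((act Y).map g) = injC X c (e ≫ c.obj ◁ g) :=
  ((act X).map_comp _ _).symm.trans (congrArg (act X).map (inj_map g c e))

variable (X Y) in
/-- The map `(X × Y) × M ⟶ X × (Y × M)`. -/
def compAct : act (Y ⋙ act X) ⟶ act Y ⋙ act X where
  app M := actDesc (X := Y ⋙ act X) (W := actObj X (actObj Y M)) (fun c e => injC X c e)
    (fun c d f e => injC_w f e)
  naturality M N g := act_ext fun c e => by
    rw [reassoc_of% inj_map, inj_actDesc, reassoc_of% inj_actDesc]
    exact (injC_nat e g).symm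

lemma inj_compAct (M : H) (c : CP k H) (e : 𝟙_ H ⟶ c.obj ⊗ M) :
    inj (Y ⋙ act X) c e ≫ (compAct X Y).app M = injC X c e := inj_actDesc _ _ _ _

lemma lm_injC [X.LaxMonoidal] [Y.LaxMonoidal] {c d : CP k H} {M N : H} (e : 𝟙_ H ⟶ c.obj ⊗ M)
    (e' : 𝟙_ H ⟶ d.obj ⊗ N) :
    lm (Y ⋙ act X) c d ≫ injC X (d ⊗ c) (pairE e e') =
      (injC X c e ⊗ₘ injC X d e') ≫ actμ X _ _ ≫ (act X).map (actμ Y M N) := by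
  have h : ((act X).map (inj Y c e) ⊗ₘ (act X).map (inj Y d e')) ≫ actμ X _ _ = actμ X _ _ ≫
      (act X).map (inj Y c e ⊗ₘ inj Y d e') := (Functor.LaxMonoidal.μ_natural (act X) _ _)
  have h₁ : (act X).map (inj Y c e ⊗ₘ inj Y d e') ≫ (act X).map (actμ Y M N) =
      (act X).map (lm Y c d) ≫ (act X).map (inj Y (d ⊗ c) (pairE e e')) :=
    ((act X).map_comp _ _).symm.trans ((congrArg (act X).map (inj_actμ Y c e d e')).trans
      ((act X).map_comp _ _))
  have h₂ := congrArg (· ≫ (act X).map (actμ Y M N)) h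
  have h₃ := congrArg (actμ X _ _ ≫ ·) h₁
  exact (assoc (actμ X _ _) _ _).trans
    (h₃.symm.trans ((assoc _ _ _).symm.trans (h₂.symm.trans (assoc _ _ _))))

lemma lu_injC [X.LaxMonoidal] [Y.LaxMonoidal] :
    lu (Y ⋙ act X) ≫ injC X (𝟙_ (CP k H)) (λ_ (𝟙_ H)).inv = actε X ≫ (act X).map (actε Y) := by
  have h : (act X).map (lu Y) ≫ (act X).map (inj Y (𝟙_ (CP k H)) (λ_ (𝟙_ H)).inv) =
    (act X).map (actε Y) := ((act X).map_comp _ _).symm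
  exact (assoc (actε X) _ _).trans (congrArg (actε X ≫ ·) h)

/-- A map of algebras induces a monoidal natural transformation. -/
instance actMap_isMonoidal [X.LaxMonoidal] [Y.LaxMonoidal] (φ : X ⟶ Y) [φ.IsMonoidal] :
    (actMap φ).IsMonoidal where
  unit := by
    have h : lu X ≫ ap φ _ = lu Y := NatTrans.IsMonoidal.unit (τ := φ)
    change (lu X ≫ inj X _ _) ≫ _ = lu Y ≫ inj Y _ _
    rw [assoc, inj_actMap, reassoc_of% h]
  tensor M N := act_ext₂ fun c e d e' => by
    have h : lm X c d ≫ ap φ _ = (ap φ c ⊗ₘ ap φ d) ≫ lm Y c d :=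
      NatTrans.IsMonoidal.tensor (τ := φ) _ _
    change _ ≫ actμ X M N ≫ _ = _ ≫ _ ≫ actμ Y M N
    rw [reassoc_of% inj_actμ, inj_actMap, tensorHom_comp_tensorHom_assoc, inj_actMap, inj_actMap,
      ← tensorHom_comp_tensorHom_assoc, inj_actμ, reassoc_of% h]

instance unitAct_isMonoidal : (unitAct k H).IsMonoidal where
  unit := by
    change (lu (unitD k H) ≫ inj (unitD k H) _ _) ≫ _ = 𝟙 _
    rw [assoc, inj_unitAct, lu_adjD]
  tensor M N := act_ext₂ fun c e d e' => by
    change _ ≫ actμ _ M N ≫ _ = _ ≫ _ ≫ 𝟙 _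
    rw [reassoc_of% inj_actμ, inj_unitAct, comp_id, tensorHom_comp_tensorHom, inj_unitAct,
      inj_unitAct]
    exact lm_adjD e e'

instance compAct_isMonoidal [X.LaxMonoidal] [Y.LaxMonoidal] : (compAct X Y).IsMonoidal where
  unit := by
    change (lu (Y ⋙ act X) ≫ inj (Y ⋙ act X) (𝟙_ (CP k H)) (λ_ (𝟙_ H)).inv) ≫ _ =
      actε X ≫ (act X).map (actε Y)
    rw [assoc, inj_compAct, lu_injC]
  tensor M N := act_ext₂ fun c e d e' => by
    change _ ≫ actμ _ M N ≫ _ = _ ≫ _ ≫ actμ X _ _ ≫ (act X).map (actμ Y M N)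
    rw [reassoc_of% inj_actμ, inj_compAct, tensorHom_comp_tensorHom_assoc, inj_compAct,
      inj_compAct]
    exact lm_injC e e'

end
end
end HarishChandra

namespace HarishChandra

noncomputable section

set_option linter.unusedSectionVars false

open CategoryTheory Category MonoidalCategory Limits Opposite

section
variable {k : Type w} [Field k] {H : Type u} [Category.{v} H] [Preadditive H] [Linear k H]
  [MonoidalCategory H] [MonoidalPreadditive H] [MonoidalLinear k H] [PresentablyMonoidal H]
  [UnitCP k H]

/-- The component `X(c) ⟶ X × X(c)` of a coproduct. -/
def cop {X : Idx k H ⥤ H} (Δ : X ⟶ X ⋙ act X) (c : CP k H) : ob X c ⟶ actObj X (ob X c) := ap Δ c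

/-- The component `X(c) ⟶ cᵛ` of a counit. -/
def cou {X : Idx k H ⥤ H} (ε : X ⟶ unitD k H) (c : CP k H) : ob X c ⟶ dl c := ap ε c

/-- The natural map `X × M ⟶ X × (X × M)` induced by a coproduct. -/
def comulAct {X : Idx k H ⥤ H} (Δ : X ⟶ X ⋙ act X) : act X ⟶ act X ⋙ act X :=
  actMap Δ ≫ compAct X X

/-- The natural map `X × M ⟶ M` induced by a counit. -/
def counitAct {X : Idx k H ⥤ H} (ε : X ⟶ unitD k H) : act X ⟶ 𝟭 H := actMap ε ≫ unitAct k H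

lemma inj_comulAct {X : Idx k H ⥤ H} (Δ : X ⟶ X ⋙ act X) (M : H) (c : CP k H)
    (e : 𝟙_ H ⟶ c.obj ⊗ M) :
    inj X c e ≫ (comulAct Δ).app M = cop Δ c ≫ (act X).map (inj X c e) := by
  rw [comulAct, NatTrans.comp_app, reassoc_of% inj_actMap, inj_compAct]
  rfl

lemma inj_counitAct {X : Idx k H ⥤ H} (ε : X ⟶ unitD k H) (M : H) (c : CP k H)
    (e : 𝟙_ H ⟶ c.obj ⊗ M) :
    inj X c e ≫ (counitAct ε).app M = cou ε c ≫ adjunct e := by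
  rw [counitAct, NatTrans.comp_app, reassoc_of% inj_actMap, inj_unitAct]
  rfl

variable (k H) in
/-- An algebra in `H ⊗ H^{⊗op}` which is at the same time a coalgebra for the Takeuchi product,
such that the coproduct and the counit are maps of algebras. An object of `H ⊗ H^{⊗op}` is a
`k`-linear functor `X` of coefficients, where `M₁ ⊠ M₂` is the functor `c ↦ Hom(c, M₂) ⊗ M₁`;
an algebra is a lax monoidal functor. -/
structure Bialgebroid where
  /-- The underlying object. -/
  X : Idx k H ⥤ H
  isLin : IsLin X
  /-- The algebra structure. -/
  alg : X.LaxMonoidal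
  /-- The coproduct. -/
  Δ : X ⟶ X ⋙ act X
  Δ_isMonoidal : Δ.IsMonoidal
  /-- The counit. -/
  ε : X ⟶ unitD k H
  ε_isMonoidal : ε.IsMonoidal
  coassoc : ∀ c : CP k H,
    cop Δ c ≫ (act X).map (cop Δ c) = cop Δ c ≫ (comulAct Δ).app (ob X c)
  counit_left : ∀ c : CP k H, cop Δ c ≫ (counitAct ε).app (ob X c) = 𝟙 (ob X c)
  counit_right : ∀ c : CP k H, cop Δ c ≫ (act X).map (cou ε c) = inj X c (dcoev c)

namespace Bialgebroid
variable (B : Bialgebroid k H)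

instance : B.X.LaxMonoidal := B.alg
instance : B.Δ.IsMonoidal := B.Δ_isMonoidal
instance : B.ε.IsMonoidal := B.ε_isMonoidal

/-- The comonad `B × (-)`. -/
def comonad : Comonad H where
  toFunctor := act B.X
  ε := counitAct B.ε
  δ := comulAct B.Δ
  coassoc M := act_ext fun c e => by
    change _ ≫ (comulAct B.Δ).app M ≫ (act B.X).map ((comulAct B.Δ).app M) =
      _ ≫ (comulAct B.Δ).app M ≫ (comulAct B.Δ).app (actObj B.X M)
    have h : (act B.X).map (inj B.X c e) ≫ (act B.X).map ((comulAct B.Δ).app M) =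
        (act B.X).map (cop B.Δ c) ≫ (act B.X).map ((act B.X).map (inj B.X c e)) :=
      ((act B.X).map_comp _ _).symm.trans ((congrArg (act B.X).map (inj_comulAct B.Δ M c e)).trans
        ((act B.X).map_comp _ _))
    have h' : (act B.X).map (inj B.X c e) ≫ (comulAct B.Δ).app (actObj B.X M) =
        (comulAct B.Δ).app (ob B.X c) ≫ (act B.X).map ((act B.X).map (inj B.X c e)) :=
      (comulAct B.Δ).naturality (inj B.X c e)
    rw [reassoc_of% inj_comulAct, reassoc_of% inj_comulAct]
    exact (congrArg (_ ≫ ·) h).trans ((assoc _ _ _).symm.trans ((congrArg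
      (· ≫ (act B.X).map ((act B.X).map (inj B.X c e))) (B.coassoc c)).trans
        ((assoc _ _ _).trans (congrArg (_ ≫ ·) h'.symm))))
  left_counit M := act_ext fun c e => by
    change _ ≫ (comulAct B.Δ).app M ≫ (counitAct B.ε).app (actObj B.X M) = _ ≫ 𝟙 _
    rw [reassoc_of% inj_comulAct, comp_id]
    have h := (counitAct B.ε).naturality (inj B.X c e)
    exact (congrArg (_ ≫ ·) h).trans (((assoc _ _ _).symm.trans
      (congrArg (· ≫ inj B.X c e) (B.counit_left c))).trans (id_comp _))
  right_counit M := act_ext fun c e => by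
    change _ ≫ (comulAct B.Δ).app M ≫ (act B.X).map ((counitAct B.ε).app M) = _ ≫ 𝟙 _
    rw [reassoc_of% inj_comulAct, comp_id]
    have h : (act B.X).map (inj B.X c e) ≫ (act B.X).map ((counitAct B.ε).app M) =
        (act B.X).map (cou B.ε c) ≫ (act B.X).map (adjunct e) :=
      ((act B.X).map_comp _ _).symm.trans ((congrArg (act B.X).map (inj_counitAct B.ε M c e)).trans
        ((act B.X).map_comp _ _))
    exact (congrArg (_ ≫ ·) h).trans ((assoc _ _ _).symm.trans ((congrArg
      (· ≫ (act B.X).map (adjunct e)) (B.counit_right c)).trans ((inj_map _ _ _).trans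
        (congrArg (inj B.X c) (coev_adjunct e)))))

instance : B.comonad.toFunctor.LaxMonoidal := inferInstanceAs (act B.X).LaxMonoidal
instance : B.comonad.δ.IsMonoidal := inferInstanceAs (actMap B.Δ ≫ compAct B.X B.X).IsMonoidal
instance : B.comonad.ε.IsMonoidal := inferInstanceAs (actMap B.ε ≫ unitAct k H).IsMonoidal

end Bialgebroid
end

section
variable {H : Type u} [Category.{v} H] [MonoidalCategory H] (G : Comonad H)
  [G.toFunctor.LaxMonoidal] [G.δ.IsMonoidal] [G.ε.IsMonoidal]

open Functor.LaxMonoidal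

variable {G} in
/-- The coaction on a tensor product of coalgebras. -/
def tensorCoalg (M N : G.Coalgebra) : G.Coalgebra where
  A := M.A ⊗ N.A
  a := (M.a ⊗ₘ N.a) ≫ μ G.toFunctor M.A N.A
  counit := by
    have h := NatTrans.IsMonoidal.tensor (τ := G.ε) M.A N.A
    rw [assoc]
    refine (congrArg (_ ≫ ·) h).trans ?_
    change _ ≫ _ ≫ 𝟙 _ = _
    rw [comp_id, tensorHom_comp_tensorHom, M.counit, N.counit]
    exact id_tensorHom_id _ _
  coassoc := by
    have h := NatTrans.IsMonoidal.tensor (τ := G.δ) M.A N.A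
    have h' : μ (G.toFunctor ⋙ G.toFunctor) M.A N.A = μ G.toFunctor _ _ ≫
      G.map (μ G.toFunctor M.A N.A) := rfl
    rw [assoc, assoc, Functor.map_comp, ← μ_natural_assoc, tensorHom_comp_tensorHom_assoc,
      ← M.coassoc, ← N.coassoc, ← tensorHom_comp_tensorHom_assoc, ← h']
    exact congrArg (_ ≫ ·) h

/-- The trivial coalgebra. -/
def unitCoalg : G.Coalgebra where
  A := 𝟙_ H
  a := ε G.toFunctor
  counit := NatTrans.IsMonoidal.unit (τ := G.ε)
  coassoc := NatTrans.IsMonoidal.unit (τ := G.δ)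

lemma coalg_tensorHom {M M' N N' : H} {m : M ⟶ G.obj M} {m' : M' ⟶ G.obj M'} {n : N ⟶ G.obj N}
    {n' : N' ⟶ G.obj N'} {f : M ⟶ M'} {g : N ⟶ N'} (hf : m ≫ G.map f = f ≫ m')
    (hg : n ≫ G.map g = g ≫ n') :
    ((m ⊗ₘ n) ≫ μ G.toFunctor _ _) ≫ G.map (f ⊗ₘ g) =
      (f ⊗ₘ g) ≫ (m' ⊗ₘ n') ≫ μ G.toFunctor _ _ := by
  rw [assoc, ← μ_natural, tensorHom_comp_tensorHom_assoc, hf, hg, tensorHom_comp_tensorHom_assoc]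

lemma coalg_whiskerLeft {M N N' : H} (m : M ⟶ G.obj M) {n : N ⟶ G.obj N} {n' : N' ⟶ G.obj N'}
    {g : N ⟶ N'} (hg : n ≫ G.map g = g ≫ n') :
    ((m ⊗ₘ n) ≫ μ G.toFunctor _ _) ≫ G.map (M ◁ g) = M ◁ g ≫ (m ⊗ₘ n') ≫ μ G.toFunctor _ _ := by
  have := coalg_tensorHom G (m := m) (m' := m) (f := 𝟙 M) (by simp) hg
  rwa [id_tensorHom] at this

lemma coalg_whiskerRight {M N N' : H} (m : M ⟶ G.obj M) {n : N ⟶ G.obj N} {n' : N' ⟶ G.obj N'}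
    {g : N ⟶ N'} (hg : n ≫ G.map g = g ≫ n') :
    ((n ⊗ₘ m) ≫ μ G.toFunctor _ _) ≫ G.map (g ▷ M) = g ▷ M ≫ (n' ⊗ₘ m) ≫ μ G.toFunctor _ _ := by
  have := coalg_tensorHom G (n := m) (n' := m) (g := 𝟙 M) hg (by simp)
  rwa [tensorHom_id] at this

lemma coalg_assoc {M N K : H} (m : M ⟶ G.obj M) (n : N ⟶ G.obj N) (l : K ⟶ G.obj K) :
    ((((m ⊗ₘ n) ≫ μ G.toFunctor _ _) ⊗ₘ l) ≫ μ G.toFunctor _ _) ≫ G.map (α_ M N K).hom =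
      (α_ M N K).hom ≫ (m ⊗ₘ ((n ⊗ₘ l) ≫ μ G.toFunctor _ _)) ≫ μ G.toFunctor _ _ := by
  have h₁ : ((m ⊗ₘ n) ≫ μ G.toFunctor M N) ⊗ₘ l =
      ((m ⊗ₘ n) ⊗ₘ l) ≫ μ G.toFunctor M N ▷ G.obj K := by
    rw [← tensorHom_id, tensorHom_comp_tensorHom, comp_id]
  have h₂ : m ⊗ₘ ((n ⊗ₘ l) ≫ μ G.toFunctor N K) =
      (m ⊗ₘ (n ⊗ₘ l)) ≫ G.obj M ◁ μ G.toFunctor N K := by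
    rw [← id_tensorHom, tensorHom_comp_tensorHom, comp_id]
  rw [h₁, h₂, assoc, assoc, assoc, associativity, associator_naturality_assoc]

lemma coalg_left {M : H} (m : M ⟶ G.obj M) :
    ((ε G.toFunctor ⊗ₘ m) ≫ μ G.toFunctor _ _) ≫ G.map (λ_ M).hom = (λ_ M).hom ≫ m := by
  rw [← leftUnitor_naturality, left_unitality, assoc, tensorHom_def', assoc]

lemma coalg_right {M : H} (m : M ⟶ G.obj M) :
    ((m ⊗ₘ ε G.toFunctor) ≫ μ G.toFunctor _ _) ≫ G.map (ρ_ M).hom = (ρ_ M).hom ≫ m := by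
  rw [← rightUnitor_naturality, right_unitality, assoc, MonoidalCategory.tensorHom_def, assoc]

instance : MonoidalCategoryStruct G.Coalgebra where
  tensorObj := tensorCoalg
  tensorUnit := unitCoalg G
  tensorHom f g := { f := f.f ⊗ₘ g.f, h := coalg_tensorHom G f.h g.h }
  whiskerLeft M _ _ f := { f := M.A ◁ f.f, h := coalg_whiskerLeft G M.a f.h }
  whiskerRight f M := { f := f.f ▷ M.A, h := coalg_whiskerRight G M.a f.h }
  associator M N K := Comonad.Coalgebra.isoMk (α_ M.A N.A K.A) (coalg_assoc G M.a N.a K.a)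
  leftUnitor M := Comonad.Coalgebra.isoMk (λ_ M.A) (coalg_left G M.a)
  rightUnitor M := Comonad.Coalgebra.isoMk (ρ_ M.A) (coalg_right G M.a)

lemma id_mid {X Y : H} (f : X ⟶ Y) : f = 𝟙 X ≫ f ≫ 𝟙 Y := by simp

lemma refl_assoc (X Y Z : H) : (α_ X Y Z).hom =
    (((Iso.refl _).symm ≪≫ ((Iso.refl (X ⊗ Y)).symm ⊗ᵢ Iso.refl Z)) ≪≫ α_ X Y Z ≪≫
      ((Iso.refl X ⊗ᵢ Iso.refl (Y ⊗ Z)) ≪≫ Iso.refl _)).hom := by simp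

lemma refl_left (X : H) : (λ_ X).hom =
    (((Iso.refl _).symm ≪≫ ((Iso.refl (𝟙_ H)).symm ⊗ᵢ Iso.refl X)) ≪≫ λ_ X).hom := by simp

lemma refl_right (X : H) : (ρ_ X).hom =
    (((Iso.refl _).symm ≪≫ (Iso.refl X ⊗ᵢ (Iso.refl (𝟙_ H)).symm)) ≪≫ ρ_ X).hom := by simp

/-- The forgetful functor from coalgebras preserves tensor products on the nose. -/
def coalgInducing : Monoidal.InducingFunctorData G.forget where
  μIso M N := Iso.refl (M.A ⊗ N.A)
  εIso := Iso.refl (𝟙_ H)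
  whiskerLeft_eq M _ _ f := id_mid (M.A ◁ f.f)
  whiskerRight_eq f M := id_mid (f.f ▷ M.A)
  tensorHom_eq f g := id_mid (f.f ⊗ₘ g.f)
  associator_eq M N K := refl_assoc M.A N.A K.A
  leftUnitor_eq M := refl_left M.A
  rightUnitor_eq M := refl_right M.A

/-- Coalgebras over a lax monoidal comonad form a monoidal category. -/
instance : MonoidalCategory G.Coalgebra := Monoidal.induced G.forget (coalgInducing G)

/-- The forgetful functor from coalgebras is monoidal. -/
instance : G.forget.Monoidal := Monoidal.fromInducedMonoidal G.forget (coalgInducing G)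
end
end
end HarishChandra

namespace HarishChandra

noncomputable section

set_option linter.unusedSectionVars false

open CategoryTheory Category MonoidalCategory Limits Opposite

section
variable {E E' : Type*} [Category E] [MonoidalCategory E] [Category E'] [MonoidalCategory E']

open Functor.OplaxMonoidal

/-- The functor between the opposites with reversed tensor product. -/
abbrev mopOp (Φ : E ⥤ E') : (Eᴹᵒᵖ)ᵒᵖ ⥤ (E'ᴹᵒᵖ)ᵒᵖ where
  obj c := op (MonoidalOpposite.mop (Φ.obj c.unop.unmop))
  map f := (Φ.map f.unop.unmop).mop.op
  map_id c := congrArg (fun f => f.mop.op) (Φ.map_id c.unop.unmop)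
  map_comp f g := congrArg (fun f => f.mop.op) (Φ.map_comp g.unop.unmop f.unop.unmop)

lemma mopOp_assoc (Φ : E ⥤ E') [Φ.OplaxMonoidal] (x y z : E) :
    (Φ.map (α_ x y z).hom ≫ δ Φ x (y ⊗ z)) ≫ Φ.obj x ◁ δ Φ y z =
      (δ Φ (x ⊗ y) z ≫ δ Φ x y ▷ Φ.obj z) ≫ (α_ _ _ _).hom := by
  simp

lemma mopOp_right (Φ : E ⥤ E') [Φ.OplaxMonoidal] (x : E) :
    (ρ_ (Φ.obj x)).inv = (Φ.map (ρ_ x).inv ≫ δ Φ x (𝟙_ E)) ≫ Φ.obj x ◁ η Φ := by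
  rw [right_unitality, assoc]

lemma mopOp_left (Φ : E ⥤ E') [Φ.OplaxMonoidal] (x : E) :
    (λ_ (Φ.obj x)).inv = (Φ.map (λ_ x).inv ≫ δ Φ (𝟙_ E) x) ≫ η Φ ▷ Φ.obj x := by
  rw [left_unitality, assoc]

instance (Φ : E ⥤ E') [Φ.OplaxMonoidal] : (mopOp Φ).LaxMonoidal where
  ε := (η Φ).mop.op
  μ c d := (δ Φ d.unop.unmop c.unop.unmop).mop.op
  μ_natural_left f d := congrArg (fun f => f.mop.op)
    (δ_natural_right Φ d.unop.unmop f.unop.unmop)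
  μ_natural_right c f := congrArg (fun f => f.mop.op)
    (δ_natural_left Φ f.unop.unmop c.unop.unmop)
  associativity c d e := congrArg (fun f => f.mop.op)
    (mopOp_assoc Φ e.unop.unmop d.unop.unmop c.unop.unmop)
  left_unitality c := congrArg (fun f => f.mop.op) (mopOp_right Φ c.unop.unmop)
  right_unitality c := congrArg (fun f => f.mop.op) (mopOp_left Φ c.unop.unmop)

/-- A monoidal functor preserves duals. -/
abbrev mapPairing (Φ : E ⥤ E') [Φ.Monoidal] (X Y : E) [ExactPairing X Y] :
    ExactPairing (Φ.obj X) (Φ.obj Y) where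
  coevaluation' := Functor.LaxMonoidal.ε Φ ≫ Φ.map (η_ X Y) ≫ δ Φ X Y
  evaluation' := Functor.LaxMonoidal.μ Φ Y X ≫ Φ.map (ε_ X Y) ≫ η Φ
  coevaluation_evaluation' := by
    have h : δ Φ Y (𝟙_ E) ≫ Φ.obj Y ◁ Φ.map (η_ X Y) ≫ Φ.obj Y ◁ δ Φ X Y ≫ (α_ _ _ _).inv ≫
        Functor.LaxMonoidal.μ Φ Y X ▷ Φ.obj Y ≫ Φ.map (ε_ X Y) ▷ Φ.obj Y ≫
          Functor.LaxMonoidal.μ Φ (𝟙_ E) Y = Φ.map (ρ_ Y).hom ≫ Φ.map (λ_ Y).inv := by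
      rw [← Functor.map_comp, ← ExactPairing.coevaluation_evaluation X Y]
      rw [Functor.map_comp, Functor.map_comp, Functor.Monoidal.map_whiskerLeft,
        Functor.Monoidal.map_whiskerRight, Functor.Monoidal.map_associator_inv]
      simp
    rw [← cancel_epi (Φ.obj Y ◁ η Φ), ← cancel_epi (δ Φ Y (𝟙_ E)),
      ← cancel_mono (Functor.LaxMonoidal.ε Φ ▷ Φ.obj Y),
      ← cancel_mono (Functor.LaxMonoidal.μ Φ (𝟙_ E) Y)]
    simpa using h
  evaluation_coevaluation' := by
    have h : δ Φ (𝟙_ E) X ≫ Φ.map (η_ X Y) ▷ Φ.obj X ≫ δ Φ X Y ▷ Φ.obj X ≫ (α_ _ _ _).hom ≫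
        Φ.obj X ◁ Functor.LaxMonoidal.μ Φ Y X ≫ Φ.obj X ◁ Φ.map (ε_ X Y) ≫
          Functor.LaxMonoidal.μ Φ X (𝟙_ E) = Φ.map (λ_ X).hom ≫ Φ.map (ρ_ X).inv := by
      rw [← Functor.map_comp, ← ExactPairing.evaluation_coevaluation X Y]
      rw [Functor.map_comp, Functor.map_comp, Functor.Monoidal.map_whiskerLeft,
        Functor.Monoidal.map_whiskerRight, Functor.Monoidal.map_associator]
      simp
    rw [← cancel_epi (η Φ ▷ Φ.obj X), ← cancel_epi (δ Φ (𝟙_ E) X),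
      ← cancel_mono (Φ.obj X ◁ Functor.LaxMonoidal.ε Φ),
      ← cancel_mono (Functor.LaxMonoidal.μ Φ X (𝟙_ E))]
    simpa using h
end
end
end HarishChandra

namespace HarishChandra

noncomputable section

set_option linter.unusedSectionVars false

open CategoryTheory Category MonoidalCategory Limits Opposite

section
variable {C : Type u} [Category.{v} C] [MonoidalCategory C] [HasCoequalizers C]
  [∀ X : C, PreservesColimitsOfSize.{0, 0} (tensorLeft X)]
  [∀ X : C, PreservesColimitsOfSize.{0, 0} (tensorRight X)] {A : Mon C}

/-- The projection to the relative tensor product of bimodules. -/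
def πB (P Q : Bimod A A) : P.X ⊗ Q.X ⟶ (P ⊗ Q).X :=
  coequalizer.π (P.actRight ▷ Q.X) ((α_ _ _ _).hom ≫ (P.X ◁ Q.actLeft))

lemma πB_whiskerRight {P P' : Bimod A A} (f : P ⟶ P') (Q : Bimod A A) :
    πB P Q ≫ (f ▷ Q).hom = f.hom ▷ Q.X ≫ πB P' Q :=
  ι_colimMap _ WalkingParallelPair.one

lemma πB_whiskerLeft (P : Bimod A A) {Q Q' : Bimod A A} (f : Q ⟶ Q') :
    πB P Q ≫ (P ◁ f).hom = P.X ◁ f.hom ≫ πB P Q' :=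
  ι_colimMap _ WalkingParallelPair.one

lemma πB_tensorHom {P P' Q Q' : Bimod A A} (f : P ⟶ P') (g : Q ⟶ Q') :
    πB P Q ≫ (f ⊗ₘ g).hom = (f.hom ⊗ₘ g.hom) ≫ πB P' Q' := by
  rw [MonoidalCategory.tensorHom_def, MonoidalCategory.tensorHom_def, Bimod.comp_hom',
    reassoc_of% πB_whiskerRight, πB_whiskerLeft, assoc]

lemma πB_associator (P Q R : Bimod A A) :
    πB P Q ▷ R.X ≫ πB (P ⊗ Q) R ≫ (α_ P Q R).hom.hom =
      (α_ _ _ _).hom ≫ P.X ◁ πB Q R ≫ πB P (Q ⊗ R) := by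
  have h : πB (P ⊗ Q) R ≫ (α_ P Q R).hom.hom = Bimod.AssociatorBimod.homAux P Q R :=
    coequalizer.π_desc _ _
  rw [h]
  exact π_tensor_id_preserves_coequalizer_inv_desc _ _ _ _

lemma πB_leftUnitor (P : Bimod A A) : πB (𝟙_ _) P ≫ (λ_ P).hom.hom = P.actLeft :=
  coequalizer.π_desc _ _

lemma πB_rightUnitor (P : Bimod A A) : πB P (𝟙_ _) ≫ (ρ_ P).hom.hom = P.actRight :=
  coequalizer.π_desc _ _
end

namespace HC
section
variable {C : Type u} [Category.{v} C] [MonoidalCategory C] [PresentablyMonoidal C]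
  {L : Center C} [MonObj L] [IsCommMonObj L]

lemma π_associator (M N K : HC L) :
    π M N ▷ K.X ≫ π (M ⊗ N) K ≫ (α_ M N K).hom.hom =
      (α_ _ _ _).hom ≫ M.X ◁ π N K ≫ π M (N ⊗ K) := by
  have h₁ : (α_ M N K).hom.hom = ((tensorIsos (M ⊗ N) K).inv.hom ≫
      ((tensorIsos M N).inv ⊗ₘ 𝟙 (bimodObj K)).hom) ≫
      (α_ (bimodObj M) (bimodObj N) (bimodObj K)).hom.hom ≫
      (𝟙 (bimodObj M) ⊗ₘ (tensorIsos N K).hom).hom ≫ (tensorIsos M (N ⊗ K)).hom.hom := rfl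
  have h₂ : π (M ⊗ N) K ≫ (tensorIsos (M ⊗ N) K).inv.hom = πB (bimodObj (M ⊗ N)) (bimodObj K) :=
    comp_id _
  have h₃ : πB (bimodObj (M ⊗ N)) (bimodObj K) ≫
      ((tensorIsos M N).inv ⊗ₘ 𝟙 (bimodObj K)).hom = πB (bimodObj M ⊗ bimodObj N) (bimodObj K) :=
    (πB_tensorHom _ _).trans ((congrArg (· ≫ πB (bimodObj M ⊗ bimodObj N) (bimodObj K))
      (id_tensorHom_id (bimodObj M ⊗ bimodObj N).X K.X)).trans (id_comp _))
  have h₄ : πB (bimodObj M) (bimodObj N ⊗ bimodObj K) ≫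
      (𝟙 (bimodObj M) ⊗ₘ (tensorIsos N K).hom).hom ≫ (tensorIsos M (N ⊗ K)).hom.hom =
        π M (N ⊗ K) := by
    rw [reassoc_of% πB_tensorHom]
    refine (congrArg (· ≫ _) (id_tensorHom_id M.X (bimodObj N ⊗ bimodObj K).X)).trans
      ((id_comp _).trans (comp_id _))
  have h₅ := πB_associator (bimodObj M) (bimodObj N) (bimodObj K)
  rw [h₁]
  have h₆ : π (M ⊗ N) K ≫ ((tensorIsos (M ⊗ N) K).inv.hom ≫
      ((tensorIsos M N).inv ⊗ₘ 𝟙 (bimodObj K)).hom) =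
      πB (bimodObj M ⊗ bimodObj N) (bimodObj K) := by
    rw [← h₃, ← h₂]; exact (assoc _ _ _).symm
  have h₇ := congrArg (fun x => π M N ▷ K.X ≫ x ≫
    (α_ (bimodObj M) (bimodObj N) (bimodObj K)).hom.hom ≫
      (𝟙 (bimodObj M) ⊗ₘ (tensorIsos N K).hom).hom ≫ (tensorIsos M (N ⊗ K)).hom.hom) h₆
  refine Eq.trans ?_ (h₇.trans ?_)
  · exact congrArg (π M N ▷ K.X ≫ ·) (assoc _ _ _).symm
  · have h₈ := congrArg (· ≫ (𝟙 (bimodObj M) ⊗ₘ (tensorIsos N K).hom).hom ≫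
      (tensorIsos M (N ⊗ K)).hom.hom) h₅
    have h₉ := congrArg (fun x => (α_ M.X N.X K.X).hom ≫ M.X ◁ π N K ≫ x) h₄
    simp only [assoc] at h₈
    exact h₈.trans h₉

lemma π_leftUnitor (M : HC L) : π (𝟙_ (HC L)) M ≫ (λ_ M).hom.hom = M.act := by
  have h₁ : (λ_ M).hom.hom = ((tensorIsos (unitHC L) M).inv.hom ≫
      ((unitIsos (L := L)).inv ⊗ₘ 𝟙 (bimodObj M)).hom) ≫ (λ_ (bimodObj M)).hom.hom := rfl
  have h₂ : π (unitHC L) M ≫ ((tensorIsos (unitHC L) M).inv.hom ≫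
      ((unitIsos (L := L)).inv ⊗ₘ 𝟙 (bimodObj M)).hom) = πB (𝟙_ _) (bimodObj M) := by
    refine (assoc _ _ _).symm.trans ((congrArg (· ≫ _) (comp_id _)).trans ?_)
    exact (πB_tensorHom _ _).trans ((congrArg (· ≫ πB (𝟙_ _) (bimodObj M))
      (id_tensorHom_id (base L) M.X)).trans (id_comp _))
  rw [h₁]
  exact (assoc _ _ _).symm.trans
    ((congrArg (· ≫ (λ_ (bimodObj M)).hom.hom) h₂).trans (πB_leftUnitor (bimodObj M)))

lemma π_rightUnitor (M : HC L) : π M (𝟙_ (HC L)) ≫ (ρ_ M).hom.hom = M.rightAct := by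
  have h₁ : (ρ_ M).hom.hom = ((tensorIsos M (unitHC L)).inv.hom ≫
      (𝟙 (bimodObj M) ⊗ₘ (unitIsos (L := L)).inv).hom) ≫ (ρ_ (bimodObj M)).hom.hom := rfl
  have h₂ : π M (unitHC L) ≫ ((tensorIsos M (unitHC L)).inv.hom ≫
      (𝟙 (bimodObj M) ⊗ₘ (unitIsos (L := L)).inv).hom) = πB (bimodObj M) (𝟙_ _) := by
    refine (assoc _ _ _).symm.trans ((congrArg (· ≫ _) (comp_id _)).trans ?_)
    exact (πB_tensorHom _ _).trans ((congrArg (· ≫ πB (bimodObj M) (𝟙_ _))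
      (id_tensorHom_id M.X (base L))).trans (id_comp _))
  rw [h₁]
  exact (assoc _ _ _).symm.trans
    ((congrArg (· ≫ (ρ_ (bimodObj M)).hom.hom) h₂).trans (πB_rightUnitor (bimodObj M)))

/-- The forgetful functor is lax monoidal. -/
instance : (forget L).LaxMonoidal where
  ε := (MonObj.one : 𝟙_ C ⟶ base L)
  μ M N := π M N
  μ_natural_left f N := (π_whiskerRight f N).symm
  μ_natural_right M f := (π_whiskerLeft M f).symm
  associativity M N K := π_associator M N K
  left_unitality M := (one_act M).symm.trans (congrArg (_ ≫ ·) (π_leftUnitor M).symm)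
  right_unitality M := (rightAct_one M).symm.trans (congrArg (_ ≫ ·) (π_rightUnitor M).symm)

instance : (free L).OplaxMonoidal := (adj L).leftAdjointOplaxMonoidal

open Functor.OplaxMonoidal

lemma adj_symm {X : C} {M : HC L} (g : X ⟶ M.X) :
    ((adj L).homEquiv X M).symm g = freeLift g := by
  have h : (free L).map g ≫ freeLift (𝟙 M.X) = freeLift g := Mod.Hom.ext (by
    change base L ◁ g ≫ base L ◁ 𝟙 M.X ≫ M.act = base L ◁ g ≫ M.act
    simp)
  exact ((adj L).homEquiv_counit (g := g)).trans h

lemma free_η : η (free L) = freeLift (M := unitHC L) (MonObj.one : 𝟙_ C ⟶ base L) := adj_symm _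

lemma free_δ (p q : C) : δ (free L) p q =
    freeLift (M := (free L).obj p ⊗ (free L).obj q) ((freeUnit p ⊗ₘ freeUnit q) ≫ π _ _) := by
  have h (X : C) : (adj L).unit.app X = freeUnit X := comp_id _
  have h' : (freeUnit p ⊗ₘ freeUnit q) = ((adj L).unit.app p ⊗ₘ (adj L).unit.app q) := by
    rw [h, h]
    rfl
  rw [h']
  exact adj_symm _

lemma free_hom_ext {p : C} {M : HC L} {f g : (free L).obj p ⟶ M}
    (h : freeUnit p ≫ f.hom = freeUnit p ≫ g.hom) : f = g := by
  rw [← freeLift_freeUnit f, h, freeLift_freeUnit]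

instance : IsIso (η (free L)) := by
  have : IsIso ((forget L).map (η (free L))) := by
    have : (forget L).map (η (free L)) = (ρ_ (base L)).hom :=
      (congrArg Mod.Hom.hom free_η).trans (MonObj.mul_one (base L))
    rw [this]
    exact inferInstanceAs (IsIso (ρ_ (base L)).hom)
  exact isIso_of_reflects_iso _ (forget L)

/-- The map `M ⊗ (L ⊗ q) ⟶ M ⊗ q`. -/
def preμ (M : HC L) (q : C) : M.X ⊗ ((free L).obj q).X ⟶ M.X ⊗ q :=
  (α_ M.X (base L) q).inv ≫ M.rightAct ▷ q

lemma preμ_w (M : HC L) (q : C) :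
    M.rightAct ▷ ((free L).obj q).X ≫ preμ M q =
      (α_ _ _ _).hom ≫ M.X ◁ ((free L).obj q).act ≫ preμ M q := by
  change M.rightAct ▷ (base L ⊗ q) ≫ (α_ M.X (base L) q).inv ≫ M.rightAct ▷ q =
    (α_ M.X (base L) (base L ⊗ q)).hom ≫
    M.X ◁ ((α_ (base L) (base L) q).inv ≫ MonObj.mul ▷ q) ≫
      (α_ M.X (base L) q).inv ≫ M.rightAct ▷ q
  rw [associator_inv_naturality_left_assoc, whiskerLeft_comp, assoc,
    associator_inv_naturality_middle_assoc, ← comp_whiskerRight, ← comp_whiskerRight, rightAct_mul]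
  simp

lemma freeUnit_preμ (M : HC L) (q : C) : M.X ◁ freeUnit (L := L) q ≫ preμ M q = 𝟙 _ := by
  change M.X ◁ ((λ_ q).inv ≫ MonObj.one ▷ q) ≫ (α_ M.X (base L) q).inv ≫ M.rightAct ▷ q = _
  rw [whiskerLeft_comp, assoc, associator_inv_naturality_middle_assoc, ← comp_whiskerRight,
    rightAct_one]
  simp

lemma freeUnit_act (q : C) : base L ◁ freeUnit q ≫ ((free L).obj q).act = 𝟙 _ := by
  have := congrArg Mod.Hom.hom (freeLift_freeUnit (𝟙 ((free L).obj q)))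
  refine Eq.trans ?_ this
  change _ = base L ◁ (freeUnit q ≫ 𝟙 _) ≫ _
  rw [comp_id]

lemma preμ_freeUnit (M : HC L) (q : C) :
    preμ M q ≫ M.X ◁ freeUnit (L := L) q ≫ π M ((free L).obj q) = π M ((free L).obj q) := by
  have h₁ : M.rightAct ▷ q ≫ M.X ◁ freeUnit (L := L) q ≫ π M ((free L).obj q) =
      (M.X ⊗ base L) ◁ freeUnit (L := L) q ≫ (α_ _ _ _).hom ≫
        M.X ◁ ((free L).obj q).act ≫ π M ((free L).obj q) := by
    rw [← π_condition, whisker_exchange_assoc]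
  have h₂ : (α_ M.X (base L) q).inv ≫ (M.X ⊗ base L) ◁ freeUnit (L := L) q ≫ (α_ _ _ _).hom =
      M.X ◁ base L ◁ freeUnit (L := L) q := by simp
  have h₃ : (α_ M.X (base L) q).inv ≫ (M.X ⊗ base L) ◁ freeUnit (L := L) q ≫ (α_ _ _ _).hom ≫
      M.X ◁ ((free L).obj q).act ≫ π M ((free L).obj q) = M.X ◁ (base L ◁ freeUnit (L := L) q ≫
        ((free L).obj q).act) ≫ π M ((free L).obj q) := by
    rw [reassoc_of% h₂, whiskerLeft_comp, assoc]
  refine (assoc _ _ _).trans ((congrArg (_ ≫ ·) h₁).trans (h₃.trans ?_))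
  rw [freeUnit_act]
  exact (congrArg (· ≫ π M ((free L).obj q)) (whiskerLeft_id _ _)).trans (id_comp _)

/-- `M ⊗_L (L ⊗ q) ≅ M ⊗ q`. -/
def preIso (M : HC L) (q : C) : M.X ⊗ q ≅ (tensorHC M ((free L).obj q)).X where
  hom := M.X ◁ freeUnit (L := L) q ≫ π M ((free L).obj q)
  inv := descπ (preμ M q) (preμ_w M q)
  hom_inv_id := by rw [assoc, π_desc, freeUnit_preμ]
  inv_hom_id := (cancel_epi (π M ((free L).obj q))).1 (by
    rw [reassoc_of% π_desc, preμ_freeUnit, comp_id])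

lemma freeUnit_tensor_act (M : HC L) {p : C} (g : p ⟶ M.X) (q : C) :
    base L ◁ ((g ⊗ₘ freeUnit q) ≫ π M ((free L).obj q)) ≫ (tensorHC M ((free L).obj q)).act =
      (α_ _ _ _).inv ≫ (base L ◁ g ≫ M.act) ▷ q ≫ (preIso M q).hom := by
  rw [whiskerLeft_comp, assoc, π_act, MonoidalCategory.tensorHom_def, whiskerLeft_comp, assoc,
    associator_inv_naturality_right_assoc, whisker_exchange_assoc,
    associator_inv_naturality_middle_assoc, ← comp_whiskerRight_assoc]
  rfl

lemma δ_hom (p q : C) : (δ (free L) p q).hom =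
    ((α_ (base L) p q).symm ≪≫ preIso ((free L).obj p) q).hom := by
  refine (congrArg Mod.Hom.hom (free_δ p q)).trans ?_
  refine (freeUnit_tensor_act ((free L).obj p) (freeUnit p) q).trans ?_
  rw [freeUnit_act]
  exact congrArg (_ ≫ ·) ((congrArg (· ≫ _) (id_whiskerRight _ _)).trans (id_comp _))

instance (p q : C) : IsIso (δ (free L) p q) := by
  have : IsIso ((forget L).map (δ (free L) p q)) := by
    have h : (forget L).map (δ (free L) p q) =
      ((α_ (base L) p q).symm ≪≫ preIso ((free L).obj p) q).hom := δ_hom p q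
    rw [h]
    exact Iso.isIso_hom ((α_ (base L) p q).symm ≪≫ preIso ((free L).obj p) q)
  exact isIso_of_reflects_iso _ (forget L)

instance : (free L).Monoidal := Functor.Monoidal.ofOplaxMonoidal (free L)

section
variable (k : Type w) [Field k] [Preadditive C] [MonoidalPreadditive C] [Linear k C]
  [MonoidalLinear k C]

/-- `Hom_HC(L ⊗ p, M) ≅ Hom_C(p, M)`. -/
def freeHomIso (p : C) : (linearCoyoneda k (HC L)).obj (op ((free L).obj p)) ≅
    forget L ⋙ (linearCoyoneda k C).obj (op p) :=
  NatIso.ofComponents (fun M => LinearEquiv.toModuleIso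
    { toFun := fun f : (free L).obj p ⟶ M => (freeUnit p ≫ f.hom : p ⟶ M.X)
      invFun := fun g : p ⟶ M.X => freeLift g
      left_inv := freeLift_freeUnit
      right_inv := freeUnit_freeLift
      map_add' := fun f g => Preadditive.comp_add _ _ _ _ _ _
      map_smul' := fun r f => Linear.comp_smul _ _ _ _ _ _ })
    (fun f => by
      ext g
      exact (assoc _ _ _).symm)

lemma free_isDualizableCP {p : C} (hp : isDualizableCP k C p) :
    isDualizableCP k (HC L) ((free L).obj p) := by
  obtain ⟨h₁, ⟨_⟩⟩ := hp
  have : PreservesColimitsOfSize.{v, v} ((linearCoyoneda k C).obj (op p)) := h₁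
  exact ⟨preservesColimits_of_natIso (freeHomIso k p).symm,
    ⟨{ rightDual := (free L).obj pᘁ, exact := mapPairing (free L) p pᘁ }⟩⟩

variable (L) in
/-- Free modules on compact projective objects. -/
def freeCP : CP k C ⥤ CP k (HC L) :=
  ObjectProperty.lift _ ((isDualizableCP k C).ι ⋙ free L) fun p => free_isDualizableCP k p.property

variable [UnitCP k C]

instance freeCPOplax : (freeCP L k).OplaxMonoidal where
  η := ObjectProperty.homMk (η (free L))
  δ p q := ObjectProperty.homMk (δ (free L) p.obj q.obj)
  δ_natural_left f q := ObjectProperty.hom_ext _ (δ_natural_left (free L) f.hom q.obj)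
  δ_natural_right p f := ObjectProperty.hom_ext _ (δ_natural_right (free L) p.obj f.hom)
  oplax_associativity p q r := ObjectProperty.hom_ext _
    (Functor.OplaxMonoidal.associativity (free L) p.obj q.obj r.obj)
  oplax_left_unitality p := ObjectProperty.hom_ext _
    (Functor.OplaxMonoidal.left_unitality (free L) p.obj)
  oplax_right_unitality p := ObjectProperty.hom_ext _
    (Functor.OplaxMonoidal.right_unitality (free L) p.obj)

variable {k}

/-- The image of an algebra in `HC ⊗ HC^{⊗op}` in `C ⊗ C^{⊗op}`. -/
abbrev und (X : Idx k (HC L) ⥤ HC L) : Idx k C ⥤ C := mopOp (freeCP L k) ⋙ X ⋙ forget L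


end
end
end HC
end
end HarishChandra

namespace HarishChandra

noncomputable section

set_option linter.unusedSectionVars false

open CategoryTheory Category MonoidalCategory Limits Opposite

section
variable {k : Type w} [Field k] {C : Type u} [Category.{v} C] [MonoidalCategory C]
  [PresentablyMonoidal C] [Preadditive C] [MonoidalPreadditive C] [Linear k C]
  [MonoidalLinear k C] [UnitCP k C]

/-- A quantum moment map `s ⊗ t : L ⊠ L^op ⟶ A` for an algebra `A` in `C ⊗ C^{⊗op}`, in terms of
its restrictions `s : L ⊠ 1 ⟶ A` and `t : 1 ⊠ L^op ⟶ A`, which are maps of algebras and are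
central with respect to the half-braiding `τ` of `L`. Here `1 ⊠ L^op` is the functor
`p ↦ Hom(p, L) ⊗ 1`, so that `t` is a natural family of maps `Hom(p, L) ⟶ Hom(1, A(p))`. -/
structure MomentMap (L : Center C) [MonObj L] (A : Idx k C ⥤ C) [A.LaxMonoidal] where
  /-- The first component. -/
  s : base L ⟶ ob A (𝟙_ (CP k C))
  /-- The second component. -/
  t (p : CP k C) : (p.obj ⟶ base L) →ₗ[k] (𝟙_ C ⟶ ob A p)
  t_nat : ∀ {p q : CP k C} (f : p ⟶ q) (g : q.obj ⟶ base L), t p (f.hom ≫ g) = t q g ≫ mp A f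
  s_one : (MonObj.one : 𝟙_ C ⟶ base L) ≫ s = lu A
  s_mul : (MonObj.mul : base L ⊗ base L ⟶ base L) ≫ s = (s ⊗ₘ s) ≫ lm A _ _ ≫ mp A (λ_ _).inv
  s_central : ∀ q : CP k C, ob A q ◁ s ≫ lm A q (𝟙_ _) ≫ mp A (λ_ q).inv =
    (τ L (ob A q)).hom ≫ s ▷ ob A q ≫ lm A (𝟙_ _) q ≫ mp A (ρ_ q).inv
  t_one : t (𝟙_ (CP k C)) (MonObj.one : 𝟙_ C ⟶ base L) = lu A
  t_mul : ∀ {p q : CP k C} (f : p.obj ⟶ base L) (g : q.obj ⟶ base L),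
    (t p f ⊗ₘ t q g) ≫ lm A p q = (λ_ (𝟙_ C)).hom ≫ t (q ⊗ p) ((g ⊗ₘ f) ≫ MonObj.mul)
  t_central : ∀ {p p' q r : CP k C} (u : r ⟶ p ⊗ q) (v : r ⟶ q ⊗ p') (f : p.obj ⟶ base L)
    (f' : p'.obj ⟶ base L), u.hom ≫ f ▷ q.obj = v.hom ≫ q.obj ◁ f' ≫ (τ L q.obj).hom →
    (ρ_ _).inv ≫ ob A q ◁ t p f ≫ lm A q p ≫ mp A u =
      (λ_ _).inv ≫ t p' f' ▷ ob A q ≫ lm A p' q ≫ mp A v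

namespace HC
variable {L : Center C} [MonObj L] [IsCommMonObj L]
variable (X : Idx k (HC L) ⥤ HC L) [X.LaxMonoidal]

/-- The first component of the quantum moment map of the algebra in `C ⊗ C^{⊗op}` underlying an
algebra `X` in `HC ⊗ HC^{⊗op}`: the unit of `X` restricted to `L ⊠ 1`. -/
def undS : base L ⟶ ob (und X) (𝟙_ (CP k C)) :=
  (lu X).hom ≫ (mp X (Functor.OplaxMonoidal.η (freeCP L k))).hom

variable (L) in
/-- The map `L ⊗ p ⟶ L` of free modules induced by `p ⟶ L`. -/
def cpLift (p : CP k C) (f : p.obj ⟶ base L) : (freeCP L k).obj p ⟶ 𝟙_ (CP k (HC L)) :=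
  ObjectProperty.homMk (freeLift (M := unitHC L) f)

/-- The second component of the quantum moment map of the algebra in `C ⊗ C^{⊗op}` underlying an
algebra `X` in `HC ⊗ HC^{⊗op}`: the unit of `X` restricted to `1 ⊠ L^op`. -/
def undT (p : CP k C) (f : p.obj ⟶ base L) : 𝟙_ C ⟶ ob (und X) p :=
  (MonObj.one : 𝟙_ C ⟶ base L) ≫ (lu X).hom ≫ (mp X (cpLift L p f)).hom
end HC

open HC

variable (k) in
/-- A Harish-Chandra bialgebroid: an algebra `A` in `C ⊗ C^{⊗op}` with a quantum moment map
`L ⊠ L^op ⟶ A`, regarded through it as an algebra `B` in `HC ⊗ HC^{⊗op}`, together with a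
coproduct `B ⟶ B × B` and a counit `B ⟶ 𝒟`, which are maps of algebras. -/
structure HCBialgebroid (L : Center C) [MonObj L] [IsCommMonObj L] where
  /-- The underlying algebra in `C ⊗ C^{⊗op}`. -/
  A : Idx k C ⥤ C
  isLin : IsLin A
  alg : A.LaxMonoidal
  /-- The quantum moment map. -/
  moment : MomentMap L A
  /-- The algebra in `HC ⊗ HC^{⊗op}` with the coproduct and the counit. -/
  B : Bialgebroid k (HC L)
  /-- The underlying algebra of `B` is `A`. -/
  θ : und B.X ≅ A
  θ_isMonoidal : θ.hom.IsMonoidal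
  θ_s : undS B.X ≫ ap θ.hom _ = moment.s
  θ_t : ∀ (p : CP k C) (f : p.obj ⟶ base L), undT B.X p f ≫ ap θ.hom p = moment.t p f

namespace HCBialgebroid
variable {L : Center C} [MonObj L] [IsCommMonObj L] (B : HCBialgebroid k L)

/-- The comonad `M ↦ B ×_L M` on `HC`. -/
abbrev takeuchi : Comonad (HC L) := B.B.comonad

/-- The category of `B`-comodules: objects `M` of `HC` with a coassociative and counital
coaction `M ⟶ B ×_L M`. -/
abbrev CoMod : Type _ := B.takeuchi.Coalgebra

end HCBialgebroid
end
end
end HarishChandra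

open CategoryTheory MonoidalCategory Limits HarishChandra

/-! The comonad `T = F FR` on `HC` is linear, lax monoidal and cocontinuous: `FR` preserves colimits
by assumption and `F` because it is a left adjoint. The theorem is an Eilenberg–Watts statement for
such comonads, followed by comonadic descent.

Eilenberg–Watts rests on the density formula `𝒟 × M ≅ M`: every module is the coend of `Hom(1, c ⊗
M) ⊗ cᵛ`, that is, of `Hom(cᵛ, M) ⊗ cᵛ` (`HC.isIso_unitAct`). It holds because the duals `cᵛ`
strongly generate `HC` and are themselves compact projective. In `HC` the generators are the free
modules on compact projective `p`; such a module is the dual of the free module on the left dual of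
`p`. Applying `T` to the formula gives `T M ≅ X × M` for the coefficients `X(c) = T(cᵛ)`
(`isIso_coeffAct_app`).

All structure on `T` is then read off at the objects `cᵛ`. The functor `X` is the composite of the
algebra `𝒟` with the lax monoidal functor `T`, so it is an algebra; the comultiplication and counit
of `T` at `cᵛ` give a coproduct and a counit, whose axioms are those of `T` transported along `X ×
(-) ≅ T` (`ofComonad`, `ofComonadIso`).

It remains to see that an algebra in `HC ⊗ HC^{⊗op}` has an underlying algebra in `C ⊗ C^{⊗op}` with
a quantum moment map. One restricts along `p ↦ L ⊗ p` and forgets the action; the moment map is the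
unit of the algebra, evaluated on `L ⊠ 1` and `1 ⊠ L^op` (`HC.undMoment`). Centrality holds because
multiplication by `s` on the two sides is the left and the right action of `L`, which differ by `τ`,
and because the right action on the generators of a free module is `τ`.

Finally, `B`-comodules are coalgebras for a comonad isomorphic to `T`, so `G` is the comparison
functor of the adjunction (`toCoalg`). It is monoidal since the unit and counit of the adjunction
are monoidal transformations. The source is locally presentable, hence has equalizers, and the crude
comonadicity theorem gives the equivalence (`comparison_isEquivalence`). -/

namespace HarishChandra

noncomputable section

open CategoryTheory Category Limits Opposite

/-! ### Completeness of locally presentable categories and crude comonadicity. -/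

section
variable (E : Type u) [Category.{v} E]

/-- A locally presentable category is complete: it is reflective in presheaves on a small dense
subcategory. -/
lemma hasLimitsOfSize_of_isLocallyPresentable [IsLocallyPresentable.{v} E] :
    HasLimitsOfSize.{v, v} E := by
  -- The presentable objects form only an essentially small category. Passing to a small model makes
  -- the presheaf category complete in the universe `v`.
  obtain ⟨κ, _, _⟩ := IsLocallyPresentable.exists_cardinal.{v} E
  let A : SmallModel.{v} (isCardinalPresentable E κ).FullSubcategory ⥤ E :=
    (equivSmallModel.{v} (isCardinalPresentable E κ).FullSubcategory).inverse ⋙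
      (isCardinalPresentable E κ).ι
  have : A.IsDense := inferInstance
  let R := Presheaf.restrictedULiftYoneda.{v} A
  have : Reflective R :=
    { L := uliftYoneda.{v}.leftKanExtension A
      adj := Presheaf.uliftYonedaAdjunction.{v} _ (uliftYoneda.{v}.leftKanExtensionUnit A) }
  exact hasLimits_of_reflective.{v, v} R

/-- The crude comonadicity theorem for a locally presentable source. -/
lemma comparison_isEquivalence [IsLocallyPresentable.{v} E] {E' : Type u'} [Category.{v} E']
    {F : E ⥤ E'} {G : E' ⥤ E} (adj : F ⊣ G) [F.ReflectsIsomorphisms]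
    [PreservesLimitsOfShape WalkingParallelPair F] : (Comonad.comparison adj).IsEquivalence := by
  have := hasLimitsOfSize_of_isLocallyPresentable E
  have : HasLimitsOfSize.{0, 0} E := hasLimitsOfSizeShrink.{0, 0, v, v} E
  -- Only coreflexive pairs matter for comonadicity; `F` preserves all equalizers, and completeness
  -- supplies them in `E`.
  have : Comonad.PreservesLimitOfIsCoreflexivePair F := ⟨fun _ _ _ _ _ => inferInstance⟩
  exact (Comonad.comonadicOfHasPreservesCoreflexiveEqualizersOfReflectsIsomorphisms adj).eqv
end
end
end HarishChandra

/-! ### Duals of biproducts. -/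

namespace HarishChandra

noncomputable section

set_option linter.unusedSectionVars false

open CategoryTheory Category MonoidalCategory Limits Opposite

section
variable {H : Type u} [Category.{v} H] [MonoidalCategory H]

/-- Expanding the triangle identity for `X ⊞ Y` bilinearly gives four terms, each with the
coevaluation of one summand and the evaluation of another. Such a term factors through the component
`i ≫ p` between the two summands: it vanishes for distinct summands and reduces to the triangle
identity of the summand otherwise. -/
lemma zigzag_left_aux {X X' Y Y' W W' : H} (i : X ⟶ W) (p : W ⟶ Y) (i' : X' ⟶ W') (p' : W' ⟶ Y')
    (a : 𝟙_ H ⟶ X ⊗ X') (b : Y' ⊗ Y ⟶ 𝟙_ H) :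
    W' ◁ (a ≫ (i ⊗ₘ i')) ≫ (α_ _ _ _).inv ≫ ((p' ⊗ₘ p) ≫ b) ▷ W' =
      p' ▷ 𝟙_ H ≫ Y' ◁ a ≫ Y' ◁ ((i ≫ p) ▷ X') ≫ (α_ _ _ _).inv ≫ b ▷ X' ≫ 𝟙_ H ◁ i' := by
  rw [comp_whiskerRight, ← tensorHom_id (p' ⊗ₘ p), ← associator_inv_naturality_assoc]
  have h : b ▷ X' ≫ 𝟙_ H ◁ i' = (Y' ⊗ Y) ◁ i' ≫ b ▷ W' := (whisker_exchange _ _).symm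
  rw [h, ← id_tensorHom (Y' ⊗ Y), ← id_tensorHom_id, ← associator_inv_naturality_assoc]
  simp only [← assoc]
  congr 2
  simp only [← id_tensorHom, ← tensorHom_id, tensorHom_comp_tensorHom, assoc, id_comp, comp_id]

lemma zigzag_right_aux {X X' Y Y' W W' : H} (i : X ⟶ W) (p : W ⟶ Y) (i' : X' ⟶ W') (p' : W' ⟶ Y')
    (a : 𝟙_ H ⟶ X ⊗ X') (b : Y' ⊗ Y ⟶ 𝟙_ H) :
    (a ≫ (i ⊗ₘ i')) ▷ W ≫ (α_ _ _ _).hom ≫ W ◁ ((p' ⊗ₘ p) ≫ b) =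
      𝟙_ H ◁ p ≫ a ▷ Y ≫ (X ◁ (i' ≫ p')) ▷ Y ≫ (α_ _ _ _).hom ≫ X ◁ b ≫ i ▷ 𝟙_ H := by
  rw [MonoidalCategory.whiskerLeft_comp, ← id_tensorHom W (p' ⊗ₘ p), ← associator_naturality_assoc]
  have h : X ◁ b ≫ i ▷ 𝟙_ H = i ▷ (Y' ⊗ Y) ≫ W ◁ b := whisker_exchange _ _
  rw [h, ← tensorHom_id i (Y' ⊗ Y), ← id_tensorHom_id, ← associator_naturality_assoc]
  simp only [← assoc]
  congr 2
  simp only [← id_tensorHom, ← tensorHom_id, tensorHom_comp_tensorHom, assoc, id_comp, comp_id]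

variable [Preadditive H] [MonoidalPreadditive H]

/-- The biproduct of exact pairings. -/
abbrev biprodPairing [HasBinaryBiproducts H] (X X' Y Y' : H) [ExactPairing X X']
    [ExactPairing Y Y'] : ExactPairing (X ⊞ Y) (X' ⊞ Y') where
  coevaluation' := η_ X X' ≫ (biprod.inl ⊗ₘ biprod.inl) + η_ Y Y' ≫ (biprod.inr ⊗ₘ biprod.inr)
  evaluation' := (biprod.fst ⊗ₘ biprod.fst) ≫ ε_ X X' + (biprod.snd ⊗ₘ biprod.snd) ≫ ε_ Y Y'
  coevaluation_evaluation' := by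
    simp only [MonoidalPreadditive.whiskerLeft_add, MonoidalPreadditive.add_whiskerRight,
      Preadditive.add_comp, Preadditive.comp_add, zigzag_left_aux, biprod.inl_fst, biprod.inr_fst,
      biprod.inl_snd, biprod.inr_snd, id_whiskerRight, MonoidalCategory.whiskerLeft_id,
      MonoidalPreadditive.zero_whiskerRight, MonoidalPreadditive.whiskerLeft_zero, id_comp,
      zero_comp, comp_zero, add_zero, zero_add, ExactPairing.coevaluation_evaluation_assoc]
    simp only [whiskerRight_id, id_whiskerLeft, assoc, Iso.inv_hom_id_assoc]
    -- The two surviving terms are the projection to a dual summand followed by its inclusion, up to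
    -- unitors; their sum is the identity by `biprod.total`.
    rw [← Preadditive.comp_add]
    congr 1
    simp only [← assoc, ← Preadditive.add_comp, biprod.total]
    simp
  evaluation_coevaluation' := by
    simp only [MonoidalPreadditive.whiskerLeft_add, MonoidalPreadditive.add_whiskerRight,
      Preadditive.add_comp, Preadditive.comp_add, zigzag_right_aux, biprod.inl_fst, biprod.inr_fst,
      biprod.inl_snd, biprod.inr_snd, id_whiskerRight, MonoidalCategory.whiskerLeft_id,
      MonoidalPreadditive.zero_whiskerRight, MonoidalPreadditive.whiskerLeft_zero, id_comp,
      zero_comp, comp_zero, add_zero, zero_add, ExactPairing.evaluation_coevaluation_assoc]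
    simp only [whiskerRight_id, id_whiskerLeft, assoc, Iso.inv_hom_id_assoc]
    rw [← Preadditive.comp_add]
    congr 1
    simp only [← assoc, ← Preadditive.add_comp, biprod.total]
    simp
end

/-! ### Density of the duals of compact projective objects. -/

section
variable {k : Type w} [Field k] {H : Type u} [Category.{v} H] [Preadditive H] [Linear k H]
  [MonoidalCategory H] [MonoidalPreadditive H] [MonoidalLinear k H]

variable [PresentablyMonoidal H] [UnitCP k H]
-- `Hom(X, -) ≅ Hom(1, - ⊗ Xᘁ)` is a composite of cocontinuous functors because the unit is compact
-- projective. Dualizability alone therefore suffices for membership in `CP`.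
lemma isDualizableCP_of_hasRightDual (X : H) [HasRightDual X] : isDualizableCP k H X := by
  refine ⟨?_, ⟨inferInstance⟩⟩
  have : PreservesColimitsOfSize.{v, v} ((linearCoyoneda k H).obj (op (𝟙_ H))) := UnitCP.prop_unit
  have h : isCompactProjective k H (𝟙_ H ⊗ X) :=
    preservesColimits_of_natIso (homTensorIso k H (𝟙_ H) X).symm
  have : PreservesColimitsOfSize.{v, v} ((linearCoyoneda k H).obj (op (𝟙_ H ⊗ X))) := h
  exact preservesColimits_of_natIso ((linearCoyoneda k H).mapIso (λ_ X).symm.op)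

/-- One of the triangle identities. It makes `dcoev c` the universal element of `M ↦ Hom(1, c ⊗ M)`,
which is thereby represented by `dl c`. -/
lemma adjunct_dcoev (c : CP k H) : adjunct (dcoev c) = 𝟙 (dl c) := by
  have h : dl c ◁ dcoev c ≫ (α_ _ _ _).inv ≫ dev c ▷ dl c = (ρ_ _).hom ≫ (λ_ _).inv :=
    ExactPairing.coevaluation_evaluation c.obj (dl c)
  rw [adjunct, reassoc_of% h]
  simp

lemma dmap_add {c d : CP k H} (f g : c ⟶ d) : dmap (f + g) = dmap f + dmap g := dl_ext (by
  rw [dmap_dev, MonoidalPreadditive.add_whiskerRight, Preadditive.add_comp, dmap_dev, dmap_dev,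
    ← Preadditive.add_comp, ← MonoidalPreadditive.whiskerLeft_add]
  rfl)

lemma dmap_smul {c d : CP k H} (r : k) (f : c ⟶ d) : dmap (r • f) = r • dmap f := dl_ext (by
  rw [dmap_dev, MonoidalLinear.smul_whiskerRight, Linear.smul_comp, dmap_dev, ← Linear.smul_comp,
    ← MonoidalLinear.whiskerLeft_smul]
  rfl)

variable (k H) in
lemma unitD_isLin : IsLin (unitD k H) := ⟨fun _ _ => dmap_add, fun _ _ => dmap_smul⟩

/-- The colimit defining `X × M` is an ordinary one over pairs `(c, e)`, with no linearity imposed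
in `e`. Linearity is automatic: `CP` is closed under biproducts, so two elements `e`, `e'` come from
a single one over `c ⊞ c`, and `X` is additive on the maps `c ⊞ c ⟶ c`. Hence the ordinary colimit
can stand for the linear coend. -/
lemma inj_add {X : Idx k H ⥤ H} (hX : IsLin X) {M : H} (c : CP k H) (e e' : 𝟙_ H ⟶ c.obj ⊗ M) :
    inj X c (e + e') = inj X c e + inj X c e' := by
  have : HasBinaryBiproducts H := HasBinaryBiproducts.of_hasBinaryCoproducts
  let d : CP k H := ⟨c.obj ⊞ c.obj,
    have : HasRightDual (c.obj ⊞ c.obj) :=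
      { rightDual := dl c ⊞ dl c, exact := biprodPairing _ _ _ _ }
    isDualizableCP_of_hasRightDual _⟩
  let p₁ : d ⟶ c := ObjectProperty.homMk (biprod.fst : c.obj ⊞ c.obj ⟶ c.obj)
  let p₂ : d ⟶ c := ObjectProperty.homMk (biprod.snd : c.obj ⊞ c.obj ⟶ c.obj)
  -- `E` has components `e` and `e'`; pushing it along `p₁`, `p₂` and `p₁ + p₂` yields `e`, `e'` and
  -- `e + e'`.
  let E : 𝟙_ H ⟶ d.obj ⊗ M := e ≫ biprod.inl ▷ M + e' ≫ biprod.inr ▷ M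
  have h₁ : E ≫ p₁.hom ▷ M = e := by
    change (e ≫ biprod.inl ▷ M + e' ≫ biprod.inr ▷ M) ≫ biprod.fst ▷ M = e
    rw [Preadditive.add_comp, assoc, assoc, ← comp_whiskerRight, ← comp_whiskerRight]
    simp
  have h₂ : E ≫ p₂.hom ▷ M = e' := by
    change (e ≫ biprod.inl ▷ M + e' ≫ biprod.inr ▷ M) ≫ biprod.snd ▷ M = e'
    rw [Preadditive.add_comp, assoc, assoc, ← comp_whiskerRight, ← comp_whiskerRight]
    simp
  have h₃ : E ≫ (p₁ + p₂).hom ▷ M = e + e' := by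
    change E ≫ (p₁.hom + p₂.hom) ▷ M = e + e'
    rw [MonoidalPreadditive.add_whiskerRight, Preadditive.comp_add, h₁, h₂]
  rw [← h₃, ← inj_w, hX.add, Preadditive.add_comp, inj_w, inj_w, h₁, h₂]

lemma inj_smul {X : Idx k H ⥤ H} (hX : IsLin X) {M : H} (c : CP k H) (r : k)
    (e : 𝟙_ H ⟶ c.obj ⊗ M) : inj X c (r • e) = r • inj X c e := by
  have h : e ≫ (r • 𝟙 c : c ⟶ c).hom ▷ M = r • e := by
    change e ≫ (r • 𝟙 c.obj) ▷ M = r • e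
    simp [MonoidalLinear.smul_whiskerRight]
  rw [← h, ← inj_w, hX.smul, mp_id, Linear.smul_comp, id_comp]

/-- The maps out of the dual of a compact projective object, lifted along `𝒟 × M ⟶ M`. -/
def liftD (c : CP k H) (M : H) : (dl c ⟶ M) →ₗ[k] (dl c ⟶ actObj (unitD k H) M) where
  toFun g := inj (unitD k H) c (dcoev c ≫ c.obj ◁ g)
  map_add' g h := by
    rw [MonoidalPreadditive.whiskerLeft_add, Preadditive.comp_add, inj_add (unitD_isLin k H)]
    rfl
  map_smul' r g := by
    rw [MonoidalLinear.whiskerLeft_smul, Linear.comp_smul, inj_smul (unitD_isLin k H)]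
    rfl

/-- Through the bijection `Hom(dl c, M) ≅ Hom(1, c ⊗ M)`, the lift sends a map to the coend
inclusion that it indexes, so `liftD` splits postcomposition with `unitAct`. -/
lemma liftD_unitAct {c : CP k H} {M : H} (g : dl c ⟶ M) :
    liftD (k := k) c M g ≫ (unitAct k H).app M = g := by
  refine (inj_unitAct M c _).trans ((adjD_nat (dcoev c) g).symm.trans ?_)
  exact (congrArg (· ≫ g) (adjunct_dcoev c)).trans (id_comp g)

/-- Dualization is full: `Hom(dᵛ, cᵛ) ≅ Hom(dᵛ ⊗ c, 1) ≅ Hom(c, d)`. The preimage `f` is the mate of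
`x ▷ c ≫ dev c`. -/
lemma dmap_surjective {c d : CP k H} : Function.Surjective (dmap : (c ⟶ d) → (dl d ⟶ dl c)) := by
  intro x
  let f := tensorLeftHomEquiv c.obj d.obj (dl d) (𝟙_ H) (x ▷ c.obj ≫ dev c)
  refine ⟨ObjectProperty.homMk (f ≫ (ρ_ d.obj).hom), dl_ext ?_⟩
  have h : dl d ◁ f ≫ (α_ _ _ _).inv ≫ dev d ▷ 𝟙_ H ≫ (λ_ _).hom = x ▷ c.obj ≫ dev c :=
    (tensorLeftHomEquiv c.obj d.obj (dl d) (𝟙_ H)).left_inv (x ▷ c.obj ≫ dev c)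
  rw [dmap_dev, ← h]
  change dl d ◁ (f ≫ (ρ_ d.obj).hom) ≫ dev d = _
  simp [unitors_equal]

/-- A map from a dual into `𝒟 × M` that factors through one leg of the colimit lies in the image of
`liftD`: by fullness the factor is the dual of a map, which the coend relation absorbs into the
index. -/
lemma comp_inj (c d : CP k H) (M : H) (e : 𝟙_ H ⟶ d.obj ⊗ M) (x : dl c ⟶ dl d) :
    liftD (k := k) c M (x ≫ adjunct e) = x ≫ inj (unitD k H) d e := by
  obtain ⟨f, rfl⟩ := dmap_surjective x
  rw [adjunct_w]
  exact (congrArg (inj (unitD k H) c) (coev_adjunct _)).trans (inj_w f e).symm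

/-- `Hom(cᵛ, M) ≅ Hom(1, c ⊗ M)`. -/
def dualHomIso (c : CP k H) : (linearCoyoneda k H).obj (op (dl c)) ≅
    tensorLeft c.obj ⋙ (linearCoyoneda k H).obj (op (𝟙_ H)) :=
  NatIso.ofComponents (fun M => LinearEquiv.toModuleIso
    { toFun := fun g : dl c ⟶ M => (dcoev c ≫ c.obj ◁ g : 𝟙_ H ⟶ c.obj ⊗ M)
      invFun := fun e : 𝟙_ H ⟶ c.obj ⊗ M => adjunct e
      left_inv := fun g => by
        change adjunct (dcoev c ≫ c.obj ◁ g) = g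
        rw [← adjunct_nat, adjunct_dcoev, id_comp]
      right_inv := coev_adjunct
      map_add' := fun f g => by rw [MonoidalPreadditive.whiskerLeft_add, Preadditive.comp_add]
      map_smul' := fun r f => by
        rw [MonoidalLinear.whiskerLeft_smul, Linear.comp_smul, RingHom.id_apply] })
    (fun f => by
      ext g
      exact (congrArg (dcoev c ≫ ·) (MonoidalCategory.whiskerLeft_comp _ _ _)).trans
        (assoc _ _ _).symm)

lemma isCompactProjective_dl (c : CP k H) : isCompactProjective k H (dl c) := by
  have : PreservesColimitsOfSize.{v, v} ((linearCoyoneda k H).obj (op (𝟙_ H))) := UnitCP.prop_unit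
  exact preservesColimits_of_natIso (dualHomIso c).symm

/-- Since `dl c` is compact projective, `Hom(dl c, 𝒟 × M)` is the colimit of the spaces `Hom(dl c,
dl d)`, computed in vector spaces, so every element is a sum of elements from the legs. Each leg
lands in the image of `liftD` by `comp_inj`, and this image is a subspace. The argument is run by
showing that the quotient map by the image is zero. -/
lemma liftD_surjective (c : CP k H) (M : H) : Function.Surjective (liftD (k := k) c M) := by
  have : PreservesColimitsOfSize.{v, v} ((linearCoyoneda k H).obj (op (dl c))) :=
    isCompactProjective_dl c
  let S := LinearMap.range (liftD (k := k) c M)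
  let q : ((linearCoyoneda k H).obj (op (dl c))).obj (actObj (unitD k H) M) ⟶
    ModuleCat.of k ((dl c ⟶ actObj (unitD k H) M) ⧸ S) := ModuleCat.ofHom S.mkQ
  -- The pairs are only essentially small, so preservation of small colimits is moved along an
  -- equivalence with a small model.
  have : PreservesColimit (diag (unitD k H) M) ((linearCoyoneda k H).obj (op (dl c))) := by
    have e := equivSmallModel.{v} (Pairs k M)ᵒᵖ
    have := preservesColimitsOfShape_of_equiv e.symm ((linearCoyoneda k H).obj (op (dl c)))
    infer_instance
  have hq : q = 0 := (isColimitOfPreserves ((linearCoyoneda k H).obj (op (dl c)))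
      (colimit.isColimit (diag (unitD k H) M))).hom_ext fun j => by
    refine ModuleCat.hom_ext (LinearMap.ext fun x => ?_)
    exact (Submodule.Quotient.mk_eq_zero S).2 ⟨_, comp_inj c j.unop.right M j.unop.hom x⟩
  intro y
  have h : S.mkQ y = 0 := congrArg (fun q => q.hom y) hq
  exact (Submodule.Quotient.mk_eq_zero S).1 h

variable (k H) in
/-- The duals of compact projective objects. -/
def isDual : ObjectProperty H := fun X => ∃ c : CP k H, X = dl c

/-- If the duals of the compact projective objects strongly generate, they are dense. -/
lemma isIso_unitAct (h : (isDual k H).IsStrongGenerator) : IsIso (unitAct k H) := by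
  have (M : H) : IsIso ((unitAct k H).app M) := by
    -- Monomorphy is tested on maps out of duals. By surjectivity such maps are lifts, and a lift is
    -- determined by its image under `unitAct`. The same lifts show that every map from a dual to
    -- `M` factors, whence strong generation gives an isomorphism.
    have : Mono ((unitAct k H).app M) := by
      rw [h.isSeparating.mono_iff]
      rintro _ ⟨c, rfl⟩ x y hxy
      obtain ⟨x, rfl⟩ := liftD_surjective (k := k) c M x
      obtain ⟨y, rfl⟩ := liftD_surjective (k := k) c M y
      exact congrArg _ ((liftD_unitAct x).symm.trans (hxy.trans (liftD_unitAct y)))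
    refine h.isIso_of_mono _ ?_
    rintro _ ⟨c, rfl⟩ g
    exact ⟨liftD (k := k) c M g, liftD_unitAct g⟩
  exact NatIso.isIso_of_isIso_app _

end
end
end HarishChandra

/-! ### Duals strongly generate the category of modules. -/

namespace HarishChandra

noncomputable section

set_option linter.unusedSectionVars false

open CategoryTheory Category MonoidalCategory Limits Opposite

namespace HC
section
variable {k : Type w} [Field k] {C : Type u} [Category.{v} C] [MonoidalCategory C]
  [PresentablyMonoidal C] [Preadditive C] [MonoidalPreadditive C] [Linear k C]
  [MonoidalLinear k C] [UnitCP k C] {L : Center C} [MonObj L] [IsCommMonObj L]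

/-- The free module on a compact projective object of a cp-rigid category is the dual of a compact
projective module. -/
lemma exists_free_iso_dl [CpRigid k C] {p : C} (hp : isCompactProjective k C p) :
    ∃ c : CP k (HC L), Nonempty ((free L).obj p ≅ dl c) := by
  -- The left dual of `p` has `p` as a right dual, so it lies in `CP k C`. The monoidal functor
  -- `free` carries this duality to `HC`, and uniqueness of right duals identifies `L ⊗ p` with the
  -- chosen dual.
  obtain ⟨_⟩ := CpRigid.hasLeftDual p hp
  have : HasRightDual (ᘁp : C) := { rightDual := p, exact := inferInstance }
  have h : isDualizableCP k C (ᘁp : C) := isDualizableCP_of_hasRightDual _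
  exact ⟨(freeCP L k).obj ⟨_, h⟩,
    ⟨rightDualIso (mapPairing (free L) (ᘁp : C) p) (dlPairing ((freeCP L k).obj ⟨_, h⟩))⟩⟩

-- Through `Hom(L ⊗ p, M) ≅ Hom(p, M.X)` the generators of `C` give generators of `HC`: the
-- forgetful functor is faithful, preserves monomorphisms and reflects isomorphisms. The free
-- modules involved are duals by `exists_free_iso_dl`.
variable (k L) in
lemma isStrongGenerator_isDual [CpRigid k C] : (isDual k (HC L)).IsStrongGenerator := by
  have hP := CpRigid.isStrongGenerator (k := k) (H := C)
  refine ObjectProperty.isStrongGenerator_iff.2 ⟨fun M N f g h => ?_, fun M N i _ h => ?_⟩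
  · refine Mod.Hom.ext (hP.isSeparating _ _ fun p hp x => ?_)
    obtain ⟨c, ⟨φ⟩⟩ := exists_free_iso_dl (L := L) hp
    have h₁ := h _ ⟨c, rfl⟩ (φ.inv ≫ freeLift x)
    rw [assoc, assoc, cancel_epi] at h₁
    have h₂ := congrArg (fun q => freeUnit p ≫ q.hom) h₁
    dsimp at h₂
    rwa [← assoc, freeUnit_freeLift, ← assoc, freeUnit_freeLift] at h₂
  · have := mono_hom i
    have : IsIso i.hom := hP.isIso_of_mono i.hom fun p hp x => by
      obtain ⟨c, ⟨φ⟩⟩ := exists_free_iso_dl (L := L) hp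
      obtain ⟨q, hq⟩ := h _ ⟨c, rfl⟩ (φ.inv ≫ freeLift x)
      refine ⟨freeUnit p ≫ (φ.hom ≫ q).hom, ?_⟩
      have h₁ : (φ.hom ≫ q) ≫ i = freeLift x := by
        rw [assoc, ← Iso.eq_inv_comp]
        exact hq
      have h₂ := congrArg (fun q => freeUnit p ≫ q.hom) h₁
      dsimp at h₂
      rw [freeUnit_freeLift] at h₂
      exact (assoc _ _ _).trans h₂
    have : IsIso ((forget L).map i) := this
    exact isIso_of_reflects_iso i (forget L)

variable (k L) in
/-- The action of `𝒟` on modules is isomorphic to the identity. -/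
lemma isIso_unitAct [CpRigid k C] : IsIso (unitAct k (HC L)) :=
  HarishChandra.isIso_unitAct (isStrongGenerator_isDual k L)
end
end HC
end
end HarishChandra

/-! ### Cocontinuous lax monoidal comonads as bialgebroids. -/

namespace HarishChandra

noncomputable section

set_option linter.unusedSectionVars false

open CategoryTheory Category MonoidalCategory Limits Opposite

section
variable {H : Type u} [Category.{v} H] {A : H ⥤ H} {T : Comonad H} (κ : A ≅ T.toFunctor)

/-- The cofree coaction `T M ⟶ T (T M)`, pushed through `κ⁻¹`, becomes a coaction for the
comultiplication `δ'` matching that of `T`. Here `A` need not be known to be a comonad: this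
identity and the next two, at `M = cᵛ`, are the bialgebroid axioms that will make it one. -/
lemma transport_coassoc {δ' : A ⟶ A ⋙ A}
    (h : ∀ M, κ.hom.app M ≫ T.δ.app M =
      δ'.app M ≫ A.map (κ.hom.app M) ≫ κ.hom.app (T.obj M)) (M : H) :
    (T.δ.app M ≫ κ.inv.app (T.obj M)) ≫ A.map (T.δ.app M ≫ κ.inv.app (T.obj M)) =
      (T.δ.app M ≫ κ.inv.app (T.obj M)) ≫ δ'.app (T.obj M) := by
  have h₁ := h (T.obj M)
  have h₂ : δ'.app (T.obj M) = κ.hom.app (T.obj M) ≫ T.δ.app (T.obj M) ≫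
      κ.inv.app (T.obj (T.obj M)) ≫ A.map (κ.inv.app (T.obj M)) := by
    rw [reassoc_of% h₁, κ.hom_inv_id_app_assoc, ← A.map_comp, κ.hom_inv_id_app, A.map_id]
    exact (comp_id _).symm
  rw [h₂, A.map_comp, assoc, assoc, κ.inv_hom_id_app_assoc, ← κ.inv.naturality_assoc]
  exact T.coassoc_assoc M _

lemma transport_counit_left {ε' : A ⟶ 𝟭 H} (h : ∀ M, κ.hom.app M ≫ T.ε.app M = ε'.app M) (M : H) :
    (T.δ.app M ≫ κ.inv.app (T.obj M)) ≫ ε'.app (T.obj M) = 𝟙 (T.obj M) := by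
  rw [← h, assoc, κ.inv_hom_id_app_assoc]
  exact T.left_counit M

lemma transport_counit_right (M : H) :
    (T.δ.app M ≫ κ.inv.app (T.obj M)) ≫ A.map (T.ε.app M) = κ.inv.app M := by
  rw [assoc, ← κ.inv.naturality]
  exact T.right_counit_assoc M _
end

section
variable {k : Type w} [Field k] {H : Type u} [Category.{v} H] [Preadditive H] [Linear k H]
  [MonoidalCategory H] [MonoidalPreadditive H] [MonoidalLinear k H] [PresentablyMonoidal H]
  [UnitCP k H]

section
variable (k) (T : H ⥤ H)

/-- The functor of coefficients `c ↦ T(cᵛ)`. -/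
abbrev coeff : Idx k H ⥤ H := unitD k H ⋙ T

variable {k} in
/-- The map `T(cᵛ) ⟶ T(M)` corresponding to `1 ⟶ c ⊗ M`. -/
def adjT {c : CP k H} {M : H} (e : 𝟙_ H ⟶ c.obj ⊗ M) : ob (coeff k T) c ⟶ T.obj M :=
  T.map (adjD e)

variable {k} in
lemma adjT_w {c d : CP k H} {M : H} (f : c ⟶ d) (e : 𝟙_ H ⟶ c.obj ⊗ M) :
    mp (coeff k T) f ≫ adjT T e = adjT T (c := d) (e ≫ f.hom ▷ M) :=
  (T.map_comp _ _).symm.trans (congrArg T.map (adjD_w f e))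

variable {k} in
lemma adjT_nat {c : CP k H} {M N : H} (e : 𝟙_ H ⟶ c.obj ⊗ M) (g : M ⟶ N) :
    adjT T e ≫ T.map g = adjT T (e ≫ c.obj ◁ g) :=
  (T.map_comp _ _).symm.trans (congrArg T.map (adjD_nat e g))

/-- The comparison of the action of the coefficients of `T` with `T`. -/
def coeffAct : act (coeff k T) ⟶ T where
  app M := actDesc (X := coeff k T) (W := T.obj M) (fun c e => adjT T e)
    (fun c d f e => adjT_w T f e)
  naturality M N g := act_ext fun c e => by
    rw [reassoc_of% inj_map, inj_actDesc, reassoc_of% inj_actDesc, adjT_nat]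

lemma inj_coeffAct (M : H) (c : CP k H) (e : 𝟙_ H ⟶ c.obj ⊗ M) :
    inj (coeff k T) c e ≫ (coeffAct k T).app M = adjT T e := inj_actDesc _ _ _ _

/-- The multiplication of the coefficients is `μ T` followed by `T` of the multiplication of `𝒟`.
The claim is naturality of `μ T` applied to the corresponding identity `lm_adjD` for `𝒟`. -/
lemma lm_adjT [T.LaxMonoidal] {c d : CP k H} {M N : H} (e : 𝟙_ H ⟶ c.obj ⊗ M)
    (e' : 𝟙_ H ⟶ d.obj ⊗ N) :
    lm (coeff k T) c d ≫ adjT T (c := d ⊗ c) (pairE e e') =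
      (adjT T e ⊗ₘ adjT T e') ≫ Functor.LaxMonoidal.μ T M N := by
  have h : T.map (lm (unitD k H) c d) ≫ T.map (adjD (c := d ⊗ c) (pairE e e')) =
      T.map (adjD e ⊗ₘ adjD e') := (T.map_comp _ _).symm.trans (congrArg T.map (lm_adjD e e'))
  exact (assoc _ _ _).trans ((congrArg (Functor.LaxMonoidal.μ T _ _ ≫ ·) h).trans
    (Functor.LaxMonoidal.μ_natural T (adjD e) (adjD e')).symm)

lemma lu_adjT [T.LaxMonoidal] :
    lu (coeff k T) ≫ adjT T (c := 𝟙_ (CP k H)) (λ_ (𝟙_ H)).inv = Functor.LaxMonoidal.ε T := by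
  have h : T.map (lu (unitD k H)) ≫ T.map (adjD (c := 𝟙_ (CP k H)) (λ_ (𝟙_ H)).inv) =
      𝟙 _ := (T.map_comp _ _).symm.trans ((congrArg T.map lu_adjD).trans (T.map_id _))
  exact (assoc _ _ _).trans ((congrArg (Functor.LaxMonoidal.ε T ≫ ·) h).trans (comp_id _))

instance coeffAct_isMonoidal [T.LaxMonoidal] : (coeffAct k T).IsMonoidal where
  unit := by
    change (lu (coeff k T) ≫ inj (coeff k T) _ _) ≫ _ = _
    rw [assoc, inj_coeffAct, lu_adjT]
  tensor M N := act_ext₂ fun c e d e' => by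
    change _ ≫ actμ _ M N ≫ _ = _
    rw [reassoc_of% inj_actμ, inj_coeffAct, tensorHom_comp_tensorHom_assoc, inj_coeffAct,
      inj_coeffAct]
    exact lm_adjT k T e e'

lemma coeff_isLin [T.Additive] [T.Linear k] : IsLin (coeff k T) where
  add _ _ f g := (congrArg T.map ((unitD_isLin k H).add f g)).trans T.map_add
  smul _ _ r f := (congrArg T.map ((unitD_isLin k H).smul r f)).trans (T.map_smul _ _)

/-- `T` preserves the colimit `𝒟 × M`, whose legs become those of `coeff k T × M`. This comparison
`ψ` turns `coeffAct` into `T` applied to the density isomorphism, and so provides the inverse. -/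
lemma isIso_coeffAct_app [IsIso (unitAct k H)] [PreservesColimitsOfSize.{v, v} T] (M : H) :
    IsIso ((coeffAct k T).app M) := by
  let ψ : T.obj (actObj (unitD k H) M) ⟶ actObj (coeff k T) M :=
    actDescMap T (X := unitD k H) (fun c e => inj (coeff k T) c e) (fun _ _ f e => inj_w (X := coeff k T) f e)
  have hψ (c e) : T.map (inj (unitD k H) c e) ≫ ψ = inj (coeff k T) c e :=
    inj_actDescMap T (X := unitD k H) (fun c e => inj (coeff k T) c e) _ c e
  have h₁ : ψ ≫ (coeffAct k T).app M = T.map ((unitAct k H).app M) :=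
    act_ext_map T fun c e => by
      have h : T.map (inj (unitD k H) c e) ≫ T.map ((unitAct k H).app M) = adjT T e :=
        (T.map_comp _ _).symm.trans (congrArg T.map (inj_unitAct M c e))
      rw [h, reassoc_of% hψ]
      exact inj_coeffAct k T M c e
  have h₂ : (coeffAct k T).app M ≫ T.map (inv ((unitAct k H).app M)) ≫ ψ = 𝟙 _ :=
    act_ext fun c e => by
      have h : adjD e ≫ inv ((unitAct k H).app M) = inj (unitD k H) c e := by
        rw [IsIso.comp_inv_eq, inj_unitAct]
      have h' : adjT T e ≫ T.map (inv ((unitAct k H).app M)) = T.map (inj (unitD k H) c e) :=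
        (T.map_comp _ _).symm.trans (congrArg T.map h)
      rw [reassoc_of% inj_coeffAct, reassoc_of% h', comp_id]
      exact hψ c e
  refine ⟨T.map (inv ((unitAct k H).app M)) ≫ ψ, h₂, ?_⟩
  rw [assoc, h₁, ← T.map_comp, IsIso.inv_hom_id, T.map_id]

/-- A cocontinuous functor is the action of its coefficients. -/
def coeffIso [IsIso (unitAct k H)] [PreservesColimitsOfSize.{v, v} T] : act (coeff k T) ≅ T :=
  have (M : H) : IsIso ((coeffAct k T).app M) := isIso_coeffAct_app k T M
  have := NatIso.isIso_of_isIso_app (coeffAct k T)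
  asIso (coeffAct k T)

instance coeffIso_hom_isMonoidal [IsIso (unitAct k H)] [PreservesColimitsOfSize.{v, v} T]
    [T.LaxMonoidal] : NatTrans.IsMonoidal (coeffIso k T).hom := coeffAct_isMonoidal k T

end

section
variable (k) (T : Comonad H) [PreservesColimitsOfSize.{v, v} T.toFunctor] [IsIso (unitAct k H)]

/-- The coproduct `T(cᵛ) ⟶ T(T(cᵛ)) ≅ T × T(cᵛ)`. -/
def coeffΔ : coeff k T.toFunctor ⟶ coeff k T.toFunctor ⋙ act (coeff k T.toFunctor) :=
  Functor.whiskerLeft (unitD k H)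
    (T.δ ≫ Functor.whiskerLeft T.toFunctor (coeffIso k T.toFunctor).inv)

/-- The counit `T(cᵛ) ⟶ cᵛ`. -/
def coeffε : coeff k T.toFunctor ⟶ unitD k H := Functor.whiskerLeft (unitD k H) T.ε

variable {k}

/-- Tested on a leg `T(cᵛ) ⟶ X × M`, both sides are the comultiplication at `cᵛ` followed by `T (T
(adjunct e))`: one by naturality of `T.δ`, the other because the inverse of `coeffIso` built into
`coeffΔ` cancels. -/
lemma coeffIso_hom_δ (M : H) :
    (coeffIso k T.toFunctor).hom.app M ≫ T.δ.app M = (comulAct (coeffΔ k T)).app M ≫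
      (act (coeff k T.toFunctor)).map ((coeffIso k T.toFunctor).hom.app M) ≫
        (coeffIso k T.toFunctor).hom.app (T.obj M) := by
  refine act_ext fun c e => ?_
  have h : inj (coeff k T.toFunctor) c e ≫ (coeffIso k T.toFunctor).hom.app M =
    T.map (adjunct e) := inj_coeffAct k T.toFunctor M c e
  have h₁ : (act (coeff k T.toFunctor)).map (inj (coeff k T.toFunctor) c e) ≫
      (act (coeff k T.toFunctor)).map ((coeffIso k T.toFunctor).hom.app M) =
      (act (coeff k T.toFunctor)).map (T.map (adjunct e)) :=
    ((act _).map_comp _ _).symm.trans (congrArg _ h)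
  have h₂ := (coeffIso k T.toFunctor).hom.naturality (T.map (adjunct e))
  have h₃ := (coeffIso k T.toFunctor).inv_hom_id_app_assoc (T.obj (dl c)) (T.map (T.map (adjunct e)))
  rw [reassoc_of% h, reassoc_of% inj_comulAct, reassoc_of% h₁]
  refine (T.δ.naturality (adjunct e)).trans ((congrArg (T.δ.app (dl c) ≫ ·) h₃.symm).trans ?_)
  exact (congrArg (fun x => T.δ.app (dl c) ≫ (coeffIso k T.toFunctor).inv.app (T.obj (dl c)) ≫ x)
    h₂.symm).trans (assoc _ _ _).symm

lemma coeffIso_hom_ε (M : H) :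
    (coeffIso k T.toFunctor).hom.app M ≫ T.ε.app M = (counitAct (coeffε k T)).app M := by
  refine act_ext fun c e => ?_
  have h : inj (coeff k T.toFunctor) c e ≫ (coeffIso k T.toFunctor).hom.app M =
    T.map (adjunct e) := inj_coeffAct k T.toFunctor M c e
  rw [reassoc_of% h, inj_counitAct]
  exact T.ε.naturality (adjunct e)

instance coeffΔ_isMonoidal [T.toFunctor.LaxMonoidal] [T.δ.IsMonoidal] :
    (coeffΔ k T).IsMonoidal := by
  -- Inserting the associator, an identity on components, exhibits the map as a composite of
  -- transformations each already known to be monoidal.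
  have h : coeffΔ k T = Functor.whiskerLeft (unitD k H)
      (T.δ ≫ Functor.whiskerLeft T.toFunctor (coeffIso k T.toFunctor).inv) ≫
        (Functor.associator (unitD k H) T.toFunctor (act (coeff k T.toFunctor))).inv :=
    NatTrans.ext (funext fun c => (comp_id _).symm)
  rw [h]
  infer_instance

instance coeffε_isMonoidal [T.toFunctor.LaxMonoidal] [T.ε.IsMonoidal] :
    (coeffε k T).IsMonoidal := by
  have h : coeffε k T = Functor.whiskerLeft (unitD k H) T.ε ≫
      (Functor.rightUnitor (unitD k H)).hom :=
    NatTrans.ext (funext fun c => (comp_id _).symm)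
  rw [h]
  infer_instance

variable (k) in
/-- A cocontinuous linear lax monoidal comonad as a bialgebroid. -/
def ofComonad [T.toFunctor.LaxMonoidal] [T.δ.IsMonoidal] [T.ε.IsMonoidal] [T.toFunctor.Additive]
    [T.toFunctor.Linear k] : Bialgebroid k H where
  X := coeff k T.toFunctor
  isLin := coeff_isLin k T.toFunctor
  alg := inferInstance
  Δ := coeffΔ k T
  Δ_isMonoidal := inferInstance
  ε := coeffε k T
  ε_isMonoidal := inferInstance
  coassoc c := transport_coassoc (coeffIso k T.toFunctor) (coeffIso_hom_δ T) (dl c)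
  counit_left c := transport_counit_left (coeffIso k T.toFunctor) (coeffIso_hom_ε T) (dl c)
  counit_right c := by
    -- As `dcoev c` corresponds to the identity of `cᵛ`, the leg at `dcoev c` is a right inverse of
    -- nothing but `coeffIso` read backwards: it equals the inverse of `coeffIso` at `cᵛ`, which is
    -- what the comonad counit law yields.
    have h : inj (coeff k T.toFunctor) c (dcoev c) ≫ (coeffIso k T.toFunctor).hom.app (dl c) =
        𝟙 _ := (inj_coeffAct k T.toFunctor (dl c) c (dcoev c)).trans
      ((congrArg T.map (adjunct_dcoev c)).trans (T.map_id _))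
    exact (transport_counit_right (coeffIso k T.toFunctor) (dl c)).trans
      ((cancel_mono ((coeffIso k T.toFunctor).hom.app (dl c))).1
        (((coeffIso k T.toFunctor).inv_hom_id_app (dl c)).trans h.symm))

variable (k) in
/-- A cocontinuous linear lax monoidal comonad is the comonad of its bialgebroid. -/
def ofComonadIso [T.toFunctor.LaxMonoidal] [T.δ.IsMonoidal] [T.ε.IsMonoidal]
    [T.toFunctor.Additive] [T.toFunctor.Linear k] : T ≅ (ofComonad k T).comonad :=
  -- `coeffIso` points from the comonad of the bialgebroid to `T`, hence the final `symm`.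
  -- Naturality of `coeffIso` exchanges the two ways of writing its horizontal square.
  (ComonadIso.mk (M := (ofComonad k T).comonad) (coeffIso k T.toFunctor) (coeffIso_hom_ε T)
    (fun M => (coeffIso_hom_δ T M).trans
      (congrArg ((comulAct (coeffΔ k T)).app M ≫ ·)
        ((coeffIso k T.toFunctor).hom.naturality ((coeffIso k T.toFunctor).hom.app M))))).symm

lemma ofComonadIso_hom_isMonoidal [T.toFunctor.LaxMonoidal] [T.δ.IsMonoidal] [T.ε.IsMonoidal]
    [T.toFunctor.Additive] [T.toFunctor.Linear k] :
    NatTrans.IsMonoidal (F₁ := T.toFunctor) (F₂ := (ofComonad k T).comonad.toFunctor)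
      (ofComonadIso k T).hom.toNatTrans :=
  inferInstanceAs (NatTrans.IsMonoidal (coeffIso k T.toFunctor).inv)
end
end
end
end HarishChandra

/-! ### The quantum moment map of the underlying algebra. -/

namespace HarishChandra

noncomputable section

set_option linter.unusedSectionVars false

open CategoryTheory Category MonoidalCategory Limits Opposite

section
variable {k : Type w} [Field k] {H : Type u} [Category.{v} H] [Preadditive H] [Linear k H]
  [MonoidalCategory H] [MonoidalPreadditive H] [MonoidalLinear k H] [PresentablyMonoidal H]
  [UnitCP k H] (X : Idx k H ⥤ H) [X.LaxMonoidal]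

/-- The composite of the unit of an algebra of coefficients with a map to the unit object. -/
def unitMap {p : CP k H} (g : p ⟶ 𝟙_ (CP k H)) : 𝟙_ H ⟶ ob X p := lu X ≫ mp X g

lemma unitMap_mp {p q : CP k H} (f : q ⟶ p) (g : p ⟶ 𝟙_ (CP k H)) :
    unitMap X g ≫ mp X f = unitMap X (f ≫ g) := by
  rw [unitMap, unitMap, mp_comp, assoc]

/-- Elements coming from the unit of the algebra multiply by functoriality: naturality moves `g` out
of the product and unitality removes the unit. The factor `p` appears to the right of `c` because
the second tensor factor carries the reversed product. -/
lemma unitMap_lm {c p d : CP k H} (g : p ⟶ 𝟙_ (CP k H)) (z : d ⟶ c ⊗ p) :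
    unitMap X g ▷ ob X c ≫ lm X p c ≫ mp X z =
      (λ_ _).hom ≫ mp X (z ≫ c ◁ g ≫ (ρ_ c).hom) := by
  rw [unitMap, comp_whiskerRight, assoc, reassoc_of% lm_natR, lu_left X c, assoc, assoc,
    ← mp_comp, ← mp_comp]
  simp only [assoc, Iso.hom_inv_id, comp_id]

lemma lm_unitMap {c p d : CP k H} (g : p ⟶ 𝟙_ (CP k H)) (z : d ⟶ p ⊗ c) :
    ob X c ◁ unitMap X g ≫ lm X c p ≫ mp X z =
      (ρ_ _).hom ≫ mp X (z ≫ g ▷ c ≫ (λ_ c).hom) := by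
  rw [unitMap, MonoidalCategory.whiskerLeft_comp, assoc, reassoc_of% lm_natL, lu_right X c, assoc,
    assoc, ← mp_comp, ← mp_comp]
  simp only [assoc, Iso.hom_inv_id, comp_id]
end

namespace HC
section
variable {k : Type w} [Field k] {C : Type u} [Category.{v} C] [MonoidalCategory C]
  [PresentablyMonoidal C] [Preadditive C] [MonoidalPreadditive C] [Linear k C]
  [MonoidalLinear k C] [UnitCP k C] {L : Center C} [MonObj L] [IsCommMonObj L]
  (X : Idx k (HC L) ⥤ HC L)

open Functor.OplaxMonoidal

lemma freeCP_add {p q : CP k C} (f g : p ⟶ q) :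
    (freeCP L k).map (f + g) = (freeCP L k).map f + (freeCP L k).map g :=
  ObjectProperty.hom_ext _ (Mod.Hom.ext (MonoidalPreadditive.whiskerLeft_add _ _))

lemma freeCP_smul {p q : CP k C} (r : k) (f : p ⟶ q) :
    (freeCP L k).map (r • f) = r • (freeCP L k).map f :=
  ObjectProperty.hom_ext _ (Mod.Hom.ext (MonoidalLinear.whiskerLeft_smul _ _ _))

lemma mp_und {p q : CP k C} (f : p ⟶ q) : mp (und X) f = (mp X ((freeCP L k).map f)).hom := rfl

lemma und_isLin {X : Idx k (HC L) ⥤ HC L} (hX : IsLin X) : IsLin (und X) where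
  add p q f g := by
    rw [mp_und, freeCP_add, hX.add]
    rfl
  smul p q r f := by
    rw [mp_und, freeCP_smul, hX.smul]
    rfl

lemma freeLift_add {X : C} {M : HC L} (f g : X ⟶ M.X) :
    freeLift (f + g) = freeLift f + freeLift g := Mod.Hom.ext (by
  change base L ◁ (f + g) ≫ M.act = base L ◁ f ≫ M.act + base L ◁ g ≫ M.act
  rw [MonoidalPreadditive.whiskerLeft_add, Preadditive.add_comp])

lemma freeLift_smul {X : C} {M : HC L} (r : k) (f : X ⟶ M.X) :
    freeLift (r • f) = r • freeLift f := Mod.Hom.ext (by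
  change base L ◁ (r • f) ≫ M.act = r • (base L ◁ f ≫ M.act)
  rw [MonoidalLinear.whiskerLeft_smul, Linear.smul_comp])

lemma cpLift_add (p : CP k C) (f g : p.obj ⟶ base L) :
    cpLift L p (f + g) = cpLift L p f + cpLift L p g :=
  ObjectProperty.hom_ext _ (freeLift_add (M := unitHC L) f g)

lemma cpLift_smul (p : CP k C) (r : k) (f : p.obj ⟶ base L) :
    cpLift L p (r • f) = r • cpLift L p f :=
  ObjectProperty.hom_ext _ (freeLift_smul (M := unitHC L) r f)

lemma freeLift_precomp {Y Z : C} {M : HC L} (f : Y ⟶ Z) (g : Z ⟶ M.X) :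
    freeLift (f ≫ g) = (free L).map f ≫ freeLift g := Mod.Hom.ext (by
  change base L ◁ (f ≫ g) ≫ M.act = base L ◁ f ≫ base L ◁ g ≫ M.act
  rw [MonoidalCategory.whiskerLeft_comp, assoc])

lemma cpLift_precomp {p q : CP k C} (f : p ⟶ q) (g : q.obj ⟶ base L) :
    cpLift L p (f.hom ≫ g) = (freeCP L k).map f ≫ cpLift L q g :=
  ObjectProperty.hom_ext _ (freeLift_precomp (M := unitHC L) f.hom g)

-- This links the two halves of the moment map: `t` at the unit of `L` and `s` restricted along the
-- unit of `L` are the same element.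
variable (k L) in
lemma cpLift_one :
    cpLift L (𝟙_ (CP k C)) (MonObj.one : 𝟙_ C ⟶ base L) = η (freeCP L k) :=
  ObjectProperty.hom_ext _ free_η.symm

lemma freeUnit_map {Y Z : C} (f : Y ⟶ Z) :
    freeUnit Y ≫ ((free L).map f).hom = f ≫ freeUnit Z := by
  change ((λ_ Y).inv ≫ MonObj.one ▷ Y) ≫ base L ◁ f = f ≫ (λ_ Z).inv ≫ MonObj.one ▷ Z
  rw [assoc, ← whisker_exchange, leftUnitor_inv_naturality_assoc]

lemma freeUnit_δ (Y Z : C) : freeUnit (Y ⊗ Z) ≫ (δ (free L) Y Z).hom =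
    (freeUnit Y ⊗ₘ freeUnit Z) ≫ π ((free L).obj Y) ((free L).obj Z) := by
  rw [free_δ]
  exact freeUnit_freeLift _

/-- Maps out of a free module are determined by their restriction to generators. This lemma and the
next three compute such restrictions, reducing identities of module maps to identities in `C`. -/
lemma freeUnit_δ_whiskerRight {Y Z W : C} {M : HC L} (u : W ⟶ Y ⊗ Z) (f : Y ⟶ M.X) :
    freeUnit W ≫ ((free L).map u ≫ δ (free L) Y Z ≫ freeLift f ▷ (free L).obj Z).hom =
      u ≫ f ▷ Z ≫ M.X ◁ freeUnit Z ≫ π M ((free L).obj Z) := by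
  have h₁ : (freeUnit Y ⊗ₘ freeUnit Z) ≫ (freeLift f).hom ▷ ((free L).obj Z).X =
      f ▷ Z ≫ M.X ◁ freeUnit Z := by
    rw [← tensorHom_id, tensorHom_comp_tensorHom, freeUnit_freeLift, comp_id,
      MonoidalCategory.tensorHom_def]
  change freeUnit W ≫ ((free L).map u).hom ≫ (δ (free L) Y Z).hom ≫
        (freeLift f ▷ (free L).obj Z).hom = _
  rw [reassoc_of% freeUnit_map, reassoc_of% freeUnit_δ, π_whiskerRight, reassoc_of% h₁]

lemma freeUnit_δ_whiskerLeft {Y Z W : C} {M : HC L} (u : W ⟶ Y ⊗ Z) (f : Z ⟶ M.X) :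
    freeUnit W ≫ ((free L).map u ≫ δ (free L) Y Z ≫ (free L).obj Y ◁ freeLift f).hom =
      u ≫ Y ◁ f ≫ freeUnit Y ▷ M.X ≫ π ((free L).obj Y) M := by
  have h₁ : (freeUnit Y ⊗ₘ freeUnit Z) ≫ ((free L).obj Y).X ◁ (freeLift f).hom =
      Y ◁ f ≫ freeUnit Y ▷ M.X := by
    rw [← id_tensorHom, tensorHom_comp_tensorHom, freeUnit_freeLift, comp_id, tensorHom_def']
  change freeUnit W ≫ ((free L).map u).hom ≫ (δ (free L) Y Z).hom ≫
        ((free L).obj Y ◁ freeLift f).hom = _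
  rw [reassoc_of% freeUnit_map, reassoc_of% freeUnit_δ, π_whiskerLeft, reassoc_of% h₁]

lemma freeUnit_δ_left {Y Z W : C} (u : W ⟶ Y ⊗ Z) (f : Y ⟶ base L) :
    freeUnit W ≫ ((free L).map u ≫ δ (free L) Y Z ≫
      freeLift (M := unitHC L) f ▷ (free L).obj Z ≫ (λ_ ((free L).obj Z)).hom).hom = u ≫ f ▷ Z := by
  have h₁ := freeUnit_δ_whiskerRight (M := unitHC L) u f =≫ (λ_ ((free L).obj Z)).hom.hom
  have h₂ : π (unitHC L) ((free L).obj Z) ≫ (λ_ ((free L).obj Z)).hom.hom =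
    ((free L).obj Z).act := π_leftUnitor _
  have h₃ : (free L).map u ≫ δ (free L) Y Z ≫ freeLift (M := unitHC L) f ▷ (free L).obj Z ≫
      (λ_ ((free L).obj Z)).hom = ((free L).map u ≫ δ (free L) Y Z ≫
        freeLift (M := unitHC L) f ▷ (free L).obj Z) ≫ (λ_ ((free L).obj Z)).hom := by
    rw [assoc]
    exact congrArg (_ ≫ ·) (assoc _ _ _).symm
  refine (congrArg (fun x => freeUnit W ≫ x.hom) h₃).trans ((assoc _ _ _).symm.trans (h₁.trans ?_))
  refine (assoc _ _ _).trans (congrArg (u ≫ ·) ((assoc _ _ _).trans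
    (((congrArg (f ▷ Z ≫ ·) ((assoc _ _ _).trans ?_)).trans (comp_id _)))))
  exact (congrArg (_ ≫ ·) h₂).trans (freeUnit_act Z)

lemma freeUnit_δ_right {Y Z W : C} (u : W ⟶ Y ⊗ Z) (f : Z ⟶ base L) :
    freeUnit W ≫ ((free L).map u ≫ δ (free L) Y Z ≫
      (free L).obj Y ◁ freeLift (M := unitHC L) f ≫ (ρ_ ((free L).obj Y)).hom).hom =
        u ≫ Y ◁ f ≫ freeUnit Y ▷ base L ≫ ((free L).obj Y).rightAct := by
  have h₁ := freeUnit_δ_whiskerLeft (M := unitHC L) u f =≫ (ρ_ ((free L).obj Y)).hom.hom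
  have h₂ : π ((free L).obj Y) (unitHC L) ≫ (ρ_ ((free L).obj Y)).hom.hom =
    ((free L).obj Y).rightAct := π_rightUnitor _
  have h₃ : (free L).map u ≫ δ (free L) Y Z ≫ (free L).obj Y ◁ freeLift (M := unitHC L) f ≫
      (ρ_ ((free L).obj Y)).hom = ((free L).map u ≫ δ (free L) Y Z ≫
        (free L).obj Y ◁ freeLift (M := unitHC L) f) ≫ (ρ_ ((free L).obj Y)).hom := by
    rw [assoc]
    exact congrArg (_ ≫ ·) (assoc _ _ _).symm
  refine (congrArg (fun x => freeUnit W ≫ x.hom) h₃).trans ((assoc _ _ _).symm.trans (h₁.trans ?_))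
  exact (assoc _ _ _).trans (congrArg (u ≫ ·) ((assoc _ _ _).trans
    (congrArg (Y ◁ f ≫ ·) ((assoc _ _ _).trans (congrArg (_ ≫ ·) h₂)))))

/-- The right action is the left action composed with `τ`, and on generators the left action is
free, so only `τ` remains. This is how the half-braiding enters the centrality of `t`. -/
lemma freeUnit_rightAct (Y : C) : freeUnit Y ▷ base L ≫ ((free L).obj Y).rightAct = (τ L Y).hom := by
  rw [rightAct, reassoc_of% τ_naturality, freeUnit_act]
  exact comp_id _

/-- On generators the composite multiplies the values of `g` and `f` by the right action of `L` on
itself. It is the source of the multiplicativity of `t`, including the reversed order. -/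
lemma cpLift_mul {p q : CP k C} (f : p.obj ⟶ base L) (g : q.obj ⟶ base L) :
    δ (freeCP L k) q p ≫ (freeCP L k).obj q ◁ cpLift L p f ≫ (ρ_ _).hom ≫ cpLift L q g =
      cpLift L (q ⊗ p) ((g ⊗ₘ f) ≫ MonObj.mul) := by
  refine ObjectProperty.hom_ext _ (free_hom_ext (p := q.obj ⊗ p.obj) ?_)
  have h₁ := freeUnit_δ_right (L := L) (𝟙 (q.obj ⊗ p.obj)) f =≫ (freeLift (M := unitHC L) g).hom
  have h₂ : freeUnit q.obj ≫ (freeLift (M := unitHC L) g).hom = g := freeUnit_freeLift _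
  -- A module map also respects the right actions, and the right action of `L` on itself is its
  -- multiplication because `L` is commutative in the center.
  have h₃ : ((free L).obj q.obj).rightAct ≫ (freeLift (M := unitHC L) g).hom =
      (freeLift (M := unitHC L) g).hom ▷ base L ≫ (MonObj.mul : base L ⊗ base L ⟶ base L) :=
    (rightAct_hom _).trans (congrArg (_ ≫ ·) unitHC_rightAct)
  have h₄ : q.obj ◁ f ≫ freeUnit q.obj ▷ base L ≫ (freeLift (M := unitHC L) g).hom ▷ base L =
      (g ⊗ₘ f) := by
    rw [← comp_whiskerRight, tensorHom_def']
    exact congrArg (fun x => q.obj ◁ f ≫ x ▷ base L) h₂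
  have h₅ : δ (free L) q.obj p.obj ≫ (free L).obj q.obj ◁ freeLift (M := unitHC L) f ≫
      (ρ_ ((free L).obj q.obj)).hom ≫ freeLift (M := unitHC L) g =
      ((free L).map (𝟙 (q.obj ⊗ p.obj)) ≫ δ (free L) q.obj p.obj ≫
        (free L).obj q.obj ◁ freeLift (M := unitHC L) f ≫ (ρ_ ((free L).obj q.obj)).hom) ≫
          freeLift (M := unitHC L) g := by
    exact ((((free L).map_id _ =≫ _).trans (id_comp _) =≫ _).trans ((assoc _ _ _).trans (congrArg (_ ≫ ·) (assoc _ _ _)))).symm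
  refine (congrArg (fun x => freeUnit (q.obj ⊗ p.obj) ≫ x.hom) h₅).trans
    ((assoc _ _ _).symm.trans (h₁.trans (Eq.trans ?_ (freeUnit_freeLift _).symm)))
  refine (id_comp _ =≫ _).trans (Eq.trans ?_
    (congrArg (· ≫ (MonObj.mul : base L ⊗ base L ⟶ base L)) h₄))
  refine (assoc _ _ _).trans (Eq.trans ?_ (assoc _ _ _).symm)
  refine congrArg (q.obj ◁ f ≫ ·) ((assoc _ _ _).trans (Eq.trans ?_ (assoc _ _ _).symm))
  exact congrArg (_ ≫ ·) h₃

/-- Both sides are module maps from a free module. On generators they are exactly the two sides of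
the hypothesis, the `τ` coming from `freeUnit_rightAct`. -/
lemma cpLift_central {p p' q r : CP k C} (u : r ⟶ p ⊗ q) (v : r ⟶ q ⊗ p') (f : p.obj ⟶ base L)
    (f' : p'.obj ⟶ base L) (h : u.hom ≫ f ▷ q.obj = v.hom ≫ q.obj ◁ f' ≫ (τ L q.obj).hom) :
    (freeCP L k).map u ≫ δ (freeCP L k) p q ≫ cpLift L p f ▷ (freeCP L k).obj q ≫ (λ_ _).hom =
      (freeCP L k).map v ≫ δ (freeCP L k) q p' ≫ (freeCP L k).obj q ◁ cpLift L p' f' ≫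
        (ρ_ _).hom := by
  refine ObjectProperty.hom_ext _ (free_hom_ext (p := r.obj) ?_)
  have h₁ := freeUnit_δ_right (L := L) v.hom f'
  rw [freeUnit_rightAct] at h₁
  exact (freeUnit_δ_left (L := L) u.hom f).trans (h.trans h₁.symm)

variable [X.LaxMonoidal]

lemma lm_und (p q : CP k C) : lm (und X) p q =
    π (ob X ((freeCP L k).obj p)) (ob X ((freeCP L k).obj q)) ≫
      (lm X ((freeCP L k).obj p) ((freeCP L k).obj q)).hom ≫ (mp X (δ (freeCP L k) q p)).hom :=
  assoc _ _ _

lemma lu_und : lu (und X) = (MonObj.one : 𝟙_ C ⟶ base L) ≫ undS X := assoc _ _ _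

lemma undT_eq (p : CP k C) (f : p.obj ⟶ base L) :
    undT X p f = (MonObj.one : 𝟙_ C ⟶ base L) ≫ (unitMap X (cpLift L p f)).hom := rfl

/-- The relative product `π` turns multiplication by a map out of the unit module `L` into the
unitor of `HC`, which is the action of `L`. Taking `g` to be the counit of `freeCP` gives `s`;
restricting along the unit of `L` gives `t`. -/
lemma unitMap_lm_und {p q r : CP k C} (g : (freeCP L k).obj p ⟶ 𝟙_ (CP k (HC L)))
    (u : r ⟶ q ⊗ p) :
    (unitMap X g).hom ▷ ob (und X) q ≫ lm (und X) p q ≫ mp (und X) u =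
      (ob X ((freeCP L k).obj q)).act ≫ (mp X ((freeCP L k).map u ≫ δ (freeCP L k) q p ≫
        (freeCP L k).obj q ◁ g ≫ (ρ_ _).hom)).hom := by
  have h₁ := π_whiskerRight (unitMap X g) (ob X ((freeCP L k).obj q))
  have h₂ := congrArg Mod.Hom.hom (unitMap_lm X g ((freeCP L k).map u ≫ δ (freeCP L k) q p))
  have h₃ := π_leftUnitor (ob X ((freeCP L k).obj q))
  have h₄ : mp X (δ (freeCP L k) q p) ≫ mp X ((freeCP L k).map u) =
    mp X ((freeCP L k).map u ≫ δ (freeCP L k) q p) := (mp_comp ..).symm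
  have h₅ : lm (und X) p q ≫ mp (und X) u =
      π (ob X ((freeCP L k).obj p)) (ob X ((freeCP L k).obj q)) ≫
      (lm X ((freeCP L k).obj p) ((freeCP L k).obj q) ≫
        mp X ((freeCP L k).map u ≫ δ (freeCP L k) q p)).hom := by
    rw [lm_und, ← h₄]
    exact (assoc _ _ _).trans (congrArg (_ ≫ ·) (assoc _ _ _))
  refine (congrArg (_ ≫ ·) h₅).trans ((assoc _ _ _).symm.trans ((congrArg (· ≫ _) h₁.symm).trans
    ((assoc _ _ _).trans ((congrArg (_ ≫ ·) h₂).trans ((assoc _ _ _).symm.trans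
      ((congrArg (· ≫ _) h₃).trans ?_))))))
  rw [assoc]
  rfl

lemma lm_und_unitMap {p q r : CP k C} (g : (freeCP L k).obj p ⟶ 𝟙_ (CP k (HC L)))
    (u : r ⟶ p ⊗ q) :
    ob (und X) q ◁ (unitMap X g).hom ≫ lm (und X) q p ≫ mp (und X) u =
      (ob X ((freeCP L k).obj q)).rightAct ≫ (mp X ((freeCP L k).map u ≫ δ (freeCP L k) p q ≫
        g ▷ (freeCP L k).obj q ≫ (λ_ _).hom)).hom := by
  have h₁ := π_whiskerLeft (ob X ((freeCP L k).obj q)) (unitMap X g)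
  have h₂ := congrArg Mod.Hom.hom (lm_unitMap X g ((freeCP L k).map u ≫ δ (freeCP L k) p q))
  have h₃ := π_rightUnitor (ob X ((freeCP L k).obj q))
  have h₄ : mp X (δ (freeCP L k) p q) ≫ mp X ((freeCP L k).map u) =
    mp X ((freeCP L k).map u ≫ δ (freeCP L k) p q) := (mp_comp ..).symm
  have h₅ : lm (und X) q p ≫ mp (und X) u =
      π (ob X ((freeCP L k).obj q)) (ob X ((freeCP L k).obj p)) ≫
      (lm X ((freeCP L k).obj q) ((freeCP L k).obj p) ≫
        mp X ((freeCP L k).map u ≫ δ (freeCP L k) p q)).hom := by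
    rw [lm_und, ← h₄]
    exact (assoc _ _ _).trans (congrArg (_ ≫ ·) (assoc _ _ _))
  refine (congrArg (_ ≫ ·) h₅).trans ((assoc _ _ _).symm.trans ((congrArg (· ≫ _) h₁.symm).trans
    ((assoc _ _ _).trans ((congrArg (_ ≫ ·) h₂).trans ((assoc _ _ _).symm.trans
      ((congrArg (· ≫ _) h₃).trans ?_))))))
  rw [assoc]
  rfl

lemma undT_nat {p q : CP k C} (f : p ⟶ q) (g : q.obj ⟶ base L) :
    undT X p (f.hom ≫ g) = undT X q g ≫ mp (und X) f := by
  refine (congrArg (fun x => (MonObj.one : 𝟙_ C ⟶ base L) ≫ (unitMap X x).hom)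
    (cpLift_precomp f g)).trans (Eq.trans ?_ (assoc _ _ _).symm)
  exact congrArg (fun x => (MonObj.one : 𝟙_ C ⟶ base L) ≫ Mod.Hom.hom x)
    (unitMap_mp X ((freeCP L k).map f) (cpLift L q g)).symm

/-- Restricting along the unit of `L` makes the action in `unitMap_lm_und` trivial, so
multiplication by `t` is pure functoriality of `X`. -/
lemma undT_lm {p q r : CP k C} (f : p.obj ⟶ base L) (u : r ⟶ q ⊗ p) :
    undT X p f ▷ ob (und X) q ≫ lm (und X) p q ≫ mp (und X) u =
      (λ_ (ob (und X) q)).hom ≫ (mp X ((freeCP L k).map u ≫ δ (freeCP L k) q p ≫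
        (freeCP L k).obj q ◁ cpLift L p f ≫ (ρ_ _).hom)).hom := by
  refine (congrArg (· ≫ lm (und X) p q ≫ mp (und X) u)
    (comp_whiskerRight (MonObj.one : 𝟙_ C ⟶ base L) _ _)).trans ((assoc _ _ _).trans ?_)
  refine (congrArg (_ ≫ ·) (unitMap_lm_und X (cpLift L p f) u)).trans ((assoc _ _ _).symm.trans ?_)
  exact congrArg (· ≫ _) (one_act (ob X ((freeCP L k).obj q)))

lemma lm_undT {p q r : CP k C} (f : p.obj ⟶ base L) (u : r ⟶ p ⊗ q) :
    ob (und X) q ◁ undT X p f ≫ lm (und X) q p ≫ mp (und X) u =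
      (ρ_ (ob (und X) q)).hom ≫ (mp X ((freeCP L k).map u ≫ δ (freeCP L k) p q ≫
        cpLift L p f ▷ (freeCP L k).obj q ≫ (λ_ _).hom)).hom := by
  refine (congrArg (· ≫ lm (und X) q p ≫ mp (und X) u)
    (MonoidalCategory.whiskerLeft_comp _ (MonObj.one : 𝟙_ C ⟶ base L) _)).trans
      ((assoc _ _ _).trans ?_)
  refine (congrArg (_ ≫ ·) (lm_und_unitMap X (cpLift L p f) u)).trans ((assoc _ _ _).symm.trans ?_)
  exact congrArg (· ≫ _) (rightAct_one (ob X ((freeCP L k).obj q)))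

/-- The product with `t f` acts on `t g` by functoriality of `X`, hence produces the element of the
composite map to the unit, which `cpLift_mul` evaluates. -/
lemma undT_mul {p q : CP k C} (f : p.obj ⟶ base L) (g : q.obj ⟶ base L) :
    (undT X p f ⊗ₘ undT X q g) ≫ lm (und X) p q =
      (λ_ (𝟙_ C)).hom ≫ undT X (q ⊗ p) ((g ⊗ₘ f) ≫ MonObj.mul) := by
  have h₁ := undT_lm X (q := q) f (𝟙 (q ⊗ p))
  rw [mp_id, comp_id] at h₁
  rw [tensorHom_def', assoc, h₁]
  refine (assoc _ _ _).symm.trans ((congrArg (· ≫ _) (leftUnitor_naturality _)).trans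
    ((assoc _ _ _).trans ?_))
  have h₂ : ((freeCP L k).map (𝟙 (q ⊗ p)) ≫ δ (freeCP L k) q p ≫
      (freeCP L k).obj q ◁ cpLift L p f ≫ (ρ_ _).hom) ≫ cpLift L q g =
        cpLift L (q ⊗ p) ((g ⊗ₘ f) ≫ MonObj.mul) := by
    rw [← cpLift_mul, (freeCP L k).map_id, id_comp, assoc, assoc]
  have h₃ := congrArg Mod.Hom.hom ((unitMap_mp X _ (cpLift L q g)).trans (congrArg (unitMap X) h₂))
  exact congrArg (_ ≫ ·) ((assoc _ _ _).trans
    (congrArg ((MonObj.one : 𝟙_ C ⟶ base L) ≫ ·) h₃))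

/-- Multiplication by `s` on the left recovers the given left action of `L`: the remaining
functoriality term is trivial by the unitality of `freeCP`. On the other side `lm_undS` recovers the
right action. -/
lemma undS_lm (q : CP k C) : undS X ▷ ob (und X) q ≫ lm (und X) (𝟙_ _) q ≫ mp (und X) (ρ_ q).inv =
    (ob X ((freeCP L k).obj q)).act := by
  refine (unitMap_lm_und X (η (freeCP L k)) (ρ_ q).inv).trans ?_
  have h : (freeCP L k).map (ρ_ q).inv ≫ δ (freeCP L k) q (𝟙_ _) ≫
      (freeCP L k).obj q ◁ η (freeCP L k) ≫ (ρ_ _).hom = 𝟙 _ := by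
    rw [← Functor.OplaxMonoidal.right_unitality_assoc, Iso.inv_hom_id]
  rw [h, mp_id]
  exact comp_id _

lemma lm_undS (q : CP k C) : ob (und X) q ◁ undS X ≫ lm (und X) q (𝟙_ _) ≫ mp (und X) (λ_ q).inv =
    (ob X ((freeCP L k).obj q)).rightAct := by
  refine (lm_und_unitMap X (η (freeCP L k)) (λ_ q).inv).trans ?_
  have h : (freeCP L k).map (λ_ q).inv ≫ δ (freeCP L k) (𝟙_ _) q ≫
      η (freeCP L k) ▷ (freeCP L k).obj q ≫ (λ_ _).hom = 𝟙 _ := by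
    rw [← Functor.OplaxMonoidal.left_unitality_assoc, Iso.inv_hom_id]
  rw [h, mp_id]
  exact comp_id _

/-- `s` underlies the module map `unitMap X (η (freeCP L k))`. Its linearity is the multiplicativity
of `s`, once the action on the target is rewritten as multiplication by `s`. -/
lemma mul_undS : (MonObj.mul : base L ⊗ base L ⟶ base L) ≫ undS X =
    (undS X ⊗ₘ undS X) ≫ lm (und X) _ _ ≫ mp (und X) (λ_ (𝟙_ (CP k C))).inv := by
  rw [tensorHom_def', assoc, unitors_inv_equal]
  refine (act_hom (M := unitHC L) (unitMap X (η (freeCP L k)))).trans ?_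
  exact congrArg (_ ≫ ·) (undS_lm X (𝟙_ (CP k C))).symm

variable {X} in
/-- The quantum moment map of the algebra in `C ⊗ C^{⊗op}` underlying an algebra in
`HC ⊗ HC^{⊗op}`. -/
def undMoment (hX : IsLin X) : MomentMap L (und X) where
  s := undS X
  t p :=
    { toFun := undT X p
      map_add' := fun f g => by
        simp only [undT_eq, unitMap, cpLift_add, hX.add, Preadditive.comp_add]
        exact Preadditive.comp_add ..
      map_smul' := fun r f => by
        simp only [undT_eq, unitMap, cpLift_smul, hX.smul, Linear.comp_smul]
        exact Linear.comp_smul .. }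
  t_nat f g := undT_nat X f g
  s_one := (lu_und X).symm
  s_mul := mul_undS X
  -- The two products with `s` are the right and the left action, and the former is by definition
  -- `τ` followed by the latter.
  s_central q := (lm_undS X q).trans (congrArg (_ ≫ ·) (undS_lm X q).symm)
  t_one := by
    refine Eq.trans ?_ (lu_und X).symm
    exact congrArg (fun x => (MonObj.one : 𝟙_ C ⟶ base L) ≫ (unitMap X x).hom) (cpLift_one k L)
  t_mul f g := undT_mul X f g
  t_central u v f f' h := by
    change (ρ_ _).inv ≫ ob (und X) _ ◁ undT X _ f ≫ _ = (λ_ _).inv ≫ undT X _ f' ▷ _ ≫ _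
    rw [lm_undT, undT_lm, cpLift_central u v f f' h]
    exact (Iso.inv_hom_id_assoc _ _).trans (Iso.inv_hom_id_assoc _ _).symm

end
end HC

section
variable {k : Type w} [Field k] {C : Type u} [Category.{v} C] [MonoidalCategory C]
  [PresentablyMonoidal C] [Preadditive C] [MonoidalPreadditive C] [Linear k C]
  [MonoidalLinear k C] [UnitCP k C] {L : Center C} [MonObj L] [IsCommMonObj L]

/-- The Harish-Chandra bialgebroid with a given algebra in `HC ⊗ HC^{⊗op}`. -/
def HCBialgebroid.ofBialgebroid (B : Bialgebroid k (HC L)) : HCBialgebroid k L :=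
  letI := B.alg
  { A := HC.und B.X
    isLin := HC.und_isLin B.isLin
    alg := inferInstance
    moment := HC.undMoment B.isLin
    B := B
    -- The algebra in `C ⊗ C^{⊗op}` is chosen to be the underlying one and its moment map the
    -- induced one, so the compatibilities hold trivially.
    θ := Iso.refl _
    θ_isMonoidal := inferInstanceAs (NatTrans.IsMonoidal (𝟙 (HC.und B.X)))
    θ_s := comp_id _
    θ_t := fun _ _ => comp_id _ }
end
end
end HarishChandra

/-! ### Change of comonad and the monoidal comparison functor. -/

namespace HarishChandra

noncomputable section

set_option linter.unusedSectionVars false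

open CategoryTheory Category MonoidalCategory Limits Opposite

section
variable {H : Type u} [Category.{v} H] {M N : Comonad H}

/-- Coalgebras along a map of comonads. -/
def coalgFunctor (g : M ⟶ N) : M.Coalgebra ⥤ N.Coalgebra where
  obj X :=
    { A := X.A
      a := X.a ≫ g.app X.A
      counit := by rw [assoc, ComonadHom.app_ε, X.counit]
      coassoc := by
        rw [assoc, ComonadHom.app_δ, reassoc_of% X.coassoc, assoc, N.map_comp]
        exact congrArg (X.a ≫ ·) ((assoc _ _ _).symm.trans
          ((congrArg (· ≫ _) (g.naturality X.a)).trans (assoc _ _ _))) }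
  map {X Y} f :=
    { f := f.f
      h := by
        have h := g.naturality f.f
        exact (assoc _ _ _).trans ((congrArg (X.a ≫ ·) h.symm).trans ((assoc _ _ _).symm.trans
          ((congrArg (· ≫ g.app Y.A) f.h).trans (assoc _ _ _)))) }

instance (g : M ⟶ N) : (coalgFunctor g).Faithful where
  map_injective {X Y} a b h := Comonad.Coalgebra.Hom.ext (by
    exact congrArg (Comonad.Coalgebra.Hom.f (A := (coalgFunctor g).obj X)
      (B := (coalgFunctor g).obj Y)) h)

/-- Underlying objects and maps are unchanged. Fullness cancels the isomorphism from the coaction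
square, and a coalgebra is reached by transporting its coaction along the inverse. -/
lemma coalgFunctor_isEquivalence (e : M ≅ N) : (coalgFunctor e.hom).IsEquivalence := by
  have h (X : H) : e.hom.app X ≫ e.inv.app X = 𝟙 _ :=
    congrArg (fun g : M ⟶ M => g.app X) e.hom_inv_id
  have h' (X : H) : e.inv.app X ≫ e.hom.app X = 𝟙 _ :=
    congrArg (fun g : N ⟶ N => g.app X) e.inv_hom_id
  have : (coalgFunctor e.hom).Full :=
    { map_surjective := fun {X Y} f => by
        have key (f : X.A ⟶ Y.A) (hf : (X.a ≫ e.hom.app X.A) ≫ N.map f =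
            f ≫ Y.a ≫ e.hom.app Y.A) : X.a ≫ M.map f = f ≫ Y.a := by
          have h₂ : M.map f ≫ e.hom.app Y.A = e.hom.app X.A ≫ N.map f := e.hom.naturality f
          have h₃ := hf =≫ e.inv.app Y.A
          simp only [assoc] at h₃
          rwa [← reassoc_of% h₂, h, comp_id, comp_id] at h₃
        exact ⟨{ f := f.f, h := key f.f f.h }, rfl⟩ }
  have : (coalgFunctor e.hom).EssSurj :=
    { mem_essImage := fun Y => ⟨(coalgFunctor e.inv).obj Y,
        ⟨Comonad.Coalgebra.isoMk (Iso.refl Y.A) (by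
          change ((Y.a ≫ e.inv.app Y.A) ≫ e.hom.app Y.A) ≫ N.map (𝟙 Y.A) = 𝟙 Y.A ≫ Y.a
          rw [N.map_id, comp_id, assoc, h', comp_id, id_comp])⟩⟩ }
  exact { }
end

section
variable {D : Type u'} [Category.{v} D] {H : Type u} [Category.{v} H] {F : D ⥤ H} {FR : H ⥤ D}

lemma rightAdjoint_linear (k : Type w) [Field k] [Preadditive D] [Linear k D] [Preadditive H]
    [Linear k H] [F.Additive] [F.Linear k] (adj : F ⊣ FR) : FR.Linear k where
  map_smul f r := (adj.homEquiv _ _).symm.injective (by simp [Adjunction.homEquiv_counit])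

variable [MonoidalCategory D] [MonoidalCategory H] [F.Monoidal] (adj : F ⊣ FR)

instance [FR.LaxMonoidal] : adj.toComonad.toFunctor.LaxMonoidal :=
  inferInstanceAs (FR ⋙ F).LaxMonoidal

instance [FR.LaxMonoidal] [adj.IsMonoidal] : adj.toComonad.ε.IsMonoidal :=
  inferInstanceAs adj.counit.IsMonoidal

instance [FR.LaxMonoidal] [adj.IsMonoidal] : adj.toComonad.δ.IsMonoidal := by
  -- The comultiplication is the unit of the adjunction whiskered by `FR` and then by `F`, up to
  -- coherence isomorphisms. Written so, it is a composite of monoidal transformations.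
  let d := FR.rightUnitor.inv ≫ Functor.whiskerLeft FR adj.unit ≫ (Functor.associator FR F FR).inv
  have h : adj.toComonad.δ =
      Functor.whiskerRight d F ≫ (Functor.associator (FR ⋙ F) FR F).hom :=
    NatTrans.ext (funext fun X => by simp [d]; rfl)
  rw [h]
  exact inferInstanceAs
    (Functor.whiskerRight d F ≫ (Functor.associator (FR ⋙ F) FR F).hom).IsMonoidal

section
open Functor.LaxMonoidal
variable {T : H ⥤ H} [T.LaxMonoidal] [FR.LaxMonoidal] (u : ∀ X : D, X ⟶ FR.obj (F.obj X))
  (e : ∀ A : H, F.obj (FR.obj A) ⟶ T.obj A)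

/-- Compatibility of `ε F` with coactions combines monoidality of `e`, monoidality of the unit, and
naturality of `e`. The statement uses bare families `u` and `e` so that `F.obj (FR.obj A)` stays
visible; in `adj.toComonad` it appears only after unfolding. -/
lemma ε_map (h₁ : (ε F ≫ F.map (ε FR)) ≫ e (𝟙_ H) = ε T)
    (h₂ : u (𝟙_ D) = ε FR ≫ FR.map (ε F))
    (h₃ : F.map (FR.map (ε F)) ≫ e (F.obj (𝟙_ D)) = e (𝟙_ H) ≫ T.map (ε F)) :
    ε T ≫ T.map (ε F) = ε F ≫ F.map (u (𝟙_ D)) ≫ e (F.obj (𝟙_ D)) := by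
  rw [← h₁, h₂, F.map_comp, assoc, assoc, assoc, h₃]

lemma μ_map {X Y : D} (h₁ : ∀ A B : H, (μ F _ _ ≫ F.map (μ FR A B)) ≫ e (A ⊗ B) =
      (e A ⊗ₘ e B) ≫ μ T A B)
    (h₂ : u (X ⊗ Y) = (u X ⊗ₘ u Y) ≫ μ FR _ _ ≫ FR.map (μ F X Y))
    (h₃ : F.map (FR.map (μ F X Y)) ≫ e (F.obj (X ⊗ Y)) =
      e (F.obj X ⊗ F.obj Y) ≫ T.map (μ F X Y)) :
    (((F.map (u X) ≫ e (F.obj X)) ⊗ₘ (F.map (u Y) ≫ e (F.obj Y))) ≫ μ T _ _) ≫ T.map (μ F X Y) =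
      μ F X Y ≫ F.map (u (X ⊗ Y)) ≫ e (F.obj (X ⊗ Y)) := by
  rw [h₂, F.map_comp, F.map_comp, assoc, assoc, assoc, h₃, ← μ_natural_assoc, ← tensorHom_comp_tensorHom,
    assoc, ← reassoc_of% h₁]
end

/-- The comparison functor to coalgebras over a comonad isomorphic to the one of an adjunction. -/
def toCoalg {K : Comonad H} (e : adj.toComonad ≅ K) : D ⥤ K.Coalgebra :=
  Comonad.comparison adj ⋙ coalgFunctor e.hom

section
variable [FR.LaxMonoidal] [adj.IsMonoidal] {K : Comonad H} [K.toFunctor.LaxMonoidal]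
  [K.δ.IsMonoidal] [K.ε.IsMonoidal] (e : adj.toComonad ≅ K)
  (he : NatTrans.IsMonoidal (F₁ := FR ⋙ F) (F₂ := K.toFunctor) e.hom.toNatTrans)

open Functor.LaxMonoidal

-- This and `toCoalg_μ` say that the structure isomorphisms of `F` are maps of coalgebras, which is
-- all that is needed to lift the monoidal structure of `F` to the comparison functor.
include he in
lemma toCoalg_ε : ε K.toFunctor ≫ K.map (ε F) =
    (ε F ≫ F.map (adj.unit.app (𝟙_ D)) ≫ e.hom.app (F.obj (𝟙_ D)) :) :=
  ε_map (T := K.toFunctor) adj.unit.app e.hom.app he.unit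
    ((id_comp _).symm.trans (NatTrans.IsMonoidal.unit (τ := adj.unit))) (e.hom.naturality (ε F))

include he in
lemma toCoalg_μ (X Y : D) :
    (((F.map (adj.unit.app X) ≫ e.hom.app (F.obj X)) ⊗ₘ
      (F.map (adj.unit.app Y) ≫ e.hom.app (F.obj Y))) ≫ μ K.toFunctor _ _) ≫ K.map (μ F X Y) =
      (μ F X Y ≫ F.map (adj.unit.app (X ⊗ Y)) ≫ e.hom.app (F.obj (X ⊗ Y)) :) :=
  μ_map (T := K.toFunctor) adj.unit.app e.hom.app he.tensor
    ((id_comp _).symm.trans (NatTrans.IsMonoidal.tensor (τ := adj.unit) X Y))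
      (e.hom.naturality (μ F X Y))

/-- The comparison functor is monoidal. -/
abbrev toCoalgMonoidal : (toCoalg adj e).Monoidal :=
  Functor.CoreMonoidal.toMonoidal
    { εIso := Comonad.Coalgebra.isoMk (Functor.Monoidal.εIso F) (toCoalg_ε adj e he)
      μIso := fun X Y => Comonad.Coalgebra.isoMk (Functor.Monoidal.μIso F X Y)
        (toCoalg_μ adj e he X Y)
      μIso_hom_natural_left := fun f X =>
        Comonad.Coalgebra.Hom.ext (μ_natural_left F f X)
      μIso_hom_natural_right := fun X f =>
        Comonad.Coalgebra.Hom.ext (μ_natural_right F X f)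
      associativity := fun X Y Z => Comonad.Coalgebra.Hom.ext (associativity F X Y Z)
      left_unitality := fun X => Comonad.Coalgebra.Hom.ext (left_unitality F X)
      right_unitality := fun X => Comonad.Coalgebra.Hom.ext (right_unitality F X) }

/-- The underlying functor of the comparison functor. -/
def toCoalgForget : toCoalg adj e ⋙ K.forget ≅ F := Iso.refl F

lemma toCoalgForget_isMonoidal :
    letI := toCoalgMonoidal adj e he
    NatTrans.IsMonoidal (toCoalgForget adj e).hom := by
  let := toCoalgMonoidal adj e he
  constructor
  · have h : ε (toCoalg adj e ⋙ K.forget) = 𝟙 _ ≫ ε F := rfl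
    rw [h, id_comp]
    exact comp_id _
  · intro X Y
    have h : μ (toCoalg adj e ⋙ K.forget) X Y = 𝟙 _ ≫ μ F X Y := rfl
    rw [h, id_comp]
    exact (comp_id _).trans ((congrArg (· ≫ μ F X Y) (id_tensorHom_id _ _)).trans (id_comp _)).symm
end
end

end
end HarishChandra


theorem mainTheorem2 (k : Type w) [Field k]
    (C : Type u) [Category.{v} C] [MonoidalCategory C] [PresentablyMonoidal C]
    [Preadditive C] [Linear k C] [MonoidalPreadditive C] [MonoidalLinear k C]
    [CpRigid k C] [UnitCP k C]
    (L : Center C) [MonObj L] [IsCommMonObj L]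
    (D : Type u') [Category.{v} D] [MonoidalCategory D] [PresentablyMonoidal D]
    [Preadditive D] [Linear k D] [MonoidalPreadditive D] [MonoidalLinear k D]
    (F : D ⥤ HC L) [F.Monoidal] [F.Additive] [F.Linear k]
    (FR : HC L ⥤ D) (adj : F ⊣ FR) [PreservesColimitsOfSize.{v, v} FR] :
    ∃ (B : HCBialgebroid k L) (e : adj.toComonad ≅ B.takeuchi),
      (letI : FR.LaxMonoidal := adj.rightAdjointLaxMonoidal;
        NatTrans.IsMonoidal (F₁ := FR ⋙ F) (F₂ := B.takeuchi.toFunctor) e.hom.toNatTrans) ∧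
      ∃ (G : D ⥤ B.CoMod) (_ : G.Monoidal) (i : G ⋙ B.takeuchi.forget ≅ F),
        NatTrans.IsMonoidal i.hom ∧
        (∀ d : D, (G.obj d).a ≫ B.takeuchi.map (i.hom.app d) =
          i.hom.app d ≫ F.map (adj.unit.app d) ≫ e.hom.app (F.obj d)) ∧
        (F.ReflectsIsomorphisms → PreservesLimitsOfShape WalkingParallelPair F →
          G.IsEquivalence) := by
  -- The right adjoint of a strong monoidal functor is lax monoidal, in such a way that unit and
  -- counit are monoidal.
  let := adj.rightAdjointLaxMonoidal
  have : FR.Additive := adj.right_adjoint_additive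
  have : FR.Linear k := rightAdjoint_linear k adj
  -- Density of the duals; this is where cp-rigidity of `C` is used.
  have := HC.isIso_unitAct k L
  have : PreservesColimitsOfSize.{v, v} F := adj.leftAdjoint_preservesColimits
  have : PreservesColimitsOfSize.{v, v} adj.toComonad.toFunctor :=
    inferInstanceAs (PreservesColimitsOfSize.{v, v} (FR ⋙ F))
  have : adj.toComonad.toFunctor.Additive := inferInstanceAs (FR ⋙ F).Additive
  have : adj.toComonad.toFunctor.Linear k := inferInstanceAs ((FR ⋙ F).Linear k)
  let B := HCBialgebroid.ofBialgebroid (ofComonad k adj.toComonad)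
  let e : adj.toComonad ≅ B.takeuchi := ofComonadIso k adj.toComonad
  have he : NatTrans.IsMonoidal (F₁ := FR ⋙ F) (F₂ := B.takeuchi.toFunctor) e.hom.toNatTrans :=
    ofComonadIso_hom_isMonoidal adj.toComonad
  refine ⟨B, e, he, toCoalg adj e, toCoalgMonoidal adj e he, toCoalgForget adj e,
    toCoalgForget_isMonoidal adj e he, fun d => ?_, fun _ _ => ?_⟩
  -- The isomorphism `G ⋙ forget ≅ F` is the identity, and the coaction of the comparison functor is
  -- by construction `F(η_d)` followed by `e`.
  · change (F.map (adj.unit.app d) ≫ e.hom.app (F.obj d)) ≫ B.takeuchi.map (𝟙 _) = 𝟙 _ ≫ _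
    rw [B.takeuchi.map_id, Category.comp_id, Category.id_comp]
  -- `G` is the comonadic comparison followed by the change of comonad along `e`, and both are
  -- equivalences.
  · have := comparison_isEquivalence D adj
    have := coalgFunctor_isEquivalence e
    exact inferInstanceAs (Comonad.comparison adj ⋙ coalgFunctor e.hom).IsEquivalence
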